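/- **Setting.** Let $T\ge 1$. For $1\le t\le T$ let $\mathcal U_t,\mathcal O_t,\mathcal W_t$ be standard Borel spaces (latent features, observed features, reward proxies), $\mathcal A_t$ a finite action space, and $\mathcal O_0$ a standard Borel space. A confounded decision process consists of transition kernels $\mathcal P_t(\cdot\mid u_{1:t},o_{1:t},a_{1:t})$ for $(U_{t+1},O_{t+1})$, a behavior policy $\pi^b_t(\cdot\mid u_{1:t},a_{1:t-1})\in\mathcal P(\mathcal A_t)$, and reward laws given $(u_{1:t},a_{1:t})$, all rewards being bounded by $R_{\max}$. The observed data, on a standard Borel probability space, are $O_0$ and $(U_t,O_t,W_t,A_t,R_t)_{t\le T}$ ($U_t$ is not available to the analyst), where given $(O_0,U_{1:t},O_{1:t},A_{1:t-1})$ the action $A_t$ is drawn from $\pi^b_t(\cdot\mid U_{1:t},A_{1:t-1})$, and given $(U_{1:t},O_{1:t},A_{1:t})$ the reward $R_t$ and the next features $(U_{t+1},O_{t+1})$ are drawn from the reward law and from $\mathcal P_t$. Put $\mathcal Z_t=\mathcal O_{1:t}\times\mathcal A_{1:t-1}$ and, in the data, $Z_t=(O_{1:t},A_{1:t-1})$.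 A super-policy $\nu=(\nu_t)\in\Omega$ consists of kernels $\nu_t(\cdot\mid o_{1:t},a^\nu_{1:t-1},a_{1:t})\in\mathcal P(\mathcal A_t)$. Under $\nu$, at time $t$ the behavior agent recommends $A_t\sim\pi^b_t(\cdot\mid U_{1:t},A^\nu_{1:t-1})$, then $A^\nu_t\sim\nu_t(\cdot\mid O_{1:t},A^\nu_{1:t-1},A_{1:t})$ is executed, and the reward and the next features are drawn given the features and the executed actions $A^\nu_{1:t}$. Write $E^\nu$ for the resulting expectation and $\mathcal V(\nu)=E[V^\nu_1(O_1,U_1)]$, $V_1^\nu(o_1,u_1)=E^\nu[\sum_{t=1}^T R_t\mid O_1=o_1,U_1=u_1]$. **Assumptions.** For $1\le t\le T$: 1. (Reward proxy) $W_t\perp A_t\mid (U_{1:t},O_{1:t},A_{1:t-1})$. 2. ($O_0$-independence) $(R_t,W_{t+1},W_t,O_{t+1},U_{t+1})\perp O_0\mid (U_{1:t},O_{1:t},A_{1:t})$ for $t<T$, and $(R_T,W_T)\perp O_0\mid(U_{1:T},O_{1:T},A_{1:T})$. 3. (Completeness) For every $a\in\mathcal A_t$: (a) for every $g$ such that $g(U_{1:t},Z_t)$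 is square-integrable given $A_t=a$, $E\{g(U_{1:t},Z_t)\mid Z_t,O_0,A_t=a\}=0$ a.s. if and only if $g(U_{1:t},Z_t)=0$ a.s.; (b) for every $g$ such that $g(Z_t,O_0)$ is square-integrable given $A_t=a$, $E\{g(Z_t,O_0)\mid W_t,Z_t,A_t=a\}=0$ a.s. if and only if $g(Z_t,O_0)=0$ a.s. Here the conditional expectations are taken under the law of the data given $A_t=a$, and "$g=0$ a.s." refers to the unconditional law of the data. 4. (Regularity, for the given $\nu$) There are classes $\mathbb G^{(t)}$, $1\le t\le T+1$, of measurable functions $g$ on $\mathcal W_t\times\mathcal Z_t\times\mathcal A_t$ with $E|g(W_t,Z_t,A_t)|<\infty$, with $\mathbb G^{(T+1)}=\{0\}$, such that, for $1\le t\le T$ and almost every value $(z,a)$ of $(Z_t,A_t)$, with $K_{z,a;t}:h\mapsto E\{h(W_t)\mid Z_t=z,O_0=\cdot,A_t=a\}$ as an operator from $L^2(W_t\mid Z_t=z,A_t=a)$ to $L^2(O_0\mid Z_t=z,A_t=a)$: - for every $g\in\mathbb G^{(t+1)}$, $f_g(o)=E\{R_t+g(W_{t+1},Z_{t+1},A_{t+1})\mid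 Z_t=z,O_0=o,A_t=a\}$ is in $L^2(O_0\mid Z_t=z,A_t=a)$; - $K_{z,a;t}$ has a singular system $(\lambda_n,\phi_n,\psi_n)_n$ (finite or infinite; the choice does not depend on $g$) with $\sum_n\lambda_n^{-2}|\langle f_g,\psi_n\rangle|^2<\infty$ for every $g\in\mathbb G^{(t+1)}$ (for each $g$, for almost every $(z,a)$); - whenever $g_{a_{1:t}}\in\mathbb G^{(t+1)}$ for all $a_{1:t}$ and the equation $(\ast)$ below with continuation $(g_{a_{1:t}})$ has a solution, it has a solution $q_t$ for which $v_t(\cdot,\cdot,(a_{1:t-1},\cdot))\in\mathbb G^{(t)}$ for all $a_{1:t-1}$, where $v_t(w,z,a_{1:t})=\sum_{a\in\mathcal A_t}q_t(w,z,a_{1:t},a)\,\nu_t(a\mid z,a_{1:t})$. **Equations.** For a family $(g_{a_{1:t}})_{a_{1:t}\in\mathcal A_{1:t}}$ of functions on $\mathcal W_{t+1}\times\mathcal Z_{t+1}\times\mathcal A_{t+1}$, a solution of the equation of stage $t$ is a measurable function $q_t$ of $(w,z,a_{1:t},a)$ with $q_t(\cdot,z,a_{1:t},a)\in L^2(W_t\mid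 Z_t=z,A_t=a)$ for almost every value $(z,a)$ of $(Z_t,A_t)$, not depending on $a_{1:T}$ if $t=T$, such that for all $a_{1:t}$ $$E\{q_t(W_t,Z_t,a_{1:t},A_t)-R_t-g_{a_{1:t}}(W_{t+1},Z_{t+1},A_{t+1})\mid Z_t,O_0,A_t\}=0\quad\text{a.s.}\qquad(\ast)$$ where for almost every value of $(Z_t,O_0,A_t)$ the integrand is integrable under the conditional law (and the $g$-term is absent for $t=T$). A solution of the backward system for $\nu$ is a family $(q_t^\nu)_{t\le T}$ such that, with $q^\nu_{T+1}=0$, for every $t\le T$ the function $q^\nu_t$ solves $(\ast)$ with continuation $$g_{a_{1:t}}(W_{t+1},Z_{t+1},A_{t+1})=\sum_{a}q^\nu_{t+1}(W_{t+1},Z_{t+1},(a_{1:t},A_{t+1}),a)\,\nu_{t+1}(a\mid Z_{t+1},(a_{1:t},A_{t+1})),$$ and $v_t(W_t,Z_t,(a_{1:t-1},A_t))$ (formed with $q_t^\nu$) is integrable for all $a_{1:t-1}$. **Theorem.** Let $\nu\in\Omega$ be a super-policy and suppose that assumptions 1–4 hold. (i) For every $t\le T$ and all $g_{a_{1:t}}\in\mathbb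 G^{(t+1)}$, $a_{1:t}\in\mathcal A_{1:t}$, equation $(\ast)$ has a solution, and the backward system for $\nu$ has a solution, which can be chosen with $v_t(\cdot,\cdot,(a_{1:t-1},\cdot))\in\mathbb G^{(t)}$ for all $t\le T$ and $a_{1:t-1}$. (ii) Every solution $(q^\nu_t)_{t\le T}$ of the backward system is a family of Q-bridge functions: for all $t\le T$ and $a_{1:t}\in\mathcal A_{1:t}$, for almost every value $(u_{1:t},o_{1:t},\bar a_{1:t-1})$ of $(U_{1:t},O_{1:t},A_{1:t-1})$, $$E^{\nu}\Big[\sum_{t'=t}^T R_{t'}\,\Big|\,U_{1:t}=u_{1:t},O_{1:t}=o_{1:t},A^\nu_{1:t-1}=\bar a_{1:t-1},A_{1:t}=a_{1:t}\Big]=E\Big[\sum_{a}q^\nu_t(W_t,Z_t,a_{1:t},a)\,\nu_t(a\mid Z_t,a_{1:t})\,\Big|\,U_{1:t}=u_{1:t},O_{1:t}=o_{1:t},A_{1:t-1}=\bar a_{1:t-1}\Big],$$ where the expectation on the right exists. (iii) For every solution of the backward system, $\mathcal V(\nu)=E\big[\sum_{a\in\mathcal A_1}q_1^\nu(W_1,O_1,A_1,a)\,\nu_1(a\mid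 O_1,A_1)\big]$. -/

import Mathlib

open MeasureTheory ProbabilityTheory
open scoped ENNReal

namespace SuperRL

/-! ## Histories

Decision stages are numbered `0, 1, …, N`, so that the horizon is `T = N + 1 ≥ 1`; spaces may vary
with the stage. A history `Hist X t` holds the first `t` entries `X 0, …, X (t - 1)`. At stage `t`
the observations up to now are a `Hist O (t + 1)`, the past actions a `Hist A t`. Families are
indexed by `ℕ` for convenience; nothing after stage `N` has any influence. -/

/-- The first `t` entries of a sequence with values in `X 0, X 1, …`. -/
abbrev Hist (X : ℕ → Type*) (t : ℕ) := (i : Fin t) → X i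

/-- Append the entry of index `t`. -/
def snoc {X : ℕ → Type*} {t : ℕ} (h : Hist X t) (x : X t) : Hist X (t + 1) :=
  Fin.snoc (α := fun i : Fin (t + 1) => X i) h x

/-- The empty history. -/
def emptyHist (X : ℕ → Type*) : Hist X 0 := fun i => i.elim0

theorem measurable_snoc {X : ℕ → Type*} [∀ t, MeasurableSpace (X t)] {t : ℕ} :
    Measurable (fun p : Hist X t × X t => snoc p.1 p.2) := by
  refine measurable_pi_iff.2 fun i => ?_
  refine Fin.lastCases ?_ (fun j => ?_) i
  · simpa [snoc] using measurable_snd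
  · have h : Measurable (fun p : Hist X t × X t => p.1 j) :=
      (measurable_pi_apply j).comp measurable_fst
    simpa [snoc] using h

@[fun_prop]
theorem Measurable.snoc' {X : ℕ → Type*} [∀ t, MeasurableSpace (X t)] {t : ℕ} {α : Type*}
    [MeasurableSpace α] {f : α → Hist X t} {g : α → X t} (hf : Measurable f) (hg : Measurable g) :
    Measurable (fun x => snoc (f x) (g x)) :=
  measurable_snoc.comp (hf.prodMk hg)

/-- The space of `Z_t = (O_{1:t}, A_{1:t-1})`: all observations, and the past *executed* actions. -/
abbrev ZSp (O A : ℕ → Type*) (t : ℕ) := Hist O (t + 1) × Hist A t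

/-- A decision node of stage `t`, just before the action of stage `t` is executed: latent features,
observed features, past executed actions, and the actions recommended by the behavior agent up to
and including stage `t`. -/
abbrev Node (U O A : ℕ → Type*) (t : ℕ) :=
  Hist U (t + 1) × Hist O (t + 1) × Hist A t × Hist A (t + 1)

noncomputable section

/-! ## The confounded decision process and super-policies -/

/-- The confounded process: transition kernels for the pair of latent and observed features, a
behavior policy that sees the latent features and the past (executed) actions, and rewards whose law
depends on the latent features and the executed actions, uniformly bounded by `rmax`. -/
structure ConfoundedProcess (U O A : ℕ → Type*) [∀ t, MeasurableSpace (U t)]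
    [∀ t, MeasurableSpace (O t)] [∀ t, MeasurableSpace (A t)] where
  trans : ∀ t, Kernel (Hist U (t + 1) × Hist O (t + 1) × Hist A (t + 1)) (U (t + 1) × O (t + 1))
  behavior : ∀ t, Kernel (Hist U (t + 1) × Hist A t) (A t)
  reward : ∀ t, Kernel (Hist U (t + 1) × Hist A (t + 1)) ℝ
  rmax : ℝ
  markov_trans : ∀ t, IsMarkovKernel (trans t)
  markov_behavior : ∀ t, IsMarkovKernel (behavior t)
  markov_reward : ∀ t, IsMarkovKernel (reward t)
  reward_bdd : ∀ t h, ∀ᵐ r ∂(reward t h), |r| ≤ rmax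

attribute [instance] ConfoundedProcess.markov_trans ConfoundedProcess.markov_behavior
  ConfoundedProcess.markov_reward

/-- A super-policy: `ν_t (· | o_{1:t}, a^ν_{1:t-1}, a_{1:t})`, where `a^ν` are the actions executed so
far and `a` the actions recommended by the behavior agent, the current one included. -/
structure SuperPolicy (O A : ℕ → Type*) [∀ t, MeasurableSpace (O t)]
    [∀ t, MeasurableSpace (A t)] where
  act : ∀ t, Kernel (ZSp O A t × Hist A (t + 1)) (A t)
  markov_act : ∀ t, IsMarkovKernel (act t)

attribute [instance] SuperPolicy.markov_act

/-- The probability `ν_t (a | z, a_{1:t})`. -/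
def SuperPolicy.prob {O A : ℕ → Type*} [∀ t, MeasurableSpace (O t)] [∀ t, MeasurableSpace (A t)]
    (ν : SuperPolicy O A) (t : ℕ) (z : ZSp O A t) (rec : Hist A (t + 1)) (a : A t) : ℝ :=
  (ν.act t (z, rec)).real {a}

section Intervention

variable {U O A : ℕ → Type*} [∀ t, MeasurableSpace (U t)] [∀ t, MeasurableSpace (O t)]
  [∀ t, MeasurableSpace (A t)]

/-- The action executed by `ν` at a decision node. -/
def actKernel (ν : SuperPolicy O A) (t : ℕ) : Kernel (Node U O A t) (A t) :=
  (ν.act t).comap (fun h => ((h.2.1, h.2.2.1), h.2.2.2)) (by fun_prop)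

/-- The reward after action `a` is executed at the node `h`. -/
def rewardKernel (M : ConfoundedProcess U O A) (t : ℕ) : Kernel (Node U O A t × A t) ℝ :=
  (M.reward t).comap (fun x => (x.1.1, snoc x.1.2.2.1 x.2)) (by fun_prop)

/-- The next features after action `a` is executed at the node `h`. -/
def transKernel (M : ConfoundedProcess U O A) (t : ℕ) :
    Kernel (Node U O A t × A t) (U (t + 1) × O (t + 1)) :=
  (M.trans t).comap (fun x => (x.1.1, x.1.2.1, snoc x.1.2.2.1 x.2)) (by fun_prop)

/-- The next recommendation of the behavior agent, who has seen the executed actions. -/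
def recKernel (M : ConfoundedProcess U O A) (t : ℕ) :
    Kernel ((Node U O A t × A t) × (U (t + 1) × O (t + 1))) (A (t + 1)) :=
  (M.behavior (t + 1)).comap
    (fun y => (snoc y.1.1.1 y.2.1, snoc y.1.1.2.2.1 y.1.2)) (by fun_prop)

/-- Assemble the next node from the present one, the executed action, the new features and the new
recommendation. -/
def nextNode (t : ℕ)
    (p : (Node U O A t × A t) × ((U (t + 1) × O (t + 1)) × A (t + 1))) : Node U O A (t + 1) :=
  (snoc p.1.1.1 p.2.1.1, snoc p.1.1.2.1 p.2.1.2, snoc p.1.1.2.2.1 p.1.2,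
    snoc p.1.1.2.2.2 p.2.2)

theorem measurable_nextNode (t : ℕ) : Measurable (nextNode (U := U) (O := O) (A := A) t) := by
  unfold nextNode
  fun_prop

/-- The law of the next node. -/
def nextKernel (M : ConfoundedProcess U O A) (t : ℕ) :
    Kernel (Node U O A t × A t) (Node U O A (t + 1)) :=
  (Kernel.id ×ₖ (transKernel M t ⊗ₖ recKernel M t)).map (nextNode t)

instance (ν : SuperPolicy O A) (t : ℕ) :
    IsMarkovKernel (actKernel (U := U) ν t) := by
  unfold actKernel; infer_instance

instance (M : ConfoundedProcess U O A) (t : ℕ) : IsMarkovKernel (rewardKernel M t) := by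
  unfold rewardKernel; infer_instance

instance (M : ConfoundedProcess U O A) (t : ℕ) : IsMarkovKernel (transKernel M t) := by
  unfold transKernel; infer_instance

instance (M : ConfoundedProcess U O A) (t : ℕ) : IsMarkovKernel (recKernel M t) := by
  unfold recKernel; infer_instance

instance (M : ConfoundedProcess U O A) (t : ℕ) : IsMarkovKernel (nextKernel M t) := by
  unfold nextKernel; exact Kernel.IsMarkovKernel.map _ (measurable_nextNode t)

/-- `returnLaw M ν n t h` is the law of the return `R_t + R_{t+1} + ⋯ + R_{t+n}` when the process
is at the node `h` of stage `t` and the actions of stages `t, …, t + n` are executed by `ν`, while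
the behavior agent keeps giving recommendations. -/
def returnLaw (M : ConfoundedProcess U O A) (ν : SuperPolicy O A) :
    (n : ℕ) → (t : ℕ) → Kernel (Node U O A t) ℝ
  | 0, t => rewardKernel M t ∘ₖ (Kernel.id ×ₖ actKernel ν t)
  | n + 1, t =>
      ((rewardKernel M t ×ₖ (returnLaw M ν n (t + 1) ∘ₖ nextKernel M t)).map
        (fun p : ℝ × ℝ => p.1 + p.2)) ∘ₖ (Kernel.id ×ₖ actKernel ν t)

instance (M : ConfoundedProcess U O A) (ν : SuperPolicy O A) (n t : ℕ) :
    IsMarkovKernel (returnLaw M ν n t) := by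
  induction n generalizing t with
  | zero => unfold returnLaw; infer_instance
  | succ n ih =>
    unfold returnLaw
    have := ih (t + 1)
    have := Kernel.IsMarkovKernel.map
      (rewardKernel M t ×ₖ (returnLaw M ν n (t + 1) ∘ₖ nextKernel M t))
      (f := fun p : ℝ × ℝ => p.1 + p.2) (by fun_prop)
    infer_instance

/-- `E^ν [∑_{t' ≥ t} R_{t'} | U_{1:t}, O_{1:t}, A^ν_{1:t-1}, A_{1:t}]` at a node, for last stage
`N`. -/
def expReturn (M : ConfoundedProcess U O A) (ν : SuperPolicy O A) (N t : ℕ)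
    (h : Node U O A t) : ℝ :=
  ∫ r, r ∂(returnLaw M ν (N - t) t h)

/-- The value function `V_1^ν (o_1, u_1)` at the first stage: the first recommendation is drawn from
the behavior policy, then `ν` acts. -/
def stateValue (M : ConfoundedProcess U O A) (ν : SuperPolicy O A) (N : ℕ)
    (u : Hist U 1) (o : Hist O 1) : ℝ :=
  ∫ a, expReturn M ν N 0 (u, o, emptyHist A, snoc (emptyHist A) a) ∂(M.behavior 0 (u, emptyHist A))

end Intervention

/-! ## Conditional laws -/

/-- The regular conditional law of everything given `X`; thus
`∫ ω, Y ω ∂(condLaw P X x)` is `E [Y | X = x]`. -/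
def condLaw {Ω α : Type*} [MeasurableSpace Ω] [StandardBorelSpace Ω] [Nonempty Ω]
    [MeasurableSpace α] (P : Measure Ω) [IsFiniteMeasure P] (X : Ω → α) : Kernel α Ω :=
  condDistrib id X P

/-- `E [Y | X = x] = f x` for almost every `x`, where the expectation of `Y` exists under almost every
conditional law. -/
def CondMeanEq {Ω α : Type*} [MeasurableSpace Ω] [StandardBorelSpace Ω] [Nonempty Ω]
    [MeasurableSpace α] (P : Measure Ω) [IsFiniteMeasure P] (X : Ω → α) (Y : Ω → ℝ)
    (f : α → ℝ) : Prop :=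
  ∀ᵐ x ∂(P.map X), Integrable Y (condLaw P X x) ∧ ∫ ω, Y ω ∂(condLaw P X x) = f x

/-! ## The observed data -/

/-- The variables of the offline data: the pre-collected observation `O_0` (here `obs0`), latent and
observed features, behavior actions, rewards, and reward proxies. -/
structure Data (Ω O₀ : Type*) (U O A W : ℕ → Type*) [MeasurableSpace Ω] [MeasurableSpace O₀]
    [∀ t, MeasurableSpace (U t)] [∀ t, MeasurableSpace (O t)] [∀ t, MeasurableSpace (A t)]
    [∀ t, MeasurableSpace (W t)] where
  obs0 : Ω → O₀
  lat : ∀ t, Ω → U t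
  obs : ∀ t, Ω → O t
  action : ∀ t, Ω → A t
  rew : ℕ → Ω → ℝ
  proxy : ∀ t, Ω → W t
  measurable_obs0 : Measurable obs0
  measurable_lat : ∀ t, Measurable (lat t)
  measurable_obs : ∀ t, Measurable (obs t)
  measurable_action : ∀ t, Measurable (action t)
  measurable_rew : ∀ t, Measurable (rew t)
  measurable_proxy : ∀ t, Measurable (proxy t)

namespace Data

variable {Ω O₀ : Type*} {U O A W : ℕ → Type*} [MeasurableSpace Ω] [MeasurableSpace O₀]
  [∀ t, MeasurableSpace (U t)] [∀ t, MeasurableSpace (O t)] [∀ t, MeasurableSpace (A t)]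
  [∀ t, MeasurableSpace (W t)] (D : Data Ω O₀ U O A W)

/-- The first `t` latent features. -/
def latHist (t : ℕ) (ω : Ω) : Hist U t := fun i => D.lat i ω

/-- The first `t` observed features. -/
def obsHist (t : ℕ) (ω : Ω) : Hist O t := fun i => D.obs i ω

/-- The first `t` behavior actions. -/
def actHist (t : ℕ) (ω : Ω) : Hist A t := fun i => D.action i ω

/-- `Z_t = (O_{1:t}, A_{1:t-1})` in the data. -/
def Z (t : ℕ) (ω : Ω) : ZSp O A t := (D.obsHist (t + 1) ω, D.actHist t ω)

/-- `(U_{1:t}, O_{1:t}, A_{1:t-1})`: the past before the action of stage `t`. -/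
def pre (t : ℕ) (ω : Ω) : Hist U (t + 1) × ZSp O A t := (D.latHist (t + 1) ω, D.Z t ω)

/-- `(U_{1:t}, O_{1:t}, A_{1:t})`: the past after the action of stage `t`. -/
def post (t : ℕ) (ω : Ω) : Hist U (t + 1) × Hist O (t + 1) × Hist A (t + 1) :=
  (D.latHist (t + 1) ω, D.obsHist (t + 1) ω, D.actHist (t + 1) ω)

@[fun_prop]
theorem measurable_latHist (t : ℕ) : Measurable (D.latHist t) :=
  measurable_pi_iff.2 fun i => D.measurable_lat i

@[fun_prop]
theorem measurable_obsHist (t : ℕ) : Measurable (D.obsHist t) :=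
  measurable_pi_iff.2 fun i => D.measurable_obs i

@[fun_prop]
theorem measurable_actHist (t : ℕ) : Measurable (D.actHist t) :=
  measurable_pi_iff.2 fun i => D.measurable_action i

@[fun_prop]
theorem measurable_Z (t : ℕ) : Measurable (D.Z t) :=
  (D.measurable_obsHist _).prodMk (D.measurable_actHist _)

theorem measurable_pre (t : ℕ) : Measurable (D.pre t) :=
  (D.measurable_latHist _).prodMk (D.measurable_Z _)

theorem measurable_post (t : ℕ) : Measurable (D.post t) :=
  (D.measurable_latHist _).prodMk ((D.measurable_obsHist _).prodMk (D.measurable_actHist _))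

/-- The data come from the process `M` run by its behavior policy: each action is drawn from the
behavior policy given all that precedes it (the pre-collected observation included), the reward and
the next features are drawn from the kernels of `M` given the features and actions so far. -/
structure GeneratedBy (M : ConfoundedProcess U O A) (P : Measure Ω) (N : ℕ) : Prop where
  action_law : ∀ t ≤ N,
    P.map (fun ω => ((D.obs0 ω, D.pre t ω), D.action t ω)) =
      (P.map (fun ω => (D.obs0 ω, D.pre t ω))) ⊗ₘ
        (M.behavior t).comap (fun x : O₀ × (Hist U (t + 1) × ZSp O A t) => (x.2.1, x.2.2.2))
          (by fun_prop)
  reward_law : ∀ t ≤ N,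
    P.map (fun ω => (D.post t ω, D.rew t ω)) =
      (P.map (D.post t)) ⊗ₘ
        (M.reward t).comap
          (fun x : Hist U (t + 1) × Hist O (t + 1) × Hist A (t + 1) => (x.1, x.2.2)) (by fun_prop)
  trans_law : ∀ t < N,
    P.map (fun ω => (D.post t ω, (D.lat (t + 1) ω, D.obs (t + 1) ω))) =
      (P.map (D.post t)) ⊗ₘ M.trans t

/-- The policy value `V(ν) = E [V_1^ν (O_1, U_1)]`. -/
def value (M : ConfoundedProcess U O A) (P : Measure Ω) (ν : SuperPolicy O A) (N : ℕ) : ℝ :=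
  ∫ ω, stateValue M ν N (D.latHist 1 ω) (D.obsHist 1 ω) ∂P

variable [StandardBorelSpace Ω] (P : Measure Ω) [IsProbabilityMeasure P]

/-- Reward proxies: `W_t ⊥ A_t | U_{1:t}, O_{1:t}, A_{1:t-1}`. -/
def RewardProxy (N : ℕ) : Prop :=
  ∀ t ≤ N, D.proxy t ⟂ᵢ[D.pre t, D.measurable_pre t; P] D.action t

/-- `(R_t, W_{t+1}, W_t, O_{t+1}, U_{t+1}) ⊥ O_0 | U_{1:t}, O_{1:t}, A_{1:t}`; at the last stage,
where there are no next variables, `(R_t, W_t) ⊥ O_0 | U_{1:t}, O_{1:t}, A_{1:t}`. -/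
structure InitialObsIndep (N : ℕ) : Prop where
  before_last : ∀ t < N,
    (fun ω => (D.rew t ω, D.proxy (t + 1) ω, D.proxy t ω, D.obs (t + 1) ω, D.lat (t + 1) ω))
      ⟂ᵢ[D.post t, D.measurable_post t; P] D.obs0
  last : (fun ω => (D.rew N ω, D.proxy N ω)) ⟂ᵢ[D.post N, D.measurable_post N; P] D.obs0

variable [Nonempty Ω]

/-- Completeness for the latent features: for every action `a` and every `g` with `g(U_{1:t}, Z_t)`
square-integrable given `A_t = a`, `E {g(U_{1:t}, Z_t) | Z_t, O_0, A_t = a} = 0` a.s. if and only if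
`g(U_{1:t}, Z_t) = 0` a.s. The conditional expectation is taken under the law of the data given
`A_t = a`; the last "almost surely" is under the law of the data itself. -/
def CompleteLatent (N : ℕ) : Prop :=
  ∀ t ≤ N, ∀ (a : A t) (g : Hist U (t + 1) × ZSp O A t → ℝ), Measurable g →
    MemLp (fun ω => g (D.pre t ω)) 2 (P[|D.action t ⁻¹' {a}]) →
    ((P[|D.action t ⁻¹' {a}])[(fun ω => g (D.pre t ω)) |
          MeasurableSpace.comap (fun ω => (D.Z t ω, D.obs0 ω)) inferInstance]
        =ᵐ[P[|D.action t ⁻¹' {a}]] 0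
      ↔ ∀ᵐ ω ∂P, g (D.pre t ω) = 0)

/-- Completeness for the pre-collected observation: for every action `a` and every `g` with
`g(Z_t, O_0)` square-integrable given `A_t = a`, `E {g(Z_t, O_0) | W_t, Z_t, A_t = a} = 0` a.s. if and
only if `g(Z_t, O_0) = 0` a.s. -/
def CompleteObs (N : ℕ) : Prop :=
  ∀ t ≤ N, ∀ (a : A t) (g : ZSp O A t × O₀ → ℝ), Measurable g →
    MemLp (fun ω => g (D.Z t ω, D.obs0 ω)) 2 (P[|D.action t ⁻¹' {a}]) →
    ((P[|D.action t ⁻¹' {a}])[(fun ω => g (D.Z t ω, D.obs0 ω)) |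
          MeasurableSpace.comap (fun ω => (D.proxy t ω, D.Z t ω)) inferInstance]
        =ᵐ[P[|D.action t ⁻¹' {a}]] 0
      ↔ ∀ᵐ ω ∂P, g (D.Z t ω, D.obs0 ω) = 0)

/-! ### The integral equations -/

/-- `(Z_t, A_t)`. -/
def ZA (t : ℕ) (ω : Ω) : ZSp O A t × A t := (D.Z t ω, D.action t ω)

/-- `(Z_t, O_0, A_t)`. -/
def ZOA (t : ℕ) (ω : Ω) : ZSp O A t × O₀ × A t := (D.Z t ω, D.obs0 ω, D.action t ω)

/-- `(W_t, Z_t, A_t)`. -/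
def WZA (t : ℕ) (ω : Ω) : W t × ZSp O A t × A t := (D.proxy t ω, D.Z t ω, D.action t ω)

end Data

/-- The type of `q_t (w, z, a_{1:t}, a)`. -/
abbrev QFun (O A W : ℕ → Type*) (t : ℕ) := W t → ZSp O A t → Hist A (t + 1) → A t → ℝ

/-- `v_t (w, z, a_t) = ∑_a q_t (w, z, (a_{1:t-1}, a_t), a) ν_t (a | z, (a_{1:t-1}, a_t))` for fixed
past recommendations `a_{1:t-1}`. -/
def vFun {O A W : ℕ → Type*} [∀ t, MeasurableSpace (O t)] [∀ t, MeasurableSpace (A t)]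
    [∀ t, Fintype (A t)] (ν : SuperPolicy O A) (t : ℕ) (q : QFun O A W t) (rec : Hist A t) :
    W t × ZSp O A t × A t → ℝ :=
  fun x => ∑ a, q x.1 x.2.1 (snoc rec x.2.2) a * ν.prob t x.2.1 (snoc rec x.2.2) a

namespace Data

variable {Ω O₀ : Type*} {U O A W : ℕ → Type*} [MeasurableSpace Ω] [StandardBorelSpace Ω]
  [Nonempty Ω] [MeasurableSpace O₀]
  [∀ t, MeasurableSpace (U t)] [∀ t, MeasurableSpace (O t)] [∀ t, MeasurableSpace (A t)]
  [∀ t, MeasurableSpace (W t)] [∀ t, Fintype (A t)]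
  (D : Data Ω O₀ U O A W) (P : Measure Ω) [IsProbabilityMeasure P]

/-- `q` solves the integral equation of stage `t` with continuation `g`: for every `a_{1:t}`,
`E {q (W_t, Z_t, a_{1:t}, A_t) - R_t - g_{a_{1:t}} (W_{t+1}, Z_{t+1}, A_{t+1}) | Z_t, O_0, A_t} = 0`.
As an unknown of this equation, `q (·, z, a_{1:t}, a)` is a member of
`L² (W_t | Z_t = z, A_t = a)`. At the last stage `q` does not depend on `a_{1:t}`. -/
structure SolvesStage (N t : ℕ) (q : QFun O A W t)
    (g : Hist A (t + 1) → W (t + 1) × ZSp O A (t + 1) × A (t + 1) → ℝ) : Prop where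
  measurable : ∀ rec a, Measurable (fun p : W t × ZSp O A t => q p.1 p.2 rec a)
  memLp : ∀ rec, ∀ᵐ x ∂(P.map (D.ZA t)),
    MemLp (fun ω => q (D.proxy t ω) x.1 rec x.2) 2 (condLaw P (D.ZA t) x)
  last : t = N → ∀ w z rec rec' a, q w z rec a = q w z rec' a
  equation : ∀ rec, CondMeanEq P (D.ZOA t)
    (fun ω => q (D.proxy t ω) (D.Z t ω) rec (D.action t ω) - D.rew t ω
      - g rec (D.WZA (t + 1) ω)) 0

/-- `q_1, …, q_T` solves the backward system: `q_{T+1} = 0`, and each `q_t` solves its equation with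
the continuation `∑_a q_{t+1} (W_{t+1}, Z_{t+1}, (a_{1:t}, A_{t+1}), a)
ν_{t+1} (a | Z_{t+1}, (a_{1:t}, A_{t+1}))`, whose expectation has to exist. -/
structure SolvesSystem (ν : SuperPolicy O A) (N : ℕ) (q : ∀ t, QFun O A W t) : Prop where
  terminal : q (N + 1) = 0
  stage : ∀ t ≤ N, D.SolvesStage P N t (q t) (vFun ν (t + 1) (q (t + 1)))
  integrable : ∀ t ≤ N, ∀ rec, Integrable (fun ω => vFun ν t (q t) rec (D.WZA t ω)) P

/-- `q` is a family of Q-bridge functions for `ν`: for every `a_{1:t}`,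
`E^ν [∑_{t' ≥ t} R_{t'} | U_{1:t}, O_{1:t}, A^ν_{1:t-1}, A_{1:t} = a_{1:t}]
  = E [∑_a q_t (W_t, Z_t, a_{1:t}, a) ν_t (a | Z_t, a_{1:t}) | U_{1:t}, O_{1:t}, A^ν_{1:t-1}]`
almost surely, and `q_T` does not depend on `a_{1:T}`. -/
structure IsQBridge (M : ConfoundedProcess U O A) (ν : SuperPolicy O A) (N : ℕ)
    (q : ∀ t, QFun O A W t) : Prop where
  bridge : ∀ t ≤ N, ∀ rec : Hist A (t + 1), CondMeanEq P (D.pre t)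
    (fun ω => ∑ a, q t (D.proxy t ω) (D.Z t ω) rec a * ν.prob t (D.Z t ω) rec a)
    (fun x => expReturn M ν N t (x.1, x.2.1, x.2.2, rec))
  last : ∀ w z rec rec' a, q N w z rec a = q N w z rec' a

/-! ### Regularity -/

/-- The operator `K_{z,a;t}`: `h ↦ E {h (W_t) | Z_t = z, O_0 = ·, A_t = a}`, here `x = (z, a)`. -/
def proxyOp (t : ℕ) (x : ZSp O A t × A t) (h : W t → ℝ) : O₀ → ℝ :=
  fun o => ∫ ω, h (D.proxy t ω) ∂(condLaw P (D.ZOA t) (x.1, o, x.2))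

/-- The inner product of `L² (W_t | Z_t = z, A_t = a)`. -/
def innerW (t : ℕ) (x : ZSp O A t × A t) (h h' : W t → ℝ) : ℝ :=
  ∫ ω, h (D.proxy t ω) * h' (D.proxy t ω) ∂(condLaw P (D.ZA t) x)

/-- The inner product of `L² (O_0 | Z_t = z, A_t = a)`. -/
def innerO (t : ℕ) (x : ZSp O A t × A t) (f f' : O₀ → ℝ) : ℝ :=
  ∫ ω, f (D.obs0 ω) * f' (D.obs0 ω) ∂(condLaw P (D.ZA t) x)

/-- Membership in `L² (W_t | Z_t = z, A_t = a)`. -/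
def MemW (t : ℕ) (x : ZSp O A t × A t) (h : W t → ℝ) : Prop :=
  Measurable h ∧ MemLp (fun ω => h (D.proxy t ω)) 2 (condLaw P (D.ZA t) x)

/-- Membership in `L² (O_0 | Z_t = z, A_t = a)`. -/
def MemO (t : ℕ) (x : ZSp O A t × A t) (f : O₀ → ℝ) : Prop :=
  Measurable f ∧ MemLp (fun ω => f (D.obs0 ω)) 2 (condLaw P (D.ZA t) x)

end Data

/-- Candidate for a singular system: positive numbers `val n` and functions `left n`, `right n`,
for `n` in a finite or infinite set `idx` of indices. -/
structure SingularData (𝒲 𝒪 : Type*) where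
  idx : Set ℕ
  val : ℕ → ℝ
  left : ℕ → 𝒲 → ℝ
  right : ℕ → 𝒪 → ℝ

namespace Data

variable {Ω O₀ : Type*} {U O A W : ℕ → Type*} [MeasurableSpace Ω] [StandardBorelSpace Ω]
  [Nonempty Ω] [MeasurableSpace O₀]
  [∀ t, MeasurableSpace (U t)] [∀ t, MeasurableSpace (O t)] [∀ t, MeasurableSpace (A t)]
  [∀ t, MeasurableSpace (W t)]
  (D : Data Ω O₀ U O A W) (P : Measure Ω) [IsProbabilityMeasure P]

/-- `S` is a singular system `(λ_n, φ_n, ψ_n)` of `K = K_{z,a;t}`: orthonormal `φ_n` and `ψ_n` with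
`K φ_n = λ_n ψ_n` and `K^* ψ_n = λ_n φ_n`, and `K` vanishes on the orthogonal complement of the
`φ_n`. -/
structure IsSingularSystem (t : ℕ) (x : ZSp O A t × A t) (S : SingularData (W t) O₀) : Prop where
  pos : ∀ n ∈ S.idx, 0 < S.val n
  memW : ∀ n ∈ S.idx, D.MemW P t x (S.left n)
  memO : ∀ n ∈ S.idx, D.MemO P t x (S.right n)
  orthoW : ∀ n ∈ S.idx, ∀ m ∈ S.idx,
    D.innerW P t x (S.left n) (S.left m) = if n = m then 1 else 0
  orthoO : ∀ n ∈ S.idx, ∀ m ∈ S.idx,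
    D.innerO P t x (S.right n) (S.right m) = if n = m then 1 else 0
  map_left : ∀ n ∈ S.idx, ∀ᵐ ω ∂(condLaw P (D.ZA t) x),
    D.proxyOp P t x (S.left n) (D.obs0 ω) = S.val n * S.right n (D.obs0 ω)
  adjoint_right : ∀ n ∈ S.idx, ∀ h, D.MemW P t x h →
    D.innerO P t x (D.proxyOp P t x h) (S.right n) = S.val n * D.innerW P t x h (S.left n)
  ker : ∀ h, D.MemW P t x h → (∀ n ∈ S.idx, D.innerW P t x h (S.left n) = 0) →
    ∀ᵐ ω ∂(condLaw P (D.ZA t) x), D.proxyOp P t x h (D.obs0 ω) = 0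

/-- The right-hand side `o ↦ E {R_t + g (W_{t+1}, Z_{t+1}, A_{t+1}) | Z_t = z, O_0 = o, A_t = a}`. -/
def target (t : ℕ) (g : W (t + 1) × ZSp O A (t + 1) × A (t + 1) → ℝ)
    (x : ZSp O A t × A t) : O₀ → ℝ :=
  fun o => ∫ ω, (D.rew t ω + g (D.WZA (t + 1) ω)) ∂(condLaw P (D.ZOA t) (x.1, o, x.2))

/-- The regularity conditions, for classes `G t` of functions of `(W_t, Z_t, A_t)` with finite
expectation. Statements about `(z, a)` hold for almost every value of `(Z_t, A_t)`.
* `square_integrable`: the right-hand sides are in `L² (O_0 | Z_t = z, A_t = a)`;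
* `picard`: the operators have singular systems, one for each `(z, a)`, such that
  `∑_n λ_n⁻² ⟨E {R_t + g | z, ·, a}, ψ_n⟩² < ∞` for all `g` in the class of stage `t + 1`;
* `closed`: `v_t` stays in the class, that is, if an equation of stage `t` with continuation from the
  class of stage `t + 1` has a solution at all, then it has one for which `v_t` is in the class of
  stage `t`. -/
structure Regular [∀ t, Fintype (A t)] (ν : SuperPolicy O A) (N : ℕ)
    (G : ∀ t, Set (W t × ZSp O A t × A t → ℝ)) : Prop where
  terminal : G (N + 1) = {0}
  measurable : ∀ t ≤ N, ∀ g ∈ G t, Measurable g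
  integrable : ∀ t ≤ N, ∀ g ∈ G t, Integrable (fun ω => g (D.WZA t ω)) P
  square_integrable : ∀ t ≤ N, ∀ g ∈ G (t + 1),
    ∀ᵐ x ∂(P.map (D.ZA t)), D.MemO P t x (D.target P t g x)
  picard : ∀ t ≤ N, ∃ S : ZSp O A t × A t → SingularData (W t) O₀,
    (∀ᵐ x ∂(P.map (D.ZA t)), D.IsSingularSystem P t x (S x)) ∧
    ∀ g ∈ G (t + 1), ∀ᵐ x ∂(P.map (D.ZA t)),
      Summable (fun n : (S x).idx =>
        ((S x).val n)⁻¹ ^ 2 * D.innerO P t x (D.target P t g x) ((S x).right n) ^ 2)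
  closed : ∀ t ≤ N, ∀ g : Hist A (t + 1) → W (t + 1) × ZSp O A (t + 1) × A (t + 1) → ℝ,
    (∀ rec, g rec ∈ G (t + 1)) → (∃ q, D.SolvesStage P N t q g) →
      ∃ q, D.SolvesStage P N t q g ∧ ∀ rec, vFun ν t q rec ∈ G t

end Data

end

end SuperRL

/-! Two independent arguments are combined: solvability of the integral equations, and transfer of
their solutions from the observables to the latent past.

Solvability. For fixed (z, a) the equation reads K q = f with K = K_{z,a;t}. With a singular system,
the Picard condition provides p = ∑ λ_n⁻¹ ⟪f, ψ_n⟫ φ_n with K^*(f - K p) = 0, hence ⟪f, K h⟫ = ⟪p,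
K^* K h⟫. Solving fibre by fibre is not enough: q must be measurable in (z, a), the singular systems
carry no measurability in (z, a), and completeness concerns functions of (Z_t, O_0) jointly. What
survives is the bound |⟪f, K h⟫| ≤ C ‖K^* K h‖ in almost every fibre. Testing it on a countable
dense set of global functions gives a constant measurable in (z, a). Dividing f by this constant and
by its fibre norm gives a global L² function that satisfies the bound with constant 1. Completeness
for O_0 makes the global adjoint injective, so the range of the global K is dense and the
Hahn–Banach range criterion gives a global solution; multiplying back gives q. This is
`exists_measurable_solution`, and `Data.exists_solvesSystem` iterates it backwards, with the closure
condition keeping v_t in the class.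

Bridge property. By the reward-proxy assumption and the O_0-independence, the law of W_t given
(U_{1:t}, O_{1:t}, A_{1:t}, O_0) depends on the past before A_t only, and the laws of the reward and
of the next features do not involve O_0. Hence the conditional mean of the residual of the equation
given all of this is a function of (U_{1:t}, Z_t, A_t), and its conditional mean given (Z_t, O_0,
A_t) is 0. Completeness for the latent features makes it vanish for every action a, not only for the
action drawn (`Data.integral_proxyLaw_eq`). All these identities, one for each a, are under the same
law of W_t, so they can be averaged with the weights ν_t(a | ·), and the result is the Bellman
equation of the super-policy.

The data contain one action per stage, which plays two parts. In the equation of stage t, A_t is the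
executed action while a_{1:t} is a free parameter. In the continuation, A_{t+1} is the next
recommendation: the behavior policy draws it after the executed actions A_{1:t}, exactly as it does
under ν (`Data.condExp_vFun_next`). Backward induction then gives the bridge property at all stages,
and averaging at the first stage gives the policy value. -/

namespace SuperRL

/-! ## Range criteria in Hilbert spaces -/

section Hilbert

open scoped InnerProductSpace

variable {E F : Type*} [NormedAddCommGroup E] [InnerProductSpace ℝ E] [CompleteSpace E]
  [NormedAddCommGroup F] [InnerProductSpace ℝ F] [CompleteSpace F]

/-- An element `f` is in the range of `K` as soon as `g ↦ ⟪f, g⟫` is bounded by the norm of the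
adjoint. -/
theorem exists_apply_eq_of_abs_inner_le (K : E →L[ℝ] F) (f : F) (C : ℝ)
    (h : ∀ g : F, |⟪f, g⟫_ℝ| ≤ C * ‖K.adjoint g‖) : ∃ q, K q = f := by
  let T : F →ₗ[ℝ] E := K.adjoint.toLinearMap
  have hT : ∀ g, T g = K.adjoint g := fun g => rfl
  -- The functional K^* g ↦ ⟪f, g⟫ on the range of K^* is defined through chosen preimages. The
  -- bound forces ⟪f, ·⟫ to vanish on the kernel of K^*, so the choice is immaterial (`key`).
  choose s hs using fun y : LinearMap.range T => y.2
  have key : ∀ g (y : LinearMap.range T), T g = (y : E) → ⟪f, s y⟫_ℝ = ⟪f, g⟫_ℝ := by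
    intro g y hgy
    have h1 := h (s y - g)
    have h2 : K.adjoint (s y - g) = 0 := by
      rw [map_sub, ← hT, ← hT, hs, hgy, sub_self]
    rw [h2, norm_zero, mul_zero, inner_sub_right] at h1
    have := abs_nonpos_iff.1 h1
    linarith
  let φ : LinearMap.range T →ₗ[ℝ] ℝ :=
    { toFun := fun y => ⟪f, s y⟫_ℝ
      map_add' := fun x y => by
        rw [key (s x + s y) (x + y) (by rw [map_add, hs, hs]; rfl), inner_add_right]
      map_smul' := fun c y => by
        rw [key (c • s y) (c • y) (by rw [map_smul, hs]; rfl), inner_smul_right]; rfl }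
  let φc : LinearMap.range T →L[ℝ] ℝ := φ.mkContinuous C fun y => by
    have := h (s y)
    rw [← hT, hs] at this
    exact this
  -- The range of K^* need not be closed, hence Hahn–Banach. The Riesz vector q of the extension
  -- satisfies ⟪K q, g⟫ = ⟪q, K^* g⟫ = ⟪f, g⟫.
  obtain ⟨ψ, hψ, -⟩ := exists_extension_norm_eq (LinearMap.range T) φc
  refine ⟨(InnerProductSpace.toDual ℝ E).symm ψ, ?_⟩
  refine ext_inner_right ℝ fun g => ?_
  rw [← ContinuousLinearMap.adjoint_inner_right, InnerProductSpace.toDual_symm_apply]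
  have := hψ ⟨T g, g, rfl⟩
  rw [← hT, this]
  exact key g ⟨T g, g, rfl⟩ rfl

/-- The bound may be checked on the range of `K`, provided the adjoint is injective. -/
theorem exists_apply_eq_of_abs_inner_apply_le (K : E →L[ℝ] F) (f : F) (C : ℝ)
    (hinj : ∀ g, K.adjoint g = 0 → g = 0)
    (h : ∀ x : E, |⟪f, K x⟫_ℝ| ≤ C * ‖K.adjoint (K x)‖) : ∃ q, K q = f := by
  refine exists_apply_eq_of_abs_inner_le K f C fun g => ?_
  -- The orthogonal complement of the range of K is the kernel of K^*. Both sides of the bound are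
  -- continuous in g.
  have hd : DenseRange K := by
    have hbot : (LinearMap.range K.toLinearMap)ᗮ = ⊥ := by
      rw [Submodule.eq_bot_iff]
      intro g hg
      refine hinj g (ext_inner_right ℝ fun x => ?_)
      rw [ContinuousLinearMap.adjoint_inner_left, inner_zero_left, real_inner_comm]
      exact hg (K x) ⟨x, rfl⟩
    have := (Submodule.topologicalClosure_eq_top_iff).2 hbot
    intro y
    have hy : y ∈ (LinearMap.range K.toLinearMap).topologicalClosure := by rw [this]; trivial
    rw [← SetLike.mem_coe, Submodule.topologicalClosure_coe] at hy
    exact hy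
  refine hd.induction_on (p := fun g => |⟪f, g⟫_ℝ| ≤ C * ‖K.adjoint g‖) g ?_ h
  exact isClosed_le (by fun_prop) (by fun_prop)

/-- If `f` satisfies the summability condition with respect to a singular system of `K`, then its
pairing with the range of `K` is represented by a vector. -/
theorem exists_inner_apply_eq_of_singular {ι : Type*} (K : E →L[ℝ] F) (f : F)
    (val : ι → ℝ) (left : ι → E) (right : ι → F) (hpos : ∀ n, 0 < val n)
    (hleft : Orthonormal ℝ left)
    (hadj : ∀ n x, ⟪K x, right n⟫_ℝ = val n * ⟪x, left n⟫_ℝ)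
    (hmap : ∀ n, K (left n) = val n • right n)
    (hker : ∀ x, (∀ n, ⟪x, left n⟫_ℝ = 0) → K x = 0)
    (hsum : Summable fun n => (val n)⁻¹ ^ 2 * ⟪f, right n⟫_ℝ ^ 2) :
    ∃ p : E, ∀ x, ⟪f, K x⟫_ℝ = ⟪p, K.adjoint (K x)⟫_ℝ := by
  have hs : Summable fun n => ((val n)⁻¹ * ⟪f, right n⟫_ℝ) • left n := by
    have h := (hleft.orthogonalFamily.summable_iff_norm_sq_summable
      (fun n => (val n)⁻¹ * ⟪f, right n⟫_ℝ)).2 (by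
        simpa [mul_pow, sq_abs] using hsum)
    simpa using h
  obtain ⟨p, hp⟩ := hs
  have hpn : ∀ n, ⟪p, left n⟫_ℝ = (val n)⁻¹ * ⟪f, right n⟫_ℝ := by
    classical
    intro n
    have h1 : HasSum (fun m => ⟪left n, ((val m)⁻¹ * ⟪f, right m⟫_ℝ) • left m⟫_ℝ) ⟪left n, p⟫_ℝ :=
      (innerSL ℝ (left n)).hasSum hp
    have h2 := hasSum_ite_eq n ((val n)⁻¹ * ⟪f, right n⟫_ℝ)
    rw [real_inner_comm]
    refine h1.unique ?_
    convert h2 using 2 with m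
    rw [inner_smul_right, orthonormal_iff_ite.1 hleft]
    by_cases hnm : m = n
    · subst hnm; simp
    · simp [hnm, Ne.symm hnm]
  -- The vectors ψ_n need not span, so K p = f may fail. But K^*(f - K p) is orthogonal to every
  -- φ_n, hence killed by K, and K K^* y = 0 implies K^* y = 0.
  have hres : ∀ x, ⟪f - K p, K x⟫_ℝ = 0 := by
    have h1 : K (K.adjoint (f - K p)) = 0 := by
      refine hker _ fun n => ?_
      rw [ContinuousLinearMap.adjoint_inner_left, hmap, inner_smul_right, inner_sub_left, hadj, hpn,
        mul_inv_cancel_left₀ (hpos n).ne', sub_self, mul_zero]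
    have h2 : K.adjoint (f - K p) = 0 := by
      rw [← inner_self_eq_zero (𝕜 := ℝ), ContinuousLinearMap.adjoint_inner_left, h1,
        inner_zero_right]
    intro x
    rw [← ContinuousLinearMap.adjoint_inner_left, h2, inner_zero_left]
  refine ⟨p, fun x => ?_⟩
  have := hres x
  rw [inner_sub_left] at this
  rw [ContinuousLinearMap.adjoint_inner_right]
  linarith

end Hilbert

/-! ## Markov kernels as operators between `L²` spaces -/

section KernelOperator

variable {α β : Type*} {mα : MeasurableSpace α} {mβ : MeasurableSpace β}
  {μ : Measure α} {ρ : Measure β} {κ : Kernel α β} {η : Kernel β α}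

theorem enorm_integral_le_eLpNorm_two {μ : Measure α} [IsProbabilityMeasure μ] (f : α → ℝ)
    (hf : AEStronglyMeasurable f μ) : ‖∫ x, f x ∂μ‖ₑ ≤ eLpNorm f 2 μ :=
  calc ‖∫ x, f x ∂μ‖ₑ ≤ ∫⁻ x, ‖f x‖ₑ ∂μ := enorm_integral_le_lintegral_enorm _
    _ = eLpNorm f 1 μ := eLpNorm_one_eq_lintegral_enorm.symm
    _ ≤ eLpNorm f 2 μ := eLpNorm_le_eLpNorm_of_exponent_le (by norm_num) hf

theorem eLpNorm_two_sq {μ : Measure α} (f : α → ℝ) :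
    eLpNorm f 2 μ ^ 2 = ∫⁻ x, ‖f x‖ₑ ^ 2 ∂μ := by
  have := eLpNorm_nnreal_pow_eq_lintegral (p := 2) (μ := μ) (f := f) (by norm_num)
  simp only [NNReal.coe_ofNat, ENNReal.rpow_ofNat] at this
  exact_mod_cast this

theorem aestronglyMeasurable_integral_of_comp [SFinite μ] [IsSFiniteKernel κ] {h : β → ℝ}
    (hh : AEStronglyMeasurable h (κ ∘ₘ μ)) :
    AEStronglyMeasurable (fun x => ∫ y, h y ∂κ x) μ := by
  refine ⟨fun x => ∫ y, hh.mk h y ∂κ x, ?_, ?_⟩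
  · exact hh.stronglyMeasurable_mk.integral_kernel
  · filter_upwards [Measure.ae_ae_of_ae_comp hh.ae_eq_mk] with x hx using integral_congr_ae hx

/-- Jensen in each fibre, (∫ h dκ_x)² ≤ ∫ h² dκ_x, integrated over μ. It makes `kerOp` a
contraction. -/
theorem eLpNorm_integral_le [SFinite μ] [IsMarkovKernel κ] {h : β → ℝ}
    (hh : AEStronglyMeasurable h (κ ∘ₘ μ)) :
    eLpNorm (fun x => ∫ y, h y ∂κ x) 2 μ ≤ eLpNorm h 2 (κ ∘ₘ μ) := by
  rw [← ENNReal.pow_le_pow_left_iff two_ne_zero, eLpNorm_two_sq, eLpNorm_two_sq,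
    Measure.lintegral_bind κ.aemeasurable (hh.enorm.pow_const 2)]
  have h1 : ∀ᵐ x ∂μ, AEStronglyMeasurable h (κ x) := by
    filter_upwards [Measure.ae_ae_of_ae_comp hh.ae_eq_mk] with x hx
    exact ⟨hh.mk h, hh.stronglyMeasurable_mk, hx⟩
  refine lintegral_mono_ae ?_
  filter_upwards [h1] with x hx
  rw [← eLpNorm_two_sq]
  gcongr
  exact enorm_integral_le_eLpNorm_two h hx

theorem MemLp.integral_kernel [SFinite μ] [IsMarkovKernel κ] {h : β → ℝ}
    (hh : MemLp h 2 (κ ∘ₘ μ)) : MemLp (fun x => ∫ y, h y ∂κ x) 2 μ :=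
  ⟨aestronglyMeasurable_integral_of_comp hh.1, (eLpNorm_integral_le hh.1).trans_lt hh.2⟩

theorem ae_memLp_of_comp [SFinite μ] [IsMarkovKernel κ] {h : β → ℝ}
    (hh : MemLp h 2 (κ ∘ₘ μ)) : ∀ᵐ x ∂μ, MemLp h 2 (κ x) := by
  have h2 : ∫⁻ x, ∫⁻ y, ‖h y‖ₑ ^ 2 ∂κ x ∂μ ≠ ∞ := by
    rw [← Measure.lintegral_bind κ.aemeasurable (hh.1.enorm.pow_const 2), ← eLpNorm_two_sq]
    exact ENNReal.pow_ne_top hh.2.ne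
  have h3 : AEMeasurable (fun x => ∫⁻ y, ‖h y‖ₑ ^ 2 ∂κ x) μ := by
    refine ⟨fun x => ∫⁻ y, ‖hh.1.mk h y‖ₑ ^ 2 ∂κ x, ?_, ?_⟩
    · exact (hh.1.stronglyMeasurable_mk.enorm.pow_const 2).lintegral_kernel
    · filter_upwards [Measure.ae_ae_of_ae_comp hh.1.ae_eq_mk] with x hx
      exact lintegral_congr_ae (by filter_upwards [hx] with y hy; rw [hy])
  filter_upwards [ae_lt_top' h3 h2, Measure.ae_ae_of_ae_comp hh.1.ae_eq_mk] with x hx hx'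
  refine ⟨⟨hh.1.mk h, hh.1.stronglyMeasurable_mk, hx'⟩, ?_⟩
  rw [← eLpNorm_two_sq] at hx
  by_contra hcon
  rw [not_lt, top_le_iff] at hcon
  rw [hcon] at hx
  simp at hx

/-- The operator `h ↦ (x ↦ ∫ h dκ_x)` from `L²` of `ρ = κ ∘ₘ μ` to `L²` of `μ`. -/
noncomputable def kerOp (μ : Measure α) [IsProbabilityMeasure μ] (κ : Kernel α β) [IsMarkovKernel κ]
    (ρ : Measure β) (hρ : κ ∘ₘ μ = ρ) : Lp ℝ 2 ρ →L[ℝ] Lp ℝ 2 μ :=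
  LinearMap.mkContinuous
    { toFun := fun h => (MemLp.integral_kernel (κ := κ) (μ := μ) (h := h)
        (hρ ▸ Lp.memLp h)).toLp _
      map_add' := fun f g => by
        subst hρ
        rw [← MemLp.toLp_add]
        refine MemLp.toLp_congr _ _ ?_
        filter_upwards [Measure.ae_ae_of_ae_comp (Lp.coeFn_add f g),
          ae_memLp_of_comp (Lp.memLp f), ae_memLp_of_comp (Lp.memLp g)] with x hx hf hg
        rw [Pi.add_apply, ← integral_add (hf.integrable (by norm_num))
          (hg.integrable (by norm_num))]
        exact integral_congr_ae hx
      map_smul' := fun c f => by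
        subst hρ
        rw [← MemLp.toLp_const_smul]
        refine MemLp.toLp_congr _ _ ?_
        filter_upwards [Measure.ae_ae_of_ae_comp (Lp.coeFn_smul c f)] with x hx
        rw [Pi.smul_apply, ← integral_smul]
        exact integral_congr_ae hx }
    1 fun h => by
      subst hρ
      simp only [LinearMap.coe_mk, AddHom.coe_mk, one_mul]
      rw [Lp.norm_toLp, Lp.norm_def]
      exact ENNReal.toReal_mono (Lp.memLp h).2.ne (eLpNorm_integral_le (Lp.memLp h).1)

variable [IsProbabilityMeasure μ] [IsProbabilityMeasure ρ] [IsMarkovKernel κ] [IsMarkovKernel η]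

theorem coeFn_kerOp (hρ : κ ∘ₘ μ = ρ) (h : Lp ℝ 2 ρ) :
    kerOp μ κ ρ hρ h =ᵐ[μ] fun x => ∫ y, h y ∂κ x :=
  MemLp.coeFn_toLp (MemLp.integral_kernel (hρ ▸ Lp.memLp h))

theorem coeFn_kerOp_of_ae (hρ : κ ∘ₘ μ = ρ) (h : Lp ℝ 2 ρ) {h' : β → ℝ} (hh : h =ᵐ[ρ] h') :
    kerOp μ κ ρ hρ h =ᵐ[μ] fun x => ∫ y, h' y ∂κ x := by
  subst hρ
  refine (coeFn_kerOp _ h).trans ?_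
  filter_upwards [Measure.ae_ae_of_ae_comp hh] with x hx using integral_congr_ae hx

theorem comp_eq_of_compProd_eq_swap (h : μ ⊗ₘ κ = (ρ ⊗ₘ η).map Prod.swap) : κ ∘ₘ μ = ρ := by
  rw [← Measure.snd_compProd, h, Measure.snd_map_swap, Measure.fst_compProd]

theorem comp_eq_of_compProd_eq_swap' (h : μ ⊗ₘ κ = (ρ ⊗ₘ η).map Prod.swap) : η ∘ₘ ρ = μ := by
  rw [← Measure.snd_compProd, ← Measure.fst_map_swap, ← h, Measure.fst_compProd]

theorem integrable_mul_compProd {μ : Measure α} [SFinite μ] {f : α → ℝ} {h : β → ℝ} (hf : MemLp f 2 μ)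
    (hh : MemLp h 2 (κ ∘ₘ μ)) : Integrable (fun p : α × β => f p.1 * h p.2) (μ ⊗ₘ κ) := by
  have h1 : MemLp (fun p : α × β => f p.1) 2 (μ ⊗ₘ κ) := by
    refine MemLp.comp_measurePreserving (g := f) hf ⟨measurable_fst, ?_⟩
    exact Measure.fst_compProd μ κ
  have h2 : MemLp (fun p : α × β => h p.2) 2 (μ ⊗ₘ κ) := by
    refine MemLp.comp_measurePreserving (g := h) hh ⟨measurable_snd, ?_⟩
    exact Measure.snd_compProd μ κ
  exact h1.integrable_mul h2

theorem integral_mul_integral_eq {μ : Measure α} [SFinite μ] {f : α → ℝ} {h : β → ℝ} (hf : MemLp f 2 μ)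
    (hh : MemLp h 2 (κ ∘ₘ μ)) :
    ∫ x, f x * ∫ y, h y ∂κ x ∂μ = ∫ p, f p.1 * h p.2 ∂(μ ⊗ₘ κ) := by
  rw [Measure.integral_compProd (integrable_mul_compProd hf hh)]
  simp_rw [integral_const_mul]

/-- The two disintegrations describe one joint law, and both pairings are the integral of f(x) g(y)
under it. -/
theorem adjoint_kerOp (h : μ ⊗ₘ κ = (ρ ⊗ₘ η).map Prod.swap) :
    (kerOp μ κ ρ (comp_eq_of_compProd_eq_swap h)).adjoint
      = kerOp ρ η μ (comp_eq_of_compProd_eq_swap' h) := by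
  symm
  rw [ContinuousLinearMap.eq_adjoint_iff]
  intro f g
  have hκ := comp_eq_of_compProd_eq_swap h
  have hη := comp_eq_of_compProd_eq_swap' h
  have hf := Lp.memLp f
  have hg := Lp.memLp g
  rw [L2.inner_def, L2.inner_def]
  have e1 : ∫ x, inner ℝ (kerOp ρ η μ hη f x) (g x) ∂ρ = ∫ x, g x * ∫ y, f y ∂η x ∂ρ := by
    refine integral_congr_ae ?_
    filter_upwards [coeFn_kerOp hη f] with x hx
    rw [hx]; rfl
  have e2 : ∫ x, inner ℝ (f x) (kerOp μ κ ρ hκ g x) ∂μ = ∫ x, f x * ∫ y, g y ∂κ x ∂μ := by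
    refine integral_congr_ae ?_
    filter_upwards [coeFn_kerOp hκ g] with x hx
    rw [hx, mul_comm]; rfl
  rw [e1, e2, integral_mul_integral_eq hg (hη.symm ▸ hf), integral_mul_integral_eq hf (hκ.symm ▸ hg), h]
  refine Eq.trans ?_ (integral_map_equiv (μ := ρ ⊗ₘ η) MeasurableEquiv.prodComm
    (fun p : α × β => f p.1 * g p.2)).symm
  exact integral_congr_ae (Filter.Eventually.of_forall fun p => mul_comm _ _)

end KernelOperator

/-! ### The bound in one fibre -/

section Fibre

variable {𝒪 𝒲 : Type*} {mO : MeasurableSpace 𝒪} {mW : MeasurableSpace 𝒲}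

theorem inner_toLp_eq {μ : Measure 𝒪} {f g : 𝒪 → ℝ} (hf : MemLp f 2 μ) (hg : MemLp g 2 μ) :
    inner ℝ (hf.toLp f) (hg.toLp g) = ∫ x, f x * g x ∂μ := by
  rw [L2.inner_def]
  refine integral_congr_ae ?_
  filter_upwards [hf.coeFn_toLp, hg.coeFn_toLp] with x h1 h2
  rw [h1, h2, mul_comm]; rfl

/-- A pair of Markov kernels in duality, with a singular system for which `f` satisfies the
summability condition: `⟪f, K h⟫` is bounded by the norm of `K^* K h`. -/
theorem exists_abs_integral_le_of_singular {μ : Measure 𝒪} {ρ : Measure 𝒲}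
    [IsProbabilityMeasure μ] [IsProbabilityMeasure ρ] {κ : Kernel 𝒪 𝒲} {η : Kernel 𝒲 𝒪}
    [IsMarkovKernel κ] [IsMarkovKernel η] (hrev : μ ⊗ₘ κ = (ρ ⊗ₘ η).map Prod.swap)
    (S : SingularData 𝒲 𝒪) (hpos : ∀ n ∈ S.idx, 0 < S.val n)
    (hleft : ∀ n ∈ S.idx, MemLp (S.left n) 2 ρ) (hright : ∀ n ∈ S.idx, MemLp (S.right n) 2 μ)
    (hortho : ∀ n ∈ S.idx, ∀ m ∈ S.idx,
      ∫ w, S.left n w * S.left m w ∂ρ = if n = m then 1 else 0)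
    (hmap : ∀ n ∈ S.idx, ∀ᵐ o ∂μ, ∫ w, S.left n w ∂κ o = S.val n * S.right n o)
    (hadj : ∀ n ∈ S.idx, ∀ h, Measurable h → MemLp h 2 ρ →
      ∫ o, (∫ w, h w ∂κ o) * S.right n o ∂μ = S.val n * ∫ w, h w * S.left n w ∂ρ)
    (hker : ∀ h, Measurable h → MemLp h 2 ρ → (∀ n ∈ S.idx, ∫ w, h w * S.left n w ∂ρ = 0) →
      ∀ᵐ o ∂μ, ∫ w, h w ∂κ o = 0)
    {f : 𝒪 → ℝ} (hf : MemLp f 2 μ)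
    (hsum : Summable fun n : S.idx =>
      (S.val n)⁻¹ ^ 2 * (∫ o, f o * S.right n o ∂μ) ^ 2) :
    ∃ C : ℝ, ∀ h, MemLp h 2 ρ → |∫ o, f o * ∫ w, h w ∂κ o ∂μ|
      ≤ C * (eLpNorm (fun w => ∫ o, ∫ w', h w' ∂κ o ∂η w) 2 ρ).toReal := by
  have hκ := comp_eq_of_compProd_eq_swap hrev
  have hη := comp_eq_of_compProd_eq_swap' hrev
  set K := kerOp μ κ ρ hκ with hK
  have hmem : ∀ {h}, MemLp h 2 ρ → MemLp (fun o => ∫ w, h w ∂κ o) 2 μ := fun hh =>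
    MemLp.integral_kernel (hκ.symm ▸ hh)
  have hKtoLp : ∀ {h} (hh : MemLp h 2 ρ), K (hh.toLp h) = (hmem hh).toLp _ := fun hh =>
    Lp.ext ((coeFn_kerOp_of_ae hκ _ hh.coeFn_toLp).trans (MemLp.coeFn_toLp _).symm)
  -- The hypotheses `hadj` and `hker` speak of measurable functions; each class in L² is fed to them
  -- through its measurable representative.
  have hself : ∀ x : Lp ℝ 2 ρ, x = (Lp.memLp x).toLp x := fun x => (Lp.toLp_coeFn x _).symm
  obtain ⟨p, hp⟩ := exists_inner_apply_eq_of_singular (ι := S.idx) K (hf.toLp f)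
    (fun n => S.val n) (fun n => (hleft n n.2).toLp _) (fun n => (hright n n.2).toLp _)
    (fun n => hpos n n.2)
    (by
      rw [orthonormal_iff_ite]
      intro n m
      rw [inner_toLp_eq, hortho n n.2 m m.2]
      simp [Subtype.ext_iff])
    (fun n x => by
      rw [hself x, hKtoLp, inner_toLp_eq, inner_toLp_eq,
        hadj n n.2 x (Lp.stronglyMeasurable x).measurable (Lp.memLp x)])
    (fun n => by
      rw [hKtoLp, ← MemLp.toLp_const_smul]
      exact MemLp.toLp_congr _ _ (hmap n n.2))
    (fun x hx => by
      rw [hself x, hKtoLp]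
      have h0 := hker x (Lp.stronglyMeasurable x).measurable (Lp.memLp x) fun n hn => by
        have := hx ⟨n, hn⟩
        rwa [hself x, inner_toLp_eq] at this
      exact Lp.ext ((MemLp.coeFn_toLp _).trans (Filter.EventuallyEq.trans h0
        (Lp.coeFn_zero ℝ 2 μ).symm)))
    (by
      refine hsum.congr fun n => ?_
      rw [inner_toLp_eq])
  refine ⟨‖p‖, fun h hh => ?_⟩
  have h1 := hp (hh.toLp h)
  rw [hKtoLp, inner_toLp_eq] at h1
  rw [h1]
  refine (abs_real_inner_le_norm _ _).trans (mul_le_mul_of_nonneg_left (le_of_eq ?_) (norm_nonneg _))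
  rw [hK, adjoint_kerOp hrev, Lp.norm_def]
  congr 1
  exact eLpNorm_congr_ae (coeFn_kerOp_of_ae hη _ (MemLp.coeFn_toLp _))

end Fibre

/-! ### From fibrewise to global square-integrability -/

section Scaling

variable {X Y : Type*} {mX : MeasurableSpace X} {mY : MeasurableSpace Y}

theorem ae_memLp_of_compProd {π : Measure X} [SFinite π] {κ : Kernel X Y} [IsMarkovKernel κ]
    {h : X × Y → ℝ} (hm : Measurable h) (hh : MemLp h 2 (π ⊗ₘ κ)) :
    ∀ᵐ x ∂π, MemLp (fun y => h (x, y)) 2 (κ x) := by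
  rw [Measure.compProd_eq_comp_prod] at hh
  filter_upwards [ae_memLp_of_comp hh] with x hx
  rw [Kernel.prod_apply, Kernel.id_apply, Measure.dirac_prod,
    memLp_map_measure_iff hm.aestronglyMeasurable (by fun_prop)] at hx
  exact hx

theorem measurable_eLpNorm_two {κ : Kernel X Y} [IsSFiniteKernel κ] {h : X × Y → ℝ} (hm : Measurable h) :
    Measurable fun x => eLpNorm (fun y => h (x, y)) 2 (κ x) := by
  have h1 : (fun x => eLpNorm (fun y => h (x, y)) 2 (κ x))
      = fun x => (∫⁻ y, ‖h (x, y)‖ₑ ^ 2 ∂κ x) ^ (2⁻¹ : ℝ) := by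
    funext x
    rw [← eLpNorm_two_sq, ← ENNReal.rpow_natCast, ← ENNReal.rpow_mul]
    norm_num
  rw [h1]
  exact (Measurable.lintegral_kernel_prod_right' (f := fun p => ‖h p‖ₑ ^ 2)
    (hm.enorm.pow_const 2)).pow_const _

theorem eLpNorm_compProd_two_sq {π : Measure X} [SFinite π] {κ : Kernel X Y} [IsSFiniteKernel κ]
    {h : X × Y → ℝ} (hm : Measurable h) :
    eLpNorm h 2 (π ⊗ₘ κ) ^ 2 = ∫⁻ x, eLpNorm (fun y => h (x, y)) 2 (κ x) ^ 2 ∂π := by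
  rw [eLpNorm_two_sq, Measure.lintegral_compProd (hm.enorm.pow_const 2)]
  simp_rw [eLpNorm_two_sq]

/-- A function that is square-integrable in every fibre becomes square-integrable after
multiplication by a positive function of the base point. -/
theorem exists_scaling_memLp {π : Measure X} [IsProbabilityMeasure π] {κ : Kernel X Y}
    [IsMarkovKernel κ] {f : X × Y → ℝ} (hm : Measurable f)
    (hf : ∀ᵐ x ∂π, MemLp (fun y => f (x, y)) 2 (κ x)) :
    ∃ c : X → ℝ, Measurable c ∧ (∀ x, 0 < c x) ∧ (∀ x, c x ≤ 1) ∧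
      MemLp (fun p : X × Y => c p.1 * f p) 2 (π ⊗ₘ κ) := by
  have hN := measurable_eLpNorm_two (κ := κ) hm
  -- With the factor (1 + n x)⁻¹ almost every fibre norm is at most 1. An infinite norm is read as 0
  -- here, which happens only on a null set.
  set n : X → ℝ := fun x => (eLpNorm (fun y => f (x, y)) 2 (κ x)).toReal with hn
  have hn0 : ∀ x, 0 ≤ n x := fun x => ENNReal.toReal_nonneg
  have hc : Measurable fun x => (1 + n x)⁻¹ := (hN.ennreal_toReal.const_add 1).inv
  refine ⟨fun x => (1 + n x)⁻¹, hc, fun x => by have := hn0 x; positivity,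
    fun x => inv_le_one_of_one_le₀ (by linarith [hn0 x]), ?_⟩
  have hm' : Measurable fun p : X × Y => (1 + n p.1)⁻¹ * f p := (hc.comp measurable_fst).mul hm
  refine ⟨hm'.aestronglyMeasurable, ?_⟩
  have h1 : eLpNorm (fun p : X × Y => (1 + n p.1)⁻¹ * f p) 2 (π ⊗ₘ κ) ^ 2 ≤ 1 := by
    rw [eLpNorm_compProd_two_sq hm']
    calc _ ≤ ∫⁻ _, 1 ∂π := by
          refine lintegral_mono_ae ?_
          filter_upwards [hf] with x hx
          have h2 : eLpNorm (fun y => (1 + n x)⁻¹ * f (x, y)) 2 (κ x) ≤ 1 := by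
            have h3 := eLpNorm_const_smul ((1 + n x)⁻¹) (fun y => f (x, y)) 2 (κ x)
            have h4 : eLpNorm (fun y => f (x, y)) 2 (κ x) = ENNReal.ofReal (n x) :=
              (ENNReal.ofReal_toReal hx.2.ne).symm
            change eLpNorm ((1 + n x)⁻¹ • fun y => f (x, y)) 2 (κ x) ≤ 1
            have h5 := hn0 x
            rw [h3, h4, Real.enorm_eq_ofReal (by positivity),
              ← ENNReal.ofReal_mul (by positivity), ← ENNReal.ofReal_one]
            refine ENNReal.ofReal_le_ofReal ?_
            rw [inv_mul_le_iff₀ (by positivity)]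
            linarith
          exact pow_le_one₀ zero_le h2
      _ = 1 := by simp
  by_contra hcon
  rw [not_lt, top_le_iff] at hcon
  rw [hcon] at h1
  simp at h1

end Scaling

/-! ### Measurable solution of a family of integral equations -/

section Parametrized

variable {X 𝒪 𝒲 : Type*} {mX : MeasurableSpace X} {mO : MeasurableSpace 𝒪}
  {mW : MeasurableSpace 𝒲}

/-- A kernel with a parameter, as a kernel that keeps the parameter. -/
noncomputable def keepParam (κ : Kernel (X × 𝒪) 𝒲) : Kernel (X × 𝒪) (X × 𝒲) :=
  Kernel.deterministic Prod.fst measurable_fst ×ₖ κ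

instance (κ : Kernel (X × 𝒪) 𝒲) [IsMarkovKernel κ] : IsMarkovKernel (keepParam κ) := by
  unfold keepParam; infer_instance

theorem keepParam_apply (κ : Kernel (X × 𝒪) 𝒲) [IsMarkovKernel κ] (p : X × 𝒪) :
    keepParam κ p = (κ p).map (Prod.mk p.1) := by
  rw [keepParam, Kernel.prod_apply, Kernel.deterministic_apply, Measure.dirac_prod]

theorem integral_keepParam (κ : Kernel (X × 𝒪) 𝒲) [IsMarkovKernel κ] (p : X × 𝒪)
    {h : X × 𝒲 → ℝ} (hm : Measurable h) : ∫ q, h q ∂(keepParam κ p) = ∫ w, h (p.1, w) ∂κ p := by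
  rw [keepParam_apply, integral_map (by fun_prop) hm.aestronglyMeasurable]

theorem lintegral_keepParam (κ : Kernel (X × 𝒪) 𝒲) [IsMarkovKernel κ] (p : X × 𝒪)
    {h : X × 𝒲 → ℝ≥0∞} (hm : Measurable h) :
    ∫⁻ q, h q ∂(keepParam κ p) = ∫⁻ w, h (p.1, w) ∂κ p := by
  rw [keepParam_apply, lintegral_map hm (by fun_prop)]

variable {π : Measure X} [IsProbabilityMeasure π] {μ : Kernel X 𝒪} {ρ : Kernel X 𝒲}
  {κ : Kernel (X × 𝒪) 𝒲} {η : Kernel (X × 𝒲) 𝒪} [IsMarkovKernel μ] [IsMarkovKernel ρ]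
  [IsMarkovKernel κ] [IsMarkovKernel η]

/-- Since the parameter is kept in the target, the global kernels act in each fibre separately, and
the fibrewise dualities integrate to a global one. This makes `adjoint_kerOp` available for the
global operator. -/
theorem compProd_keepParam_eq_swap
    (hrev : ∀ᵐ x ∂π, μ x ⊗ₘ κ.sectR x = (ρ x ⊗ₘ η.sectR x).map Prod.swap) :
    (π ⊗ₘ μ) ⊗ₘ keepParam κ = ((π ⊗ₘ ρ) ⊗ₘ keepParam η).map Prod.swap := by
  refine Measure.ext_of_lintegral _ fun F hF => ?_
  have hF1 : Measurable fun p : X × 𝒪 => ∫⁻ w, F (p, (p.1, w)) ∂κ p :=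
    Measurable.lintegral_kernel_prod_right' (f := fun q : (X × 𝒪) × 𝒲 => F (q.1, (q.1.1, q.2)))
      (by fun_prop)
  have hF2 : Measurable fun p : X × 𝒲 => ∫⁻ o, F ((p.1, o), p) ∂η p :=
    Measurable.lintegral_kernel_prod_right' (f := fun q : (X × 𝒲) × 𝒪 => F ((q.1.1, q.2), q.1))
      (by fun_prop)
  rw [lintegral_map hF measurable_swap, Measure.lintegral_compProd hF,
    Measure.lintegral_compProd (μ := π ⊗ₘ ρ) (by fun_prop)]
  have e1 : ∀ p, ∫⁻ b, F (p, b) ∂(keepParam κ p) = ∫⁻ w, F (p, (p.1, w)) ∂κ p := fun p =>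
    lintegral_keepParam κ p (by fun_prop)
  have e2 : ∀ p, ∫⁻ b, F (p, b).swap ∂(keepParam η p) = ∫⁻ o, F ((p.1, o), p) ∂η p := fun p =>
    lintegral_keepParam η p (h := fun b => F (p, b).swap) (by fun_prop)
  refine (lintegral_congr e1).trans (Eq.trans ?_ (lintegral_congr e2).symm)
  rw [Measure.lintegral_compProd hF1, Measure.lintegral_compProd hF2]
  refine lintegral_congr_ae ?_
  filter_upwards [hrev] with x hx
  have h3 := Measure.lintegral_compProd (μ := μ x) (κ := κ.sectR x)
    (f := fun p : 𝒪 × 𝒲 => F ((x, p.1), (x, p.2))) (by fun_prop)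
  rw [hx, lintegral_map (by fun_prop) measurable_swap, Measure.lintegral_compProd (by fun_prop)] at h3
  exact h3.symm

/-- Solution of a family of integral equations of the first kind, measurably in the parameter. In
each fibre, the pairing of the right-hand side with the range of the operator is bounded by the norm
of the adjoint; the adjoint of the global operator is injective. -/
theorem exists_measurable_solution [MeasurableSpace.CountablyGenerated X]
    [MeasurableSpace.CountablyGenerated 𝒲]
    (hrev : ∀ᵐ x ∂π, μ x ⊗ₘ κ.sectR x = (ρ x ⊗ₘ η.sectR x).map Prod.swap)
    (hinj : ∀ g : X × 𝒪 → ℝ, Measurable g → MemLp g 2 (π ⊗ₘ μ) →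
      (∀ᵐ p ∂(π ⊗ₘ ρ), ∫ o, g (p.1, o) ∂η p = 0) → g =ᵐ[π ⊗ₘ μ] 0)
    {f : X × 𝒪 → ℝ} (hfm : Measurable f)
    (hf : ∀ᵐ x ∂π, MemLp (fun o => f (x, o)) 2 (μ x))
    (hbound : ∀ᵐ x ∂π, ∃ C : ℝ, ∀ h, MemLp h 2 (ρ x) →
      |∫ o, f (x, o) * ∫ w, h w ∂κ (x, o) ∂μ x|
        ≤ C * (eLpNorm (fun w => ∫ o, ∫ w', h w' ∂κ (x, o) ∂η (x, w)) 2 (ρ x)).toReal) :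
    ∃ q : X × 𝒲 → ℝ, Measurable q ∧ (∀ᵐ x ∂π, MemLp (fun w => q (x, w)) 2 (ρ x)) ∧
      ∀ᵐ p ∂(π ⊗ₘ μ), ∫ w, q (p.1, w) ∂κ p = f p := by
  have hREV := compProd_keepParam_eq_swap hrev
  have hA := comp_eq_of_compProd_eq_swap hREV
  have hB := comp_eq_of_compProd_eq_swap' hREV
  set K := kerOp (π ⊗ₘ μ) (keepParam κ) (π ⊗ₘ ρ) hA with hK
  have hKadj : K.adjoint = kerOp (π ⊗ₘ ρ) (keepParam η) (π ⊗ₘ μ) hB := adjoint_kerOp hREV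
  -- measurable representatives of the functions involved
  have hkm : ∀ {h : X × 𝒲 → ℝ}, Measurable h → Measurable fun p : X × 𝒪 => ∫ w, h (p.1, w) ∂κ p :=
    fun {h} hh => (StronglyMeasurable.integral_kernel_prod_right'
      (f := fun q : (X × 𝒪) × 𝒲 => h (q.1.1, q.2))
      (hh.comp (by fun_prop)).stronglyMeasurable).measurable
  have hem : ∀ {g : X × 𝒪 → ℝ}, Measurable g → Measurable fun p : X × 𝒲 => ∫ o, g (p.1, o) ∂η p :=
    fun {g} hg => (StronglyMeasurable.integral_kernel_prod_right'
      (f := fun q : (X × 𝒲) × 𝒪 => g (q.1.1, q.2))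
      (hg.comp (by fun_prop)).stronglyMeasurable).measurable
  have hmeas : ∀ h : Lp ℝ 2 (π ⊗ₘ ρ), Measurable h := fun h => (Lp.stronglyMeasurable h).measurable
  have hKc : ∀ h : Lp ℝ 2 (π ⊗ₘ ρ), K h =ᵐ[π ⊗ₘ μ] fun p => ∫ w, h (p.1, w) ∂κ p := fun h => by
    refine (coeFn_kerOp hA h).trans (Filter.Eventually.of_forall fun p => ?_)
    exact integral_keepParam κ p (hmeas h)
  have hKa : ∀ (g : Lp ℝ 2 (π ⊗ₘ μ)) (g' : X × 𝒪 → ℝ), Measurable g' → g =ᵐ[π ⊗ₘ μ] g' →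
      K.adjoint g =ᵐ[π ⊗ₘ ρ] fun p => ∫ o, g' (p.1, o) ∂η p := fun g g' hg' hgg => by
    rw [hKadj]
    refine (coeFn_kerOp_of_ae hB g hgg).trans (Filter.Eventually.of_forall fun p => ?_)
    exact integral_keepParam η p hg'
  have : Fact ((2 : ℝ≥0∞) ≠ ∞) := ⟨by norm_num⟩
  -- the fibrewise bounds on a countable dense set
  set H : ℕ → Lp ℝ 2 (π ⊗ₘ ρ) := TopologicalSpace.denseSeq _ with hH
  set k : ℕ → X × 𝒪 → ℝ := fun j p => ∫ w, H j (p.1, w) ∂κ p with hk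
  have hkmeas : ∀ j, Measurable (k j) := fun j => hkm (hmeas (H j))
  set e : ℕ → X × 𝒲 → ℝ := fun j p => ∫ o, k j (p.1, o) ∂η p with he
  have hemeas : ∀ j, Measurable (e j) := fun j => hem (hkmeas j)
  set n : ℕ → X → ℝ := fun j x => ∫ o, f (x, o) * k j (x, o) ∂μ x with hn
  have hnmeas : ∀ j, Measurable (n j) := fun j =>
    (StronglyMeasurable.integral_kernel_prod_right' (κ := μ) (f := fun q : X × 𝒪 => f q * k j q)
      (hfm.mul (hkmeas j)).stronglyMeasurable).measurable
  set d : ℕ → X → ℝ := fun j x => (eLpNorm (fun w => e j (x, w)) 2 (ρ x)).toReal with hd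
  have hdmeas : ∀ j, Measurable (d j) := fun j =>
    (measurable_eLpNorm_two (hemeas j)).ennreal_toReal
  -- The constant of `hbound` is not measurable in x; the best constant for the countable family `H`
  -- is. Density of `H` in the global L² space suffices, because the fibre bounds are used only
  -- after integration over x.
  set B : X → ℝ≥0∞ := fun x => ⨆ j, ENNReal.ofReal (|n j x| / d j x) with hBdef
  have hBmeas : Measurable B := Measurable.iSup fun j =>
    ((hnmeas j).abs.div (hdmeas j)).ennreal_ofReal
  have hB_le : ∀ᵐ x ∂π, ∀ j, |n j x| ≤ (B x).toReal * d j x := by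
    have h1 : ∀ᵐ x ∂π, ∀ j, MemLp (fun w => H j (x, w)) 2 (ρ x) :=
      ae_all_iff.2 fun j => ae_memLp_of_compProd (hmeas (H j)) (Lp.memLp _)
    filter_upwards [h1, hbound] with x hx hC
    obtain ⟨C, hC⟩ := hC
    have hCj : ∀ j, |n j x| ≤ C * d j x := fun j => hC _ (hx j)
    have hd0 : ∀ j, 0 ≤ d j x := fun j => ENNReal.toReal_nonneg
    have hBtop : B x ≤ ENNReal.ofReal (max C 0) := by
      refine iSup_le fun j => ENNReal.ofReal_le_ofReal ?_
      rcases (hd0 j).eq_or_lt with h | h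
      · rw [← h, div_zero]; exact le_max_right _ _
      · rw [div_le_iff₀ h]
        exact (hCj j).trans (mul_le_mul_of_nonneg_right (le_max_left _ _) h.le)
    intro j
    -- When `d j x = 0` the quotient is 0 by convention and carries no information; the bound with C
    -- then gives `n j x = 0` directly.
    rcases (hd0 j).eq_or_lt with h | h
    · have := hCj j
      rw [← h, mul_zero] at this ⊢
      exact this
    · rw [← div_le_iff₀ h]
      refine (ENNReal.ofReal_le_iff_le_toReal (hBtop.trans_lt ENNReal.ofReal_lt_top).ne).1 ?_
      exact le_iSup (fun j => ENNReal.ofReal (|n j x| / d j x)) j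
  obtain ⟨c, hcm, hc0, hc1, hcf⟩ := exists_scaling_memLp hfm hf
  -- The factor c brings f into the global L² space; b absorbs the fibre constant, so that the
  -- global bound holds with constant 1.
  set b : X → ℝ := fun x => (1 + (B x).toReal)⁻¹ with hb
  have hb0 : ∀ x, 0 < b x := fun x => inv_pos.2 (by positivity)
  have hb1 : ∀ x, b x ≤ 1 := fun x => inv_le_one_of_one_le₀ (by
    linarith [ENNReal.toReal_nonneg (a := B x)])
  have hbm : Measurable b := (hBmeas.ennreal_toReal.const_add 1).inv
  have hbB : ∀ x, b x * (B x).toReal ≤ 1 := fun x => by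
    rw [hb, inv_mul_le_iff₀ (by positivity)]; linarith
  have hφ : MemLp (fun p : X × 𝒪 => b p.1 * (c p.1 * f p)) 2 (π ⊗ₘ μ) := by
    refine hcf.mono (((hbm.comp measurable_fst).mul
      ((hcm.comp measurable_fst).mul hfm)).aestronglyMeasurable) (.of_forall fun p => ?_)
    rw [norm_mul, Real.norm_of_nonneg (hb0 _).le]
    exact mul_le_of_le_one_left (norm_nonneg _) (hb1 _)
  -- the global bound
  have hglob : ∀ j, |inner ℝ (hφ.toLp _) (K (H j))| ≤ 1 * ‖K.adjoint (K (H j))‖ := by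
    intro j
    have hkL : MemLp (k j) 2 (π ⊗ₘ μ) := (memLp_congr_ae (hKc (H j))).1 (Lp.memLp _)
    have hKj : K (H j) = hkL.toLp _ := Lp.ext ((hKc (H j)).trans hkL.coeFn_toLp.symm)
    have hint : Integrable (fun p : X × 𝒪 => b p.1 * (c p.1 * f p) * k j p) (π ⊗ₘ μ) :=
      hφ.integrable_mul hkL
    have e1 : inner ℝ (hφ.toLp _) (K (H j)) = ∫ x, b x * c x * n j x ∂π := by
      rw [hKj, inner_toLp_eq, Measure.integral_compProd hint]
      refine integral_congr_ae (.of_forall fun x => ?_)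
      simp only [hn]
      rw [← integral_const_mul]
      refine integral_congr_ae (.of_forall fun o => ?_)
      ring
    have eadj : K.adjoint (K (H j)) =ᵐ[π ⊗ₘ ρ] e j := hKa _ _ (hkmeas j) (hKc (H j))
    have heL : MemLp (e j) 2 (π ⊗ₘ ρ) := (memLp_congr_ae eadj).1 (Lp.memLp _)
    have hdsq : eLpNorm (d j) 2 π = eLpNorm (e j) 2 (π ⊗ₘ ρ) := by
      have hsq : eLpNorm (d j) 2 π ^ 2 = eLpNorm (e j) 2 (π ⊗ₘ ρ) ^ 2 := by
        rw [eLpNorm_compProd_two_sq (hemeas j), eLpNorm_two_sq]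
        refine lintegral_congr_ae ?_
        filter_upwards [ae_memLp_of_compProd (hemeas j) heL] with x hx
        rw [Real.enorm_eq_ofReal ENNReal.toReal_nonneg, ENNReal.ofReal_toReal hx.2.ne]
      exact le_antisymm ((ENNReal.pow_le_pow_left_iff two_ne_zero).1 hsq.le)
        ((ENNReal.pow_le_pow_left_iff two_ne_zero).1 hsq.ge)
    have hdL : MemLp (d j) 2 π := ⟨(hdmeas j).aestronglyMeasurable, hdsq ▸ heL.2⟩
    have hle : ‖∫ x, b x * c x * n j x ∂π‖ ≤ ∫ x, d j x ∂π := by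
      refine norm_integral_le_of_norm_le (hdL.integrable (by norm_num)) ?_
      filter_upwards [hB_le] with x hx
      have hd0 : 0 ≤ d j x := ENNReal.toReal_nonneg
      rw [norm_mul, Real.norm_of_nonneg (mul_pos (hb0 x) (hc0 x)).le, Real.norm_eq_abs]
      calc b x * c x * |n j x| ≤ b x * c x * ((B x).toReal * d j x) :=
            mul_le_mul_of_nonneg_left (hx j) (mul_pos (hb0 x) (hc0 x)).le
        _ = c x * (b x * (B x).toReal) * d j x := by ring
        _ ≤ 1 * d j x := by
            refine mul_le_mul_of_nonneg_right ?_ hd0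
            exact mul_le_one₀ (hc1 x) (mul_nonneg (hb0 x).le ENNReal.toReal_nonneg) (hbB x)
        _ = d j x := one_mul _
    have hle2 : ∫ x, d j x ∂π ≤ (eLpNorm (d j) 2 π).toReal := by
      have h1 := enorm_integral_le_eLpNorm_two (d j) hdL.1
      rw [Real.enorm_eq_ofReal (integral_nonneg fun x => ENNReal.toReal_nonneg)] at h1
      exact (ENNReal.ofReal_le_iff_le_toReal hdL.2.ne).1 h1
    rw [e1, one_mul, Lp.norm_def, eLpNorm_congr_ae eadj, ← hdsq]
    exact hle.trans hle2
  obtain ⟨Q, hQ⟩ := exists_apply_eq_of_abs_inner_apply_le K (hφ.toLp _) 1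
    (fun g hg => by
      have h1 := hKa g g (Lp.stronglyMeasurable g).measurable Filter.EventuallyEq.rfl
      rw [hg] at h1
      have h2 := hinj g (Lp.stronglyMeasurable g).measurable (Lp.memLp g)
        (h1.symm.trans (Lp.coeFn_zero ℝ 2 _))
      exact Lp.ext (h2.trans (Lp.coeFn_zero ℝ 2 _).symm))
    (fun x => (TopologicalSpace.denseRange_denseSeq (Lp ℝ 2 (π ⊗ₘ ρ))).induction_on
      (p := fun x => |inner ℝ (hφ.toLp _) (K x)| ≤ 1 * ‖K.adjoint (K x)‖) x
      (isClosed_le (by fun_prop) (by fun_prop)) hglob)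
  have hsol : ∀ᵐ p ∂(π ⊗ₘ μ), ∫ w, Q (p.1, w) ∂κ p = b p.1 * (c p.1 * f p) := by
    refine (hKc Q).symm.trans ?_
    rw [hQ]
    exact hφ.coeFn_toLp
  -- Factors depending on x alone commute with the operator, so the scaling is undone here. This
  -- costs the global square-integrability and leaves the fibrewise one.
  refine ⟨fun p => (b p.1 * c p.1)⁻¹ * Q p,
    ((hbm.comp measurable_fst).mul (hcm.comp measurable_fst)).inv.mul (hmeas Q), ?_, ?_⟩
  · filter_upwards [ae_memLp_of_compProd (hmeas Q) (Lp.memLp Q)] with x hx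
    exact hx.const_mul _
  · filter_upwards [hsol] with p hp
    rw [integral_const_mul, hp, ← mul_assoc (b p.1),
      inv_mul_cancel_left₀ (mul_pos (hb0 _) (hc0 _)).ne']

end Parametrized

/-! ### Conditional laws and conditional expectations -/

section Laws

variable {Ω 𝒳 𝒳' 𝒴 𝒱 : Type*} {mΩ : MeasurableSpace Ω} {mX : MeasurableSpace 𝒳}
  {mX' : MeasurableSpace 𝒳'} {mY : MeasurableSpace 𝒴} {mV : MeasurableSpace 𝒱}
  {P : Measure Ω} {X : Ω → 𝒳} {X' : Ω → 𝒳'} {Y : Ω → 𝒴} {V : Ω → 𝒱}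

theorem hasCondDistrib_condDistrib [StandardBorelSpace 𝒴] [Nonempty 𝒴] [IsFiniteMeasure P]
    (hX : Measurable X) (hY : Measurable Y) : HasCondDistrib Y X (condDistrib Y X P) P :=
  ⟨(hX.prodMk hY).aemeasurable, (compProd_map_condDistrib hY.aemeasurable).symm⟩

theorem hasCondDistrib_condLaw [StandardBorelSpace Ω] [Nonempty Ω] [IsFiniteMeasure P]
    (hX : Measurable X) : HasCondDistrib id X (condLaw P X) P :=
  hasCondDistrib_condDistrib hX measurable_id

instance [StandardBorelSpace Ω] [Nonempty Ω] [IsFiniteMeasure P] : IsMarkovKernel (condLaw P X) := by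
  unfold condLaw; infer_instance

/-- Recoding the conditioning variable. -/
theorem HasCondDistrib.recode [SFinite P] {κ : Kernel 𝒳' 𝒴} [IsSFiniteKernel κ]
    (h : HasCondDistrib Y X' κ P)
    {s : 𝒳' → 𝒳} (hs : Measurable s) {r : 𝒳 → 𝒳'} (hr : Measurable r) (hrs : ∀ x, r (s x) = x) :
    HasCondDistrib Y (fun ω => s (X' ω)) (κ.comap r hr) P := by
  refine HasCondDistrib.comp_right (hf := hs) ?_
  have : (κ.comap r hr).comap s hs = κ := by
    ext x
    simp [Kernel.comap_apply, hrs]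
  rwa [this]

theorem HasCondDistrib.ae_eq [IsFiniteMeasure P] {κ κ' : Kernel 𝒳 𝒴} [IsFiniteKernel κ]
    [IsFiniteKernel κ'] [MeasurableSpace.CountablyGenerated 𝒴] (h : HasCondDistrib Y X κ P)
    (h' : HasCondDistrib Y X κ' P) : κ =ᵐ[P.map X] κ' :=
  Kernel.ae_eq_of_compProd_eq (h.map_eq.symm.trans h'.map_eq)

theorem HasCondDistrib.prodMk_self [SFinite P] {κ : Kernel 𝒳 𝒴} [IsMarkovKernel κ]
    (hX : Measurable X) (hY : Measurable Y) (h : HasCondDistrib Y X κ P) :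
    HasCondDistrib (fun ω => (X ω, Y ω)) X (Kernel.id ×ₖ κ) P := by
  refine ⟨(hX.prodMk (hX.prodMk hY)).aemeasurable, ?_⟩
  refine Measure.ext_of_lintegral _ fun F hF => ?_
  have e : P.map (fun ω => (X ω, X ω, Y ω))
      = (P.map fun ω => (X ω, Y ω)).map fun p => (p.1, p) := by
    rw [Measure.map_map (by fun_prop) (by fun_prop)]; rfl
  rw [e, h.map_eq, lintegral_map hF (by fun_prop), Measure.lintegral_compProd (by fun_prop),
    Measure.lintegral_compProd hF]
  refine lintegral_congr fun x => ?_
  rw [Kernel.prod_apply, Kernel.id_apply, Measure.dirac_prod, lintegral_map (by fun_prop)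
    (by fun_prop)]

/-- Under the conditional law given `X = x`, the pair `(X, Y)` has law `δ_x × κ_x`. -/
theorem HasCondDistrib.condLaw_map [StandardBorelSpace Ω] [Nonempty Ω] [IsFiniteMeasure P]
    [MeasurableSpace.CountablyGenerated 𝒳] [MeasurableSpace.CountablyGenerated 𝒴]
    {κ : Kernel 𝒳 𝒴} [IsMarkovKernel κ] (hX : Measurable X) (hY : Measurable Y)
    (h : HasCondDistrib Y X κ P) :
    ∀ᵐ x ∂(P.map X), (condLaw P X x).map (fun ω => (X ω, Y ω)) = (κ x).map (Prod.mk x) := by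
  have h1 := (hasCondDistrib_condLaw (P := P) hX).comp_left (hX.prodMk hY)
  filter_upwards [HasCondDistrib.ae_eq h1 (HasCondDistrib.prodMk_self hX hY h)] with x hx
  rw [Kernel.map_apply _ (hX.prodMk hY), Kernel.prod_apply, Kernel.id_apply,
    Measure.dirac_prod] at hx
  exact hx

theorem HasCondDistrib.condLaw_map_right [StandardBorelSpace Ω] [Nonempty Ω] [IsFiniteMeasure P]
    [MeasurableSpace.CountablyGenerated 𝒴]
    {κ : Kernel 𝒳 𝒴} [IsMarkovKernel κ] (hX : Measurable X) (hY : Measurable Y)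
    (h : HasCondDistrib Y X κ P) :
    ∀ᵐ x ∂(P.map X), (condLaw P X x).map Y = κ x := by
  have h1 := (hasCondDistrib_condLaw (P := P) hX).comp_left hY
  filter_upwards [HasCondDistrib.ae_eq h1 h] with x hx
  rw [Kernel.map_apply _ hY] at hx
  exact hx

/-- The identity kernel is a conditional law of X given X, and such laws are almost everywhere
unique. This permits replacing X by its value inside integrals against `condLaw P X x`. -/
theorem ae_condLaw_eq [StandardBorelSpace Ω] [Nonempty Ω] [IsFiniteMeasure P]
    [StandardBorelSpace 𝒳] (hX : Measurable X) :
    ∀ᵐ x ∂(P.map X), ∀ᵐ ω ∂(condLaw P X x), X ω = x := by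
  have h : HasCondDistrib X X (Kernel.id : Kernel 𝒳 𝒳) P := by
    refine ⟨(hX.prodMk hX).aemeasurable, ?_⟩
    rw [Measure.compProd_id, Measure.map_map (by unfold Function.diag; fun_prop) hX]
    rfl
  filter_upwards [HasCondDistrib.condLaw_map_right hX hX h] with x hx
  refine ae_of_ae_map hX.aemeasurable (p := fun x' => x' = x) ?_
  rw [hx, Kernel.id_apply]
  exact (ae_dirac_iff (measurableSet_singleton x)).2 rfl

/-- Used to adjoin A_t or O_0 to the conditioning variable without changing a known law. -/
theorem HasCondDistrib.prodMk_of_condIndepFun [StandardBorelSpace Ω] [IsFiniteMeasure P]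
    [StandardBorelSpace 𝒴] [Nonempty 𝒴] [StandardBorelSpace 𝒱] [Nonempty 𝒱]
    {κ : Kernel 𝒳 𝒴} [IsFiniteKernel κ] (hX : Measurable X) (hY : Measurable Y) (hV : Measurable V)
    (h : HasCondDistrib Y X κ P) (hi : Y ⟂ᵢ[X, hX; P] V) :
    HasCondDistrib Y (fun ω => (X ω, V ω)) (κ.prodMkRight 𝒱) P := by
  refine ⟨((hX.prodMk hV).prodMk hY).aemeasurable, ?_⟩
  rw [← condDistrib_ae_eq_iff_measure_eq_compProd _ hY.aemeasurable]
  have h1 := (condIndepFun_iff_condDistrib_prod_ae_eq_prodMkRight hY hV hX).1 hi.symm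
  have h2 : condDistrib Y X P =ᵐ[P.map X] κ :=
    (condDistrib_ae_eq_iff_measure_eq_compProd _ hY.aemeasurable _).2 h.map_eq
  have h3 : ∀ᵐ p ∂(P.map fun ω => (X ω, V ω)), condDistrib Y X P p.1 = κ p.1 := by
    refine ae_of_ae_map measurable_fst.aemeasurable (p := fun x => condDistrib Y X P x = κ x) ?_
    rwa [Measure.map_map measurable_fst (hX.prodMk hV)]
  filter_upwards [h1, h3] with p hp1 hp3
  rw [hp1, Kernel.prodMkRight_apply, hp3, Kernel.prodMkRight_apply]

/-- The conditional expectation of a function of `(X, Y)` given `X`, when the law of `Y` given `X`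
is known. -/
theorem HasCondDistrib.condExp_eq [StandardBorelSpace 𝒴] [Nonempty 𝒴] [IsFiniteMeasure P]
    {κ : Kernel 𝒳 𝒴} [IsFiniteKernel κ] (hX : Measurable X) (hY : Measurable Y)
    (h : HasCondDistrib Y X κ P) {F : 𝒳 × 𝒴 → ℝ} (hF : Measurable F)
    (hint : Integrable (fun ω => F (X ω, Y ω)) P) :
    P[fun ω => F (X ω, Y ω) | mX.comap X] =ᵐ[P] fun ω => ∫ y, F (X ω, y) ∂κ (X ω) := by
  have h2 : condDistrib Y X P =ᵐ[P.map X] κ :=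
    (condDistrib_ae_eq_iff_measure_eq_compProd _ hY.aemeasurable _).2 h.map_eq
  filter_upwards [condExp_prod_ae_eq_integral_condDistrib hX hY.aemeasurable hF.stronglyMeasurable
    hint, ae_of_ae_map hX.aemeasurable h2] with ω h3 h4
  rw [h3, h4]

theorem condDistrib_prodMk_ae_eq [StandardBorelSpace 𝒴] [Nonempty 𝒴] [StandardBorelSpace 𝒱]
    [Nonempty 𝒱] [IsFiniteMeasure P] (hX : Measurable X) (hY : Measurable Y) (hV : Measurable V) :
    condDistrib (fun ω => (Y ω, V ω)) X P
      =ᵐ[P.map X] condDistrib Y X P ⊗ₖ condDistrib V (fun ω => (X ω, Y ω)) P := by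
  refine (condDistrib_ae_eq_iff_measure_eq_compProd _ (hY.prodMk hV).aemeasurable _).2 ?_
  have h : (P.map X ⊗ₘ (condDistrib Y X P ⊗ₖ condDistrib V (fun ω => (X ω, Y ω)) P))
      = ((P.map X ⊗ₘ condDistrib Y X P) ⊗ₘ condDistrib V (fun ω => (X ω, Y ω)) P).map
        MeasurableEquiv.prodAssoc := Measure.compProd_assoc'.symm
  rw [h, compProd_map_condDistrib hY.aemeasurable, compProd_map_condDistrib hV.aemeasurable,
    Measure.map_map (by fun_prop) (by fun_prop)]
  rfl

/-- Disintegrating the conditional law of `(Y, V)` in the two possible orders. -/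
theorem condDistrib_compProd_eq_swap [StandardBorelSpace 𝒴] [Nonempty 𝒴] [StandardBorelSpace 𝒱]
    [Nonempty 𝒱] [IsFiniteMeasure P] (hX : Measurable X) (hY : Measurable Y) (hV : Measurable V) :
    ∀ᵐ x ∂(P.map X),
      condDistrib Y X P x ⊗ₘ (condDistrib V (fun ω => (X ω, Y ω)) P).sectR x
        = (condDistrib V X P x ⊗ₘ (condDistrib Y (fun ω => (X ω, V ω)) P).sectR x).map
          Prod.swap := by
  filter_upwards [condDistrib_prodMk_ae_eq (P := P) hX hY hV,
    condDistrib_prodMk_ae_eq (P := P) hX hV hY,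
    condDistrib_comp (μ := P) X (hV.prodMk hY).aemeasurable measurable_swap] with x h1 h2 h3
  rw [← Kernel.compProd_apply_eq_compProd_sectR, ← Kernel.compProd_apply_eq_compProd_sectR, ← h1,
    ← h2, ← Kernel.map_apply _ measurable_swap, ← h3]
  rfl

theorem memLp_cond [IsProbabilityMeasure P] {B : Set Ω} {F : Ω → ℝ} {p : ℝ≥0∞} (hF : MemLp F p P) :
    MemLp F p (P[|B]) := by
  by_cases h0 : P B = 0
  · rw [cond_eq_zero_of_meas_eq_zero h0]
    exact ⟨aestronglyMeasurable_zero_measure F, by simp⟩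
  · exact (hF.restrict B).smul_measure (ENNReal.inv_ne_top.2 h0)

theorem memLp_cond_congr [IsProbabilityMeasure P] {B : Set Ω} (hB : MeasurableSet B)
    {F F' : Ω → ℝ} {p : ℝ≥0∞} (hF : MemLp F p P)
    (hFF : ∀ ω ∈ B, F' ω = F ω) : MemLp F' p (P[|B]) :=
  (memLp_congr_ae (by filter_upwards [ae_cond_mem hB] with ω hω using (hFF ω hω).symm)).1
    (memLp_cond hF)

/-- A function with vanishing conditional expectation given `V` has vanishing conditional
expectation given `Y` under the law conditioned on `B`, if `B` is an event of `V` and `Y` a function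
of `V` on `B`. -/
theorem condExp_cond_eq_zero [IsProbabilityMeasure P] (hV : Measurable V) (hY : Measurable Y)
    {B : Set Ω} (hB : MeasurableSet B) {F F' : Ω → ℝ} (hF : Integrable F P)
    (h0 : P[F | mV.comap V] =ᵐ[P] 0) (hFF : ∀ ω ∈ B, F' ω = F ω)
    (hsub : ∀ s, MeasurableSet s → MeasurableSet[mV.comap V] (Y ⁻¹' s ∩ B)) :
    (P[|B])[F' | mY.comap Y] =ᵐ[P[|B]] 0 := by
  have hF' : Integrable F' (P[|B]) := by
    rw [← memLp_one_iff_integrable] at hF ⊢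
    exact memLp_cond_congr hB hF hFF
  refine (ae_eq_condExp_of_forall_setIntegral_eq hY.comap_le hF' (fun s _ _ => ?_) ?_ ?_).symm
  · exact (integrable_zero Ω ℝ _).integrableOn
  · rintro s ⟨S, hS, rfl⟩ _
    have h1 : ∫ ω in Y ⁻¹' S, F' ω ∂(P[|B]) = ∫ ω in Y ⁻¹' S, F ω ∂(P[|B]) := by
      refine integral_congr_ae (ae_restrict_of_ae ?_)
      filter_upwards [ae_cond_mem hB] with ω hω using hFF ω hω
    have h2 : ∫ ω in Y ⁻¹' S ∩ B, F ω ∂P = 0 := by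
      rw [← setIntegral_condExp hV.comap_le hF (hsub S hS)]
      refine (setIntegral_congr_ae (hV.comap_le _ (hsub S hS)) ?_).trans (integral_zero _ _)
      filter_upwards [h0] with ω hω _ using hω
    rw [h1, ProbabilityTheory.cond, Measure.restrict_smul, Measure.restrict_restrict (hY hS),
      integral_smul_measure, integral_smul_measure, h2]
    simp
  · exact aestronglyMeasurable_zero

end Laws

/-! ### Solvability of the stage equations and of the backward system -/

namespace Data

set_option linter.unusedSectionVars false

variable {Ω O₀ : Type*} {U O A W : ℕ → Type*}
    [MeasurableSpace Ω] [StandardBorelSpace Ω] [Nonempty Ω]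
    [MeasurableSpace O₀] [StandardBorelSpace O₀]
    [∀ t, MeasurableSpace (U t)] [∀ t, StandardBorelSpace (U t)]
    [∀ t, MeasurableSpace (O t)] [∀ t, StandardBorelSpace (O t)]
    [∀ t, MeasurableSpace (W t)] [∀ t, StandardBorelSpace (W t)]
    [∀ t, Fintype (A t)] [∀ t, MeasurableSpace (A t)] [∀ t, MeasurableSingletonClass (A t)]
    {N : ℕ} {M : ConfoundedProcess U O A}
    {P : Measure Ω} [IsProbabilityMeasure P] {D : Data Ω O₀ U O A W}

theorem measurable_ZA (D : Data Ω O₀ U O A W) (t : ℕ) : Measurable (D.ZA t) :=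
  (D.measurable_Z t).prodMk (D.measurable_action t)

theorem measurable_ZOA (D : Data Ω O₀ U O A W) (t : ℕ) : Measurable (D.ZOA t) :=
  (D.measurable_Z t).prodMk (D.measurable_obs0.prodMk (D.measurable_action t))

theorem measurable_WZA (D : Data Ω O₀ U O A W) (t : ℕ) : Measurable (D.WZA t) :=
  (D.measurable_proxy t).prodMk ((D.measurable_Z t).prodMk (D.measurable_action t))

theorem GeneratedBy.ae_abs_rew_le (hgen : D.GeneratedBy M P N) {t : ℕ} (ht : t ≤ N) :
    ∀ᵐ ω ∂P, |D.rew t ω| ≤ M.rmax := by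
  have h1 : ∀ᵐ p ∂(P.map fun ω => (D.post t ω, D.rew t ω)), |p.2| ≤ M.rmax := by
    rw [hgen.reward_law t ht]
    refine Measure.ae_compProd_of_ae_ae (measurableSet_le (by fun_prop) (by fun_prop)) ?_
    exact .of_forall fun x => M.reward_bdd t _
  exact ae_of_ae_map ((D.measurable_post t).prodMk (D.measurable_rew t)).aemeasurable h1

theorem GeneratedBy.integrable_rew (hgen : D.GeneratedBy M P N) {t : ℕ} (ht : t ≤ N) :
    Integrable (D.rew t) P :=
  Integrable.of_bound (D.measurable_rew t).aestronglyMeasurable M.rmax (hgen.ae_abs_rew_le ht)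

/-- The measurability field of `Regular` stops at stage N; at stage N + 1 the class is {0}. -/
theorem Regular.measurable_next {ν : SuperPolicy O A} {G : ∀ t, Set (W t × ZSp O A t × A t → ℝ)}
    (hreg : D.Regular P ν N G) {t : ℕ} (ht : t ≤ N) {g : W (t + 1) × ZSp O A (t + 1) × A (t + 1) → ℝ}
    (hg : g ∈ G (t + 1)) : Measurable g := by
  rcases ht.eq_or_lt with rfl | h
  · rw [hreg.terminal, Set.mem_singleton_iff] at hg
    rw [hg]; exact measurable_const
  · exact hreg.measurable _ h g hg

theorem Regular.integrable_next {ν : SuperPolicy O A} {G : ∀ t, Set (W t × ZSp O A t × A t → ℝ)}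
    (hreg : D.Regular P ν N G) {t : ℕ} (ht : t ≤ N) {g : W (t + 1) × ZSp O A (t + 1) × A (t + 1) → ℝ}
    (hg : g ∈ G (t + 1)) : Integrable (fun ω => g (D.WZA (t + 1) ω)) P := by
  rcases ht.eq_or_lt with rfl | h
  · rw [hreg.terminal, Set.mem_singleton_iff] at hg
    rw [hg]; exact integrable_zero _ _ _
  · exact hreg.integrable _ h g hg

variable [Nonempty O₀] [∀ t, Nonempty (W t)]

theorem hasCondDistrib_condLaw_ZOA (D : Data Ω O₀ U O A W) (t : ℕ) :
    HasCondDistrib id (fun ω => (D.ZA t ω, D.obs0 ω))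
      ((condLaw P (D.ZOA t)).comap
        (fun p : (ZSp O A t × A t) × O₀ => (p.1.1, p.2, p.1.2)) (by fun_prop)) P :=
  HasCondDistrib.recode (hasCondDistrib_condLaw (P := P) (D.measurable_ZOA t))
    (s := fun y : ZSp O A t × O₀ × A t => ((y.1, y.2.2), y.2.1)) (by fun_prop) _ fun _ => rfl

/-- Matches the kernel defining `proxyOp`, conditioned on (Z_t, O_0, A_t), with the disintegration
over the base (Z_t, A_t) needed by `exists_measurable_solution`. The two versions agree only almost
everywhere. -/
theorem ae_condLaw_ZOA_map_proxy (D : Data Ω O₀ U O A W) (t : ℕ) :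
    ∀ᵐ p ∂(P.map fun ω => (D.ZA t ω, D.obs0 ω)),
      (condLaw P (D.ZOA t) (p.1.1, p.2, p.1.2)).map (D.proxy t)
        = condDistrib (D.proxy t) (fun ω => (D.ZA t ω, D.obs0 ω)) P p := by
  have h1 := (hasCondDistrib_condLaw_ZOA (P := P) D t).comp_left (D.measurable_proxy t)
  have h2 := hasCondDistrib_condDistrib (P := P)
    ((D.measurable_ZA t).prodMk D.measurable_obs0) (D.measurable_proxy t)
  filter_upwards [HasCondDistrib.ae_eq h1 h2] with p hp
  rw [Kernel.map_apply _ (D.measurable_proxy t), Kernel.comap_apply] at hp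
  exact hp

theorem ae_ae_condLaw_ZOA_map_proxy (D : Data Ω O₀ U O A W) (t : ℕ) :
    ∀ᵐ x ∂(P.map (D.ZA t)), ∀ᵐ o ∂(condDistrib D.obs0 (D.ZA t) P x),
      (condLaw P (D.ZOA t) (x.1, o, x.2)).map (D.proxy t)
        = condDistrib (D.proxy t) (fun ω => (D.ZA t ω, D.obs0 ω)) P (x, o) := by
  have h := ae_condLaw_ZOA_map_proxy (P := P) D t
  rw [← compProd_map_condDistrib D.measurable_obs0.aemeasurable] at h
  exact Measure.ae_ae_of_ae_compProd h

theorem ae_condLaw_ZA_map_obs0 (D : Data Ω O₀ U O A W) (t : ℕ) :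
    ∀ᵐ x ∂(P.map (D.ZA t)),
      (condLaw P (D.ZA t) x).map D.obs0 = condDistrib D.obs0 (D.ZA t) P x :=
  HasCondDistrib.condLaw_map_right (D.measurable_ZA t) D.measurable_obs0
    (hasCondDistrib_condDistrib (P := P) (D.measurable_ZA t) D.measurable_obs0)

theorem ae_condLaw_ZA_map_proxy (D : Data Ω O₀ U O A W) (t : ℕ) :
    ∀ᵐ x ∂(P.map (D.ZA t)),
      (condLaw P (D.ZA t) x).map (D.proxy t) = condDistrib (D.proxy t) (D.ZA t) P x :=
  HasCondDistrib.condLaw_map_right (D.measurable_ZA t) (D.measurable_proxy t)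
    (hasCondDistrib_condDistrib (P := P) (D.measurable_ZA t) (D.measurable_proxy t))

theorem measurable_target (D : Data Ω O₀ U O A W) (t : ℕ)
    {g : W (t + 1) × ZSp O A (t + 1) × A (t + 1) → ℝ} (hg : Measurable g) :
    Measurable fun p : (ZSp O A t × A t) × O₀ => D.target P t g p.1 p.2 := by
  have h1 : Measurable fun y => ∫ ω, (D.rew t ω + g (D.WZA (t + 1) ω)) ∂(condLaw P (D.ZOA t) y) :=
    (StronglyMeasurable.integral_kernel (κ := condLaw P (D.ZOA t))
      ((D.measurable_rew t).add (hg.comp (D.measurable_WZA _))).stronglyMeasurable).measurable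
  exact h1.comp (g := fun y => ∫ ω, (D.rew t ω + g (D.WZA (t + 1) ω)) ∂(condLaw P (D.ZOA t) y))
    (f := fun p : (ZSp O A t × A t) × O₀ => (p.1.1, p.2, p.1.2)) (by fun_prop)

/-- The singular systems bound the pairing of the right-hand side with the range of the operator. -/
theorem ae_exists_abs_integral_target_le (D : Data Ω O₀ U O A W) (t : ℕ)
    {g : W (t + 1) × ZSp O A (t + 1) × A (t + 1) → ℝ} (hg : Measurable g)
    (S : ZSp O A t × A t → SingularData (W t) O₀)
    (hS : ∀ᵐ x ∂(P.map (D.ZA t)), D.IsSingularSystem P t x (S x))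
    (hsq : ∀ᵐ x ∂(P.map (D.ZA t)), D.MemO P t x (D.target P t g x))
    (hsum : ∀ᵐ x ∂(P.map (D.ZA t)), Summable (fun n : (S x).idx =>
        ((S x).val n)⁻¹ ^ 2 * D.innerO P t x (D.target P t g x) ((S x).right n) ^ 2)) :
    ∀ᵐ x ∂(P.map (D.ZA t)), ∃ C : ℝ, ∀ h, MemLp h 2 (condDistrib (D.proxy t) (D.ZA t) P x) →
      |∫ o, D.target P t g x o *
          ∫ w, h w ∂(condDistrib (D.proxy t) (fun ω => (D.ZA t ω, D.obs0 ω)) P (x, o))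
          ∂(condDistrib D.obs0 (D.ZA t) P x)|
        ≤ C * (eLpNorm (fun w => ∫ o,
            ∫ w', h w' ∂(condDistrib (D.proxy t) (fun ω => (D.ZA t ω, D.obs0 ω)) P (x, o))
            ∂(condDistrib D.obs0 (fun ω => (D.ZA t ω, D.proxy t ω)) P (x, w))) 2
            (condDistrib (D.proxy t) (D.ZA t) P x)).toReal := by
  filter_upwards [hS, hsq, hsum, ae_ae_condLaw_ZOA_map_proxy (P := P) D t,
    ae_condLaw_ZA_map_obs0 (P := P) D t, ae_condLaw_ZA_map_proxy (P := P) D t,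
    condDistrib_compProd_eq_swap (P := P) (D.measurable_ZA t) D.measurable_obs0
      (D.measurable_proxy t)] with x hSx hfx hsx hα hμ hρ hrev
  -- From here to `hae`, the operator, norms, inner products and null sets over Ω are rewritten on
  -- the spaces of W_t and O_0, with the kernels that appear in `hrev`.
  have hop : ∀ h : W t → ℝ, Measurable h → ∀ᵐ o ∂(condDistrib D.obs0 (D.ZA t) P x),
      D.proxyOp P t x h o
        = ∫ w, h w ∂(condDistrib (D.proxy t) (fun ω => (D.ZA t ω, D.obs0 ω)) P (x, o)) := by
    intro h hh
    filter_upwards [hα] with o ho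
    rw [← ho, integral_map (D.measurable_proxy t).aemeasurable hh.aestronglyMeasurable]
    rfl
  have hopm : ∀ h : W t → ℝ, Measurable h → Measurable (D.proxyOp P t x h) := by
    intro h hh
    have h1 : Measurable fun y => ∫ ω, h (D.proxy t ω) ∂(condLaw P (D.ZOA t) y) :=
      (StronglyMeasurable.integral_kernel (κ := condLaw P (D.ZOA t))
        (hh.comp (D.measurable_proxy t)).stronglyMeasurable).measurable
    exact h1.comp (g := fun y => ∫ ω, h (D.proxy t ω) ∂(condLaw P (D.ZOA t) y))
      (f := fun o : O₀ => (x.1, o, x.2)) (by fun_prop)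
  have hW : ∀ h : W t → ℝ, Measurable h →
      (MemLp h 2 (condDistrib (D.proxy t) (D.ZA t) P x) ↔
        MemLp (fun ω => h (D.proxy t ω)) 2 (condLaw P (D.ZA t) x)) := fun h hh => by
    rw [← hρ, memLp_map_measure_iff hh.aestronglyMeasurable (D.measurable_proxy t).aemeasurable]
    rfl
  have hO : ∀ h : O₀ → ℝ, Measurable h →
      (MemLp h 2 (condDistrib D.obs0 (D.ZA t) P x) ↔
        MemLp (fun ω => h (D.obs0 ω)) 2 (condLaw P (D.ZA t) x)) := fun h hh => by
    rw [← hμ, memLp_map_measure_iff hh.aestronglyMeasurable D.measurable_obs0.aemeasurable]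
    rfl
  have hWi : ∀ h h' : W t → ℝ, Measurable h → Measurable h' → D.innerW P t x h h'
      = ∫ w, h w * h' w ∂(condDistrib (D.proxy t) (D.ZA t) P x) := fun h h' hh hh' => by
    rw [← hρ, integral_map (D.measurable_proxy t).aemeasurable
      (show Measurable fun w => h w * h' w from hh.mul hh').aestronglyMeasurable]
    rfl
  have hOi : ∀ h h' : O₀ → ℝ, Measurable h → Measurable h' → D.innerO P t x h h'
      = ∫ w, h w * h' w ∂(condDistrib D.obs0 (D.ZA t) P x) := fun h h' hh hh' => by
    rw [← hμ, integral_map D.measurable_obs0.aemeasurable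
      (show Measurable fun w => h w * h' w from hh.mul hh').aestronglyMeasurable]
    rfl
  have hae : ∀ h h' : O₀ → ℝ, Measurable h → Measurable h' →
      (∀ᵐ ω ∂(condLaw P (D.ZA t) x), h (D.obs0 ω) = h' (D.obs0 ω)) →
      ∀ᵐ o ∂(condDistrib D.obs0 (D.ZA t) P x), h o = h' o := fun h h' hh hh' H => by
    rw [← hμ, ae_map_iff D.measurable_obs0.aemeasurable (measurableSet_eq_fun hh hh')]
    exact H
  have hlm : ∀ n ∈ (S x).idx, Measurable ((S x).left n) := fun n hn => (hSx.memW n hn).1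
  have hrm : ∀ n ∈ (S x).idx, Measurable ((S x).right n) := fun n hn => (hSx.memO n hn).1
  have hfm : Measurable (D.target P t g x) :=
    (measurable_target (P := P) D t hg).comp (by fun_prop : Measurable fun o : O₀ => (x, o))
  refine exists_abs_integral_le_of_singular
    (κ := (condDistrib (D.proxy t) (fun ω => (D.ZA t ω, D.obs0 ω)) P).sectR x)
    (η := (condDistrib D.obs0 (fun ω => (D.ZA t ω, D.proxy t ω)) P).sectR x) hrev (S x) hSx.pos
    (fun n hn => (hW _ (hlm n hn)).2 (hSx.memW n hn).2)
    (fun n hn => (hO _ (hrm n hn)).2 (hSx.memO n hn).2)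
    (fun n hn m hm => by rw [← hWi _ _ (hlm n hn) (hlm m hm), hSx.orthoW n hn m hm])
    (fun n hn => ?_) (fun n hn h hh hhL => ?_) (fun h hh hhL hz => ?_)
    ((hO _ hfm).2 hfx.2) (hsx.congr fun n => ?_)
  · filter_upwards [hae _ _ (hopm _ (hlm n hn)) ((hrm n hn).const_mul _) (hSx.map_left n hn),
      hop _ (hlm n hn)] with o h1 h2
    exact h2.symm.trans h1
  · rw [← hWi _ _ hh (hlm n hn), ← hSx.adjoint_right n hn h ⟨hh, (hW _ hh).1 hhL⟩,
      hOi _ _ (hopm _ hh) (hrm n hn)]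
    refine integral_congr_ae ?_
    filter_upwards [hop _ hh] with o ho
    rw [ho]; rfl
  · filter_upwards [hae _ _ (hopm _ hh) measurable_const (hSx.ker h ⟨hh, (hW _ hh).1 hhL⟩ fun n hn => by
      rw [hWi _ _ hh (hlm n hn), hz n hn]), hop _ hh] with o h1 h2
    exact h2.symm.trans h1
  · rw [hOi _ _ hfm (hrm n n.2)]

/-- The completeness condition for the pre-collected observation, as injectivity of the adjoint of
the global operator. -/
theorem CompleteObs.eq_zero (hcompO : D.CompleteObs P N) {t : ℕ} (ht : t ≤ N)
    (g : (ZSp O A t × A t) × O₀ → ℝ) (hg : Measurable g)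
    (hgL : MemLp g 2 (P.map fun ω => (D.ZA t ω, D.obs0 ω)))
    (h0 : ∀ᵐ p ∂(P.map fun ω => (D.ZA t ω, D.proxy t ω)),
      ∫ o, g (p.1, o) ∂(condDistrib D.obs0 (fun ω => (D.ZA t ω, D.proxy t ω)) P p) = 0) :
    g =ᵐ[P.map fun ω => (D.ZA t ω, D.obs0 ω)] 0 := by
  have hV := (D.measurable_ZA t).prodMk (D.measurable_proxy t)
  have hZO := (D.measurable_ZA t).prodMk D.measurable_obs0
  have hF : MemLp (fun ω => g (D.ZA t ω, D.obs0 ω)) 2 P :=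
    (memLp_map_measure_iff hg.aestronglyMeasurable hZO.aemeasurable).1 hgL
  have hFi := hF.integrable (by norm_num)
  have hce : P[fun ω => g (D.ZA t ω, D.obs0 ω) |
      MeasurableSpace.comap (fun ω => (D.ZA t ω, D.proxy t ω)) inferInstance] =ᵐ[P] 0 := by
    have h1 := condExp_prod_ae_eq_integral_condDistrib (μ := P) hV D.measurable_obs0.aemeasurable
      (f := fun q : ((ZSp O A t × A t) × W t) × O₀ => g (q.1.1, q.2))
      (hg.comp (by fun_prop)).stronglyMeasurable hFi
    filter_upwards [h1, ae_of_ae_map hV.aemeasurable h0] with ω h2 h3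
    rw [h2]; exact h3
  -- Completeness is stated for one action at a time, so the action in g is frozen at a. The
  -- hypothesis is needed only on the event A_t = a, while the conclusion holds under P; the
  -- finitely many actions are then recombined.
  have hall : ∀ a : A t, ∀ᵐ ω ∂P, g ((D.Z t ω, a), D.obs0 ω) = 0 := by
    intro a
    have hB : MeasurableSet (D.action t ⁻¹' {a}) := D.measurable_action t (measurableSet_singleton a)
    have hFF : ∀ ω ∈ D.action t ⁻¹' {a},
        g ((D.Z t ω, a), D.obs0 ω) = g (D.ZA t ω, D.obs0 ω) := fun ω hω => by
      rw [← show D.action t ω = a from hω]; rfl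
    refine (hcompO t ht a (fun p => g ((p.1, a), p.2)) (hg.comp (by fun_prop))
      (memLp_cond_congr hB hF hFF)).1 ?_
    refine condExp_cond_eq_zero hV ((D.measurable_proxy t).prodMk (D.measurable_Z t)) hB hFi hce hFF
      fun s hs => ⟨(fun v => (v.2, v.1.1)) ⁻¹' s ∩ (fun v => v.1.2) ⁻¹' {a}, ?_, rfl⟩
    exact ((by fun_prop : Measurable fun v : (ZSp O A t × A t) × W t => (v.2, v.1.1)) hs).inter
      ((by fun_prop : Measurable fun v : (ZSp O A t × A t) × W t => v.1.2)
        (measurableSet_singleton a))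
  have h1 : ∀ᵐ ω ∂P, g (D.ZA t ω, D.obs0 ω) = 0 := by
    filter_upwards [ae_all_iff.2 hall] with ω hω using hω (D.action t ω)
  exact (ae_map_iff hZO.aemeasurable (measurableSet_eq_fun hg measurable_const)).2 h1

/-- Solvability of the equation of stage `t` for one continuation. -/
theorem exists_solution (hgen : D.GeneratedBy M P N) (hcompO : D.CompleteObs P N)
    {ν : SuperPolicy O A} {G : ∀ t, Set (W t × ZSp O A t × A t → ℝ)} (hreg : D.Regular P ν N G)
    {t : ℕ} (ht : t ≤ N) {g : W (t + 1) × ZSp O A (t + 1) × A (t + 1) → ℝ} (hg : g ∈ G (t + 1)) :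
    ∃ q : (ZSp O A t × A t) × W t → ℝ, Measurable q ∧
      (∀ᵐ x ∂(P.map (D.ZA t)),
        MemLp (fun ω => q (x, D.proxy t ω)) 2 (condLaw P (D.ZA t) x)) ∧
      CondMeanEq P (D.ZOA t) (fun ω => q (D.ZA t ω, D.proxy t ω) - D.rew t ω
        - g (D.WZA (t + 1) ω)) 0 := by
  have hgm := hreg.measurable_next ht hg
  have hgi := hreg.integrable_next ht hg
  obtain ⟨S, hS, hsum⟩ := hreg.picard t ht
  have hsq := hreg.square_integrable t ht g hg
  have hrev := condDistrib_compProd_eq_swap (P := P) (D.measurable_ZA t) D.measurable_obs0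
      (D.measurable_proxy t)
  have hfm := measurable_target (P := P) D t hgm
  have eO : P.map (D.ZA t) ⊗ₘ condDistrib D.obs0 (D.ZA t) P = P.map fun ω => (D.ZA t ω, D.obs0 ω) :=
    compProd_map_condDistrib D.measurable_obs0.aemeasurable
  have eW : P.map (D.ZA t) ⊗ₘ condDistrib (D.proxy t) (D.ZA t) P
      = P.map fun ω => (D.ZA t ω, D.proxy t ω) :=
    compProd_map_condDistrib (D.measurable_proxy t).aemeasurable
  have : IsProbabilityMeasure (P.map (D.ZA t)) :=
    Measure.isProbabilityMeasure_map (D.measurable_ZA t).aemeasurable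
  obtain ⟨q, hqm, hqL, hqs⟩ := exists_measurable_solution hrev
    (fun g hg hgL h0 => by
      rw [eO] at hgL ⊢
      rw [eW] at h0
      exact hcompO.eq_zero ht g hg hgL h0) hfm
    (by
      filter_upwards [hsq, ae_condLaw_ZA_map_obs0 (P := P) D t] with x hx hμ
      rw [← hμ, memLp_map_measure_iff hx.1.aestronglyMeasurable D.measurable_obs0.aemeasurable]
      exact hx.2)
    (ae_exists_abs_integral_target_le D t hgm S hS hsq (hsum g hg))
  have hqx : ∀ x, Measurable fun w => q (x, w) := fun x => hqm.comp (by fun_prop)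
  refine ⟨q, hqm, ?_, ?_⟩
  · filter_upwards [hqL, ae_condLaw_ZA_map_proxy (P := P) D t] with x hx hρ
    rw [← hρ, memLp_map_measure_iff (hqx x).aestronglyMeasurable (D.measurable_proxy t).aemeasurable] at hx
    exact hx
  · have hqα : ∀ᵐ p ∂(P.map fun ω => (D.ZA t ω, D.obs0 ω)), Integrable (fun w => q (p.1, w))
        (condDistrib (D.proxy t) (fun ω => (D.ZA t ω, D.obs0 ω)) P p) := by
      rw [← eO]
      refine Measure.ae_compProd_of_ae_ae ?_ ?_
      · exact ProbabilityTheory.measurableSet_kernel_integrable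
          (κ := condDistrib (D.proxy t) (fun ω => (D.ZA t ω, D.obs0 ω)) P)
          (f := fun p w => q (p.1, w)) (hqm.comp (by fun_prop)).stronglyMeasurable
      · filter_upwards [hqL, hrev] with x hx hr
        have h1 := comp_eq_of_compProd_eq_swap hr
        rw [← h1] at hx
        filter_upwards [ae_memLp_of_comp hx] with o ho using ho.integrable (by norm_num)
    rw [eO] at hqs
    set s : ZSp O A t × O₀ × A t → (ZSp O A t × A t) × O₀ := fun y => ((y.1, y.2.2), y.2.1) with hs
    have hsm : Measurable s := by fun_prop
    have hback : ∀ {p : (ZSp O A t × A t) × O₀ → Prop},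
        (∀ᵐ x ∂(P.map fun ω => (D.ZA t ω, D.obs0 ω)), p x) →
        ∀ᵐ y ∂(P.map (D.ZOA t)), p (s y) := fun h => by
      refine ae_of_ae_map hsm.aemeasurable ?_
      rwa [Measure.map_map hsm (D.measurable_ZOA t)]
    have hrg : Integrable (fun ω => D.rew t ω + g (D.WZA (t + 1) ω)) P :=
      (hgen.integrable_rew ht).add hgi
    have hrgc : ∀ᵐ y ∂(P.map (D.ZOA t)),
        Integrable (fun ω => D.rew t ω + g (D.WZA (t + 1) ω)) (condLaw P (D.ZOA t) y) :=
      (hrg.comp_snd_map_prodMk (D.ZOA t)).condDistrib_ae_map aemeasurable_id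
    filter_upwards [hback hqα, hback hqs, hback (ae_condLaw_ZOA_map_proxy (P := P) D t), hrgc,
      ae_condLaw_eq (P := P) (D.measurable_ZOA t)] with y h1 h2 h3 h4 hZy
    have hqy : (fun ω => q (D.ZA t ω, D.proxy t ω)) =ᵐ[condLaw P (D.ZOA t) y]
        fun ω => q ((s y).1, D.proxy t ω) := by
      filter_upwards [hZy] with ω hω
      rw [← hω]; rfl
    have hqi : Integrable (fun ω => q ((s y).1, D.proxy t ω)) (condLaw P (D.ZOA t) y) := by
      rw [← h3] at h1
      exact (integrable_map_measure (hqx _).aestronglyMeasurable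
        (D.measurable_proxy t).aemeasurable).1 h1
    have hqI : ∫ ω, q ((s y).1, D.proxy t ω) ∂(condLaw P (D.ZOA t) y)
        = ∫ ω, (D.rew t ω + g (D.WZA (t + 1) ω)) ∂(condLaw P (D.ZOA t) y) := by
      rw [← h3, integral_map (D.measurable_proxy t).aemeasurable
        (hqx _).aestronglyMeasurable] at h2
      exact h2
    have hfun : (fun ω => q (D.ZA t ω, D.proxy t ω) - D.rew t ω - g (D.WZA (t + 1) ω))
        = fun ω => q (D.ZA t ω, D.proxy t ω) - (D.rew t ω + g (D.WZA (t + 1) ω)) :=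
      funext fun ω => by ring
    rw [hfun]
    have hqi' := hqi.congr hqy.symm
    refine ⟨hqi'.sub h4, ?_⟩
    rw [integral_sub hqi' h4, integral_congr_ae hqy, hqI, sub_self]
    rfl

/-- Solvability of the equation of stage `t` for a family of continuations. -/
theorem exists_solvesStage (hgen : D.GeneratedBy M P N) (hcompO : D.CompleteObs P N)
    {ν : SuperPolicy O A} {G : ∀ t, Set (W t × ZSp O A t × A t → ℝ)} (hreg : D.Regular P ν N G)
    {t : ℕ} (ht : t ≤ N) (g : Hist A (t + 1) → W (t + 1) × ZSp O A (t + 1) × A (t + 1) → ℝ)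
    (hg : ∀ rec, g rec ∈ G (t + 1)) : ∃ q, D.SolvesStage P N t q g := by
  -- The solution is chosen as a function of the continuation and not of `rec`. At the last stage
  -- all continuations are 0, so the choice is the same for all `rec`, as `SolvesStage.last`
  -- requires.
  choose F hFm hFL hFe using fun g : G (t + 1) => exists_solution hgen hcompO hreg ht g.2
  refine ⟨fun w z rec a => F ⟨g rec, hg rec⟩ ((z, a), w), fun rec a => (hFm _).comp (by fun_prop),
    fun rec => hFL _, fun htN w z rec rec' a => ?_, fun rec => hFe ⟨g rec, hg rec⟩⟩
  subst htN
  have h : ∀ rec, g rec = 0 := fun rec => by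
    have := hg rec
    rwa [hreg.terminal, Set.mem_singleton_iff] at this
  have : (⟨g rec, hg rec⟩ : G (t + 1)) = ⟨g rec', hg rec'⟩ := Subtype.ext ((h rec).trans (h rec').symm)
  simp only [this]

/-- Solvability of the backward system. -/
theorem exists_solvesSystem (hgen : D.GeneratedBy M P N) (hcompO : D.CompleteObs P N)
    {ν : SuperPolicy O A} {G : ∀ t, Set (W t × ZSp O A t × A t → ℝ)} (hreg : D.Regular P ν N G) :
    ∃ q : ∀ t, QFun O A W t, D.SolvesSystem P ν N q ∧
      ∀ t ≤ N, ∀ rec, vFun ν t (q t) rec ∈ G t := by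
  -- Here k counts the stages already solved, from the end. Each step modifies only stage N - k and
  -- leaves all later ones as they are.
  have key : ∀ k ≤ N + 1, ∃ q : ∀ t, QFun O A W t, q (N + 1) = 0 ∧
      (∀ t ≤ N, N + 1 - k ≤ t → D.SolvesStage P N t (q t) (vFun ν (t + 1) (q (t + 1)))) ∧
      ∀ t ≤ N + 1, N + 1 - k ≤ t → ∀ rec, vFun ν t (q t) rec ∈ G t := by
    intro k
    induction k with
    | zero =>
      intro _
      refine ⟨fun _ => 0, rfl, fun t ht ht' => by omega, fun t ht ht' rec => ?_⟩
      obtain rfl : t = N + 1 := by omega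
      rw [hreg.terminal, Set.mem_singleton_iff]
      funext x
      simp [vFun]
    | succ k ih =>
      intro hk
      obtain ⟨q, hq0, hqs, hqG⟩ := ih (by omega)
      obtain ⟨s, hs⟩ : ∃ s, s = N - k := ⟨_, rfl⟩
      have hsN : s ≤ N := by omega
      have hmem : ∀ rec, vFun ν (s + 1) (q (s + 1)) rec ∈ G (s + 1) :=
        hqG (s + 1) (by omega) (by omega)
      -- An arbitrary solution may have v_s outside the class; the closure condition exchanges it
      -- for one whose v_s is an admissible continuation for the stage before.
      obtain ⟨p, hp, hpG⟩ := hreg.closed s hsN _ hmem (exists_solvesStage hgen hcompO hreg hsN _ hmem)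
      refine ⟨Function.update q s p, ?_, fun t ht ht' => ?_, fun t ht ht' => ?_⟩
      · rw [Function.update_of_ne (by omega), hq0]
      · rw [Function.update_of_ne (show t + 1 ≠ s by omega)]
        by_cases hts : t = s
        · subst hts
          rwa [Function.update_self]
        · rw [Function.update_of_ne hts]
          exact hqs t ht (by omega)
      · by_cases hts : t = s
        · subst hts
          rwa [Function.update_self]
        · rw [Function.update_of_ne hts]
          exact hqG t ht (by omega)
  obtain ⟨q, hq0, hqs, hqG⟩ := key (N + 1) le_rfl
  exact ⟨q, ⟨hq0, fun t ht => hqs t ht (by omega), fun t ht rec =>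
    hreg.integrable t ht _ (hqG t (by omega) (by omega) rec)⟩,
    fun t ht => hqG t (by omega) (by omega)⟩

end Data

/-! ### The Bellman equation of the super-policy -/

section Bellman

set_option linter.unusedSectionVars false

variable {U O A : ℕ → Type*} [∀ t, MeasurableSpace (U t)] [∀ t, MeasurableSpace (O t)]
  [∀ t, MeasurableSpace (A t)]

theorem integrable_id_of_ae_abs_le {μ : Measure ℝ} [IsFiniteMeasure μ] {C : ℝ}
    (h : ∀ᵐ r ∂μ, |r| ≤ C) : Integrable (fun r : ℝ => r) μ :=
  Integrable.of_bound measurable_id.aestronglyMeasurable C h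

theorem abs_integral_id_le {μ : Measure ℝ} [IsProbabilityMeasure μ] {C : ℝ}
    (h : ∀ᵐ r ∂μ, |r| ≤ C) : |∫ r, r ∂μ| ≤ C := by
  simpa using norm_integral_le_of_norm_le_const (μ := μ) (f := fun r : ℝ => r) h

theorem measurableSet_abs_le (C : ℝ) : MeasurableSet {r : ℝ | |r| ≤ C} :=
  measurableSet_le (by fun_prop) (by fun_prop)

/-- The return collects n + 1 rewards. The bound supplies the integrability needed to split and
interchange integrals. -/
theorem ae_abs_le_returnLaw (M : ConfoundedProcess U O A) (ν : SuperPolicy O A) (n t : ℕ)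
    (h : Node U O A t) : ∀ᵐ r ∂(returnLaw M ν n t h), |r| ≤ (n + 1) * M.rmax := by
  induction n generalizing t with
  | zero =>
    unfold returnLaw
    rw [Kernel.comp_apply]
    refine Measure.ae_comp_of_ae_ae (measurableSet_abs_le _) (.of_forall fun p => ?_)
    have h1 : ∀ᵐ r ∂((rewardKernel M t) p), |r| ≤ M.rmax := M.reward_bdd t _
    simpa using h1
  | succ n ih =>
    unfold returnLaw
    rw [Kernel.comp_apply]
    refine Measure.ae_comp_of_ae_ae (measurableSet_abs_le _) (.of_forall fun p => ?_)
    rw [Kernel.map_apply _ (by fun_prop), ae_map_iff (by fun_prop) (measurableSet_abs_le _),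
      Kernel.prod_apply]
    have h1 : ∀ᵐ r ∂((rewardKernel M t) p), |r| ≤ M.rmax := M.reward_bdd t _
    have h2 : ∀ᵐ r ∂((returnLaw M ν n (t + 1) ∘ₖ nextKernel M t) p), |r| ≤ (n + 1) * M.rmax := by
      rw [Kernel.comp_apply]
      exact Measure.ae_comp_of_ae_ae (measurableSet_abs_le _) (.of_forall fun p => ih (t + 1) p)
    filter_upwards [Measure.quasiMeasurePreserving_fst.ae h1,
      Measure.quasiMeasurePreserving_snd.ae h2] with q h3 h4
    refine (abs_add_le _ _).trans ?_
    push_cast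
    linarith

variable [∀ t, Fintype (A t)] [∀ t, MeasurableSingletonClass (A t)]

theorem integral_comp_actKernel (ν : SuperPolicy O A) (t : ℕ) (K : Kernel (Node U O A t × A t) ℝ)
    [IsMarkovKernel K] {C : ℝ} (hK : ∀ p, ∀ᵐ r ∂(K p), |r| ≤ C) (h : Node U O A t) :
    ∫ r, r ∂((K ∘ₖ (Kernel.id ×ₖ actKernel ν t)) h)
      = ∑ a, (∫ r, r ∂(K (h, a))) * ν.prob t (h.2.1, h.2.2.1) h.2.2.2 a := by
  have hint : Integrable (fun r : ℝ => r) ((K ∘ₖ (Kernel.id ×ₖ actKernel ν t)) h) := by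
    refine integrable_id_of_ae_abs_le (C := C) ?_
    rw [Kernel.comp_apply]
    exact Measure.ae_comp_of_ae_ae (measurableSet_abs_le _) (.of_forall hK)
  rw [Kernel.integral_comp hint, Kernel.prod_apply, Kernel.id_apply, Measure.dirac_prod,
    integral_map (by fun_prop) (StronglyMeasurable.integral_kernel (κ := K)
      (f := fun r : ℝ => r) stronglyMeasurable_id).aestronglyMeasurable,
    integral_fintype .of_finite]
  refine Finset.sum_congr rfl fun a _ => ?_
  rw [smul_eq_mul, mul_comm]
  rfl

/-- The mean return of one more stage. -/
theorem integral_returnLaw_zero (M : ConfoundedProcess U O A) (ν : SuperPolicy O A) (t : ℕ)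
    (h : Node U O A t) :
    ∫ r, r ∂(returnLaw M ν 0 t h) = ∑ a, (∫ r, r ∂(M.reward t (h.1, snoc h.2.2.1 a)))
      * ν.prob t (h.2.1, h.2.2.1) h.2.2.2 a :=
  integral_comp_actKernel ν t (rewardKernel M t) (fun _ => M.reward_bdd t _) h

theorem integral_nextKernel (M : ConfoundedProcess U O A) (t : ℕ) (p : Node U O A t × A t)
    {Φ : Node U O A (t + 1) → ℝ} (hΦ : Measurable Φ) {C : ℝ} (hC : ∀ h, |Φ h| ≤ C) :
    ∫ h, Φ h ∂(nextKernel M t p)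
      = ∫ y, ∫ a, Φ (snoc p.1.1 y.1, snoc p.1.2.1 y.2, snoc p.1.2.2.1 p.2, snoc p.1.2.2.2 a)
          ∂(M.behavior (t + 1) (snoc p.1.1 y.1, snoc p.1.2.2.1 p.2))
          ∂(M.trans t (p.1.1, p.1.2.1, snoc p.1.2.2.1 p.2)) := by
  have hm := measurable_nextNode (U := U) (O := O) (A := A) t
  have hm2 : Measurable fun y : (U (t + 1) × O (t + 1)) × A (t + 1) => Φ (nextNode t (p, y)) :=
    hΦ.comp (hm.comp (by fun_prop))
  rw [nextKernel, Kernel.map_apply _ hm, integral_map hm.aemeasurable hΦ.aestronglyMeasurable,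
    Kernel.prod_apply, Kernel.id_apply, Measure.dirac_prod, integral_map (by fun_prop)
    (show Measurable fun y => Φ (nextNode t y) from hΦ.comp hm).aestronglyMeasurable,
    ProbabilityTheory.integral_compProd
      (Integrable.of_bound hm2.aestronglyMeasurable C (.of_forall fun _ => hC _))]
  rfl

theorem integral_returnLaw_succ (M : ConfoundedProcess U O A) (ν : SuperPolicy O A) (n t : ℕ)
    (h : Node U O A t) :
    ∫ r, r ∂(returnLaw M ν (n + 1) t h) = ∑ a, ((∫ r, r ∂(M.reward t (h.1, snoc h.2.2.1 a)))
      + ∫ h', ∫ r, r ∂(returnLaw M ν n (t + 1) h') ∂(nextKernel M t (h, a)))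
      * ν.prob t (h.2.1, h.2.2.1) h.2.2.2 a := by
  have hm : Measurable fun p : ℝ × ℝ => p.1 + p.2 := by fun_prop
  set K := ((rewardKernel M t ×ₖ (returnLaw M ν n (t + 1) ∘ₖ nextKernel M t)).map
        (fun p : ℝ × ℝ => p.1 + p.2)) with hK
  have : IsMarkovKernel K := Kernel.IsMarkovKernel.map _ hm
  have h1 : ∀ p, ∀ᵐ r ∂(rewardKernel M t p), |r| ≤ M.rmax := fun _ => M.reward_bdd t _
  have h2 : ∀ p, ∀ᵐ r ∂((returnLaw M ν n (t + 1) ∘ₖ nextKernel M t) p), |r| ≤ (n + 1) * M.rmax := by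
    intro p
    rw [Kernel.comp_apply]
    exact Measure.ae_comp_of_ae_ae (measurableSet_abs_le _)
      (.of_forall fun p => ae_abs_le_returnLaw M ν n (t + 1) p)
  have hbd : ∀ p, ∀ᵐ r ∂(K p), |r| ≤ M.rmax + (n + 1) * M.rmax := by
    intro p
    rw [hK, Kernel.map_apply _ hm, ae_map_iff (by fun_prop) (measurableSet_abs_le _),
      Kernel.prod_apply]
    filter_upwards [Measure.quasiMeasurePreserving_fst.ae (h1 p),
      Measure.quasiMeasurePreserving_snd.ae (h2 p)] with q h3 h4
    exact (abs_add_le _ _).trans (add_le_add h3 h4)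
  rw [returnLaw, integral_comp_actKernel ν t K hbd]
  refine Finset.sum_congr rfl fun a _ => ?_
  congr 1
  have i1 := integrable_id_of_ae_abs_le (h1 (h, a))
  have i2 := integrable_id_of_ae_abs_le (h2 (h, a))
  rw [hK, Kernel.map_apply _ hm, integral_map hm.aemeasurable (by fun_prop), Kernel.prod_apply,
    integral_add (i1.comp_fst _) (i2.comp_snd _), integral_fun_fst (fun r : ℝ => r),
    integral_fun_snd (fun r : ℝ => r), Kernel.integral_comp i2]
  simp
  rfl

theorem measurable_expReturn (M : ConfoundedProcess U O A) (ν : SuperPolicy O A) (N t : ℕ) :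
    Measurable (expReturn M ν N t) :=
  (StronglyMeasurable.integral_kernel (κ := returnLaw M ν (N - t) t)
    stronglyMeasurable_id).measurable

theorem abs_expReturn_le (M : ConfoundedProcess U O A) (ν : SuperPolicy O A) (N t : ℕ)
    (h : Node U O A t) : |expReturn M ν N t h| ≤ ((N - t : ℕ) + 1) * M.rmax :=
  abs_integral_id_le (ae_abs_le_returnLaw M ν (N - t) t h)

/-- The mean continuation return after action `a` is executed at the node `h`; nothing follows the
last stage. -/
noncomputable def contReturn (M : ConfoundedProcess U O A) (ν : SuperPolicy O A) (N t : ℕ)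
    (h : Node U O A t) (a : A t) : ℝ :=
  if t < N then ∫ h', expReturn M ν N (t + 1) h' ∂(nextKernel M t (h, a))
  else 0

/-- The Bellman equation. -/
theorem expReturn_eq_sum (M : ConfoundedProcess U O A) (ν : SuperPolicy O A) {N t : ℕ} (ht : t ≤ N)
    (h : Node U O A t) :
    expReturn M ν N t h = ∑ a, ((∫ r, r ∂(M.reward t (h.1, snoc h.2.2.1 a)))
      + contReturn M ν N t h a) * ν.prob t (h.2.1, h.2.2.1) h.2.2.2 a := by
  unfold contReturn
  rcases ht.eq_or_lt with rfl | hlt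
  · simp only [lt_irrefl, if_false, add_zero]
    rw [expReturn, Nat.sub_self]
    exact integral_returnLaw_zero M ν t h
  · simp only [hlt, if_true]
    have hn : N - t = (N - (t + 1)) + 1 := by omega
    rw [expReturn, hn, integral_returnLaw_succ]
    refine Finset.sum_congr rfl fun a _ => ?_
    rfl

theorem measurable_contReturn (M : ConfoundedProcess U O A) (ν : SuperPolicy O A) (N t : ℕ) :
    Measurable fun p : Node U O A t × A t => contReturn M ν N t p.1 p.2 := by
  unfold contReturn
  split_ifs
  · exact (StronglyMeasurable.integral_kernel (κ := nextKernel M t)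
      (measurable_expReturn M ν N (t + 1)).stronglyMeasurable).measurable
  · exact measurable_const

theorem exists_abs_contReturn_le (M : ConfoundedProcess U O A) (ν : SuperPolicy O A) (N t : ℕ) :
    ∃ C, ∀ (h : Node U O A t) a, |contReturn M ν N t h a| ≤ C := by
  unfold contReturn
  split_ifs
  · refine ⟨((N - (t + 1) : ℕ) + 1) * M.rmax, fun h a => ?_⟩
    simpa using norm_integral_le_of_norm_le_const (μ := nextKernel M t (h, a))
      (f := expReturn M ν N (t + 1))
      (.of_forall fun h' => abs_expReturn_le M ν N (t + 1) h')
  · exact ⟨0, fun _ _ => by simp⟩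

end Bellman

/-! ### Recoding of histories -/

/-- The decision node with past `x` and recommendations `rec`. -/
def nodeOf {U O A : ℕ → Type*} {t : ℕ} (x : Hist U (t + 1) × ZSp O A t) (rec : Hist A (t + 1)) :
    Node U O A t := (x.1, x.2.1, x.2.2, rec)

/-- Append the action to the past. -/
def toPost {U O A : ℕ → Type*} {t : ℕ} (p : (Hist U (t + 1) × ZSp O A t) × A t) :
    Hist U (t + 1) × Hist O (t + 1) × Hist A (t + 1) :=
  (p.1.1, p.1.2.1, snoc p.1.2.2 p.2)

/-- Split off the last action. -/
def ofPost {U O A : ℕ → Type*} {t : ℕ} (y : Hist U (t + 1) × Hist O (t + 1) × Hist A (t + 1)) :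
    (Hist U (t + 1) × ZSp O A t) × A t :=
  ((y.1, y.2.1, fun i => y.2.2 i.castSucc), y.2.2 (Fin.last t))

theorem toPost_ofPost {U O A : ℕ → Type*} {t : ℕ}
    (y : Hist U (t + 1) × Hist O (t + 1) × Hist A (t + 1)) : toPost (ofPost y) = y := by
  refine Prod.ext rfl (Prod.ext rfl ?_)
  exact Fin.snoc_init_self (α := fun i : Fin (t + 1) => A i) y.2.2

theorem ofPost_toPost {U O A : ℕ → Type*} {t : ℕ} (p : (Hist U (t + 1) × ZSp O A t) × A t) :
    ofPost (toPost p) = p := by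
  refine Prod.ext (Prod.ext rfl (Prod.ext rfl ?_)) ?_
  · exact Fin.init_snoc (α := fun i : Fin (t + 1) => A i) p.2 p.1.2.2
  · exact Fin.snoc_last (α := fun i : Fin (t + 1) => A i) p.2 p.1.2.2

/-- Append new features to a past with its action. -/
def nextPre {U O A : ℕ → Type*} {t : ℕ} (p : (Hist U (t + 1) × ZSp O A t) × A t)
    (y : U (t + 1) × O (t + 1)) : Hist U (t + 2) × ZSp O A (t + 1) :=
  (snoc p.1.1 y.1, snoc p.1.2.1 y.2, snoc p.1.2.2 p.2)

/-- Forget the last features and split off the last action. -/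
def prevPre {U O A : ℕ → Type*} {t : ℕ} (x : Hist U (t + 2) × ZSp O A (t + 1)) :
    (Hist U (t + 1) × ZSp O A t) × A t :=
  ofPost (fun i => x.1 i.castSucc, fun i => x.2.1 i.castSucc, x.2.2)

section MeasurableHist

variable {U O A : ℕ → Type*} [∀ t, MeasurableSpace (U t)] [∀ t, MeasurableSpace (O t)]
  [∀ t, MeasurableSpace (A t)] {t : ℕ}

@[fun_prop]
theorem measurable_nodeOf (rec : Hist A (t + 1)) :
    Measurable fun x : Hist U (t + 1) × ZSp O A t => nodeOf x rec := by
  unfold nodeOf; fun_prop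

@[fun_prop]
theorem measurable_toPost : Measurable (toPost (U := U) (O := O) (A := A) (t := t)) := by
  unfold toPost; fun_prop

@[fun_prop]
theorem measurable_ofPost : Measurable (ofPost (U := U) (O := O) (A := A) (t := t)) := by
  unfold ofPost
  refine Measurable.prodMk (measurable_fst.prodMk ((measurable_fst.comp measurable_snd).prodMk
    (measurable_pi_iff.2 fun i => ?_))) ?_
  · exact (measurable_pi_apply (Fin.castSucc i)).comp (measurable_snd.comp measurable_snd)
  · exact (measurable_pi_apply (Fin.last t)).comp (measurable_snd.comp measurable_snd)

theorem measurable_nextPre : Measurable fun p : ((Hist U (t + 1) × ZSp O A t) × A t) ×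
    (U (t + 1) × O (t + 1)) => nextPre p.1 p.2 := by
  unfold nextPre; fun_prop

@[fun_prop]
theorem measurable_prevPre : Measurable (prevPre (U := U) (O := O) (A := A) (t := t)) := by
  unfold prevPre
  refine measurable_ofPost.comp (Measurable.prodMk (measurable_pi_iff.2 fun i => ?_)
    (Measurable.prodMk (measurable_pi_iff.2 fun i => ?_) (measurable_snd.comp measurable_snd)))
  · exact (measurable_pi_apply (Fin.castSucc i)).comp measurable_fst
  · exact (measurable_pi_apply (Fin.castSucc i)).comp (measurable_fst.comp measurable_snd)

end MeasurableHist

/-! ### Conditional laws given the full past, and completeness for the latent features -/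

namespace Data

set_option linter.unusedSectionVars false

variable {Ω O₀ : Type*} {U O A W : ℕ → Type*}
    [MeasurableSpace Ω] [StandardBorelSpace Ω] [Nonempty Ω]
    [MeasurableSpace O₀] [StandardBorelSpace O₀]
    [∀ t, MeasurableSpace (U t)] [∀ t, StandardBorelSpace (U t)]
    [∀ t, MeasurableSpace (O t)] [∀ t, StandardBorelSpace (O t)]
    [∀ t, MeasurableSpace (W t)] [∀ t, StandardBorelSpace (W t)]
    [∀ t, Fintype (A t)] [∀ t, MeasurableSpace (A t)] [∀ t, MeasurableSingletonClass (A t)]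
    {N : ℕ} {M : ConfoundedProcess U O A}
    {P : Measure Ω} [IsProbabilityMeasure P] {D : Data Ω O₀ U O A W}

/-- `(U_{1:t}, O_{1:t}, A_{1:t-1})` together with `A_t`. -/
def PA (D : Data Ω O₀ U O A W) (t : ℕ) (ω : Ω) : (Hist U (t + 1) × ZSp O A t) × A t :=
  (D.pre t ω, D.action t ω)

/-- The past with its action, and the pre-collected observation. -/
def PAO (D : Data Ω O₀ U O A W) (t : ℕ) (ω : Ω) : ((Hist U (t + 1) × ZSp O A t) × A t) × O₀ :=
  (D.PA t ω, D.obs0 ω)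

theorem measurable_PA (D : Data Ω O₀ U O A W) (t : ℕ) : Measurable (D.PA t) :=
  (D.measurable_pre t).prodMk (D.measurable_action t)

theorem measurable_PAO (D : Data Ω O₀ U O A W) (t : ℕ) : Measurable (D.PAO t) :=
  (D.measurable_PA t).prodMk D.measurable_obs0

theorem snoc_hist {X : ℕ → Type*} (f : ∀ t, X t) (t : ℕ) :
    snoc (X := X) (t := t) (fun i => f i) (f t) = (fun i => f i : Hist X (t + 1)) := by
  funext i
  refine Fin.lastCases ?_ (fun j => ?_) i
  · exact Fin.snoc_last (α := fun i : Fin (t + 1) => X i) _ _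
  · exact Fin.snoc_castSucc (α := fun i : Fin (t + 1) => X i) _ _ _

theorem toPost_PA (D : Data Ω O₀ U O A W) (t : ℕ) (ω : Ω) : toPost (D.PA t ω) = D.post t ω :=
  Prod.ext rfl (Prod.ext rfl (snoc_hist (fun t => D.action t ω) t))

theorem ofPost_post (D : Data Ω O₀ U O A W) (t : ℕ) (ω : Ω) : ofPost (D.post t ω) = D.PA t ω := by
  rw [← toPost_PA, ofPost_toPost]

theorem nextPre_PA (D : Data Ω O₀ U O A W) (t : ℕ) (ω : Ω) :
    nextPre (D.PA t ω) (D.lat (t + 1) ω, D.obs (t + 1) ω) = D.pre (t + 1) ω :=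
  Prod.ext (snoc_hist (fun t => D.lat t ω) (t + 1)) (Prod.ext (snoc_hist (fun t => D.obs t ω) (t + 1))
    (snoc_hist (fun t => D.action t ω) t))

/-! ### Conditional laws given the past -/

variable [Nonempty O₀] [∀ t, Nonempty (W t)] [∀ t, Nonempty (U t)] [∀ t, Nonempty (O t)]

/-- Independence of O_0 lets it enter the conditioning at no cost, and the recoding of `post`
isolates the last action A_t. -/
theorem hasCondDistrib_PAO {𝒴 : Type*} [MeasurableSpace 𝒴] [StandardBorelSpace 𝒴] [Nonempty 𝒴]
    {t : ℕ} {Y : Ω → 𝒴} (hY : Measurable Y)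
    {κ : Kernel (Hist U (t + 1) × Hist O (t + 1) × Hist A (t + 1)) 𝒴} [IsMarkovKernel κ]
    (h : HasCondDistrib Y (D.post t) κ P) (hi : Y ⟂ᵢ[D.post t, D.measurable_post t; P] D.obs0) :
    HasCondDistrib Y (D.PAO t) (κ.comap
      (fun p : ((Hist U (t + 1) × ZSp O A t) × A t) × O₀ => toPost p.1) (by fun_prop)) P := by
  have h1 := HasCondDistrib.prodMk_of_condIndepFun (D.measurable_post t) hY D.measurable_obs0 h hi
  have h2 := HasCondDistrib.recode h1
    (s := fun y : (Hist U (t + 1) × Hist O (t + 1) × Hist A (t + 1)) × O₀ => (ofPost y.1, y.2))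
    (by fun_prop)
    (r := fun p : ((Hist U (t + 1) × ZSp O A t) × A t) × O₀ => (toPost p.1, p.2))
    (by fun_prop) (fun x => by simp [toPost_ofPost])
  have e : (fun ω => (ofPost (D.post t ω), D.obs0 ω)) = D.PAO t := by
    funext ω
    rw [ofPost_post]; rfl
  rw [← e]
  exact h2

theorem InitialObsIndep.rew_indep (hobs : D.InitialObsIndep P N) {t : ℕ} (ht : t ≤ N) :
    D.rew t ⟂ᵢ[D.post t, D.measurable_post t; P] D.obs0 := by
  rcases ht.eq_or_lt with rfl | hlt
  · exact hobs.last.comp measurable_fst measurable_id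
  · exact (hobs.before_last t hlt).comp measurable_fst measurable_id

theorem InitialObsIndep.proxy_indep (hobs : D.InitialObsIndep P N) {t : ℕ} (ht : t ≤ N) :
    D.proxy t ⟂ᵢ[D.post t, D.measurable_post t; P] D.obs0 := by
  rcases ht.eq_or_lt with rfl | hlt
  · exact hobs.last.comp measurable_snd measurable_id
  · exact (hobs.before_last t hlt).comp
      (φ := fun y : ℝ × W (t + 1) × W t × O (t + 1) × U (t + 1) => y.2.2.1) (by fun_prop)
      measurable_id

theorem InitialObsIndep.next_indep (hobs : D.InitialObsIndep P N) {t : ℕ} (ht : t < N) :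
    (fun ω => (D.lat (t + 1) ω, D.obs (t + 1) ω))
      ⟂ᵢ[D.post t, D.measurable_post t; P] D.obs0 :=
  (hobs.before_last t ht).comp
    (φ := fun y : ℝ × W (t + 1) × W t × O (t + 1) × U (t + 1) => (y.2.2.2.2, y.2.2.2.1))
    (by fun_prop) measurable_id

/-- The law of the proxy given the past before the action. -/
noncomputable def proxyLaw (D : Data Ω O₀ U O A W) (P : Measure Ω) [IsProbabilityMeasure P] (t : ℕ) :
    Kernel (Hist U (t + 1) × ZSp O A t) (W t) :=
  condDistrib (D.proxy t) (D.pre t) P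

instance (t : ℕ) : IsMarkovKernel (D.proxyLaw P t) := by
  unfold proxyLaw; infer_instance

/-- A_t is adjoined by the reward-proxy assumption and O_0 by its independence, so neither affects
the law of W_t. Because of this, identities for different actions can later be summed under one and
the same law. -/
theorem hasCondDistrib_proxy (hproxy : D.RewardProxy P N) (hobs : D.InitialObsIndep P N) {t : ℕ}
    (ht : t ≤ N) : HasCondDistrib (D.proxy t) (D.PAO t) ((D.proxyLaw P t).comap
      (fun p : ((Hist U (t + 1) × ZSp O A t) × A t) × O₀ => p.1.1) (by fun_prop)) P := by
  have : Nonempty (A t) := Nonempty.map (D.action t) inferInstance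
  have h1 := HasCondDistrib.prodMk_of_condIndepFun (D.measurable_pre t) (D.measurable_proxy t)
    (D.measurable_action t) (hasCondDistrib_condDistrib (P := P) (D.measurable_pre t)
    (D.measurable_proxy t)) (hproxy t ht)
  have h2 := HasCondDistrib.recode h1 measurable_toPost measurable_ofPost ofPost_toPost
  have e : (fun ω => toPost (D.pre t ω, D.action t ω)) = D.post t := funext (toPost_PA D t)
  rw [e] at h2
  have h3 := hasCondDistrib_PAO (D.measurable_proxy t) h2 (hobs.proxy_indep ht)
  convert! h3 using 1
  ext p : 1
  simp only [Kernel.comap_apply, Kernel.prodMkRight_apply, ofPost_toPost]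
  rfl

theorem hasCondDistrib_rew (hgen : D.GeneratedBy M P N) (hobs : D.InitialObsIndep P N) {t : ℕ}
    (ht : t ≤ N) : HasCondDistrib (D.rew t) (D.PAO t) ((M.reward t).comap
      (fun p : ((Hist U (t + 1) × ZSp O A t) × A t) × O₀ => (p.1.1.1, snoc p.1.1.2.2 p.1.2))
      (by fun_prop)) P :=
  hasCondDistrib_PAO (D.measurable_rew t)
    ⟨((D.measurable_post t).prodMk (D.measurable_rew t)).aemeasurable, hgen.reward_law t ht⟩
    (hobs.rew_indep ht)

theorem hasCondDistrib_next (hgen : D.GeneratedBy M P N) (hobs : D.InitialObsIndep P N) {t : ℕ}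
    (ht : t < N) : HasCondDistrib (fun ω => (D.lat (t + 1) ω, D.obs (t + 1) ω)) (D.PAO t)
      ((M.trans t).comap (fun p : ((Hist U (t + 1) × ZSp O A t) × A t) × O₀ => toPost p.1)
      (by fun_prop)) P :=
  hasCondDistrib_PAO ((D.measurable_lat _).prodMk (D.measurable_obs _))
    ⟨((D.measurable_post t).prodMk
      ((D.measurable_lat _).prodMk (D.measurable_obs _))).aemeasurable, hgen.trans_law t ht⟩
    (hobs.next_indep ht)

theorem hasCondDistrib_action (hgen : D.GeneratedBy M P N) {t : ℕ} (ht : t ≤ N) :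
    HasCondDistrib (D.action t) (fun ω => (D.obs0 ω, D.pre t ω)) ((M.behavior t).comap
      (fun x : O₀ × (Hist U (t + 1) × ZSp O A t) => (x.2.1, x.2.2.2)) (by fun_prop)) P :=
  ⟨((D.measurable_obs0.prodMk (D.measurable_pre t)).prodMk (D.measurable_action t)).aemeasurable,
    hgen.action_law t ht⟩

/-! ### Consequences of completeness for the latent features -/

/-- An almost sure property of the past and the action holds for every value of the action. -/
theorem CompleteLatent.ae_forall (hcompU : D.CompleteLatent P N) {t : ℕ} (ht : t ≤ N)
    {p : (Hist U (t + 1) × ZSp O A t) × A t → Prop} (hp : MeasurableSet {x | p x})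
    (h : ∀ᵐ ω ∂P, p (D.PA t ω)) (a : A t) : ∀ᵐ x ∂(P.map (D.pre t)), p (x, a) := by
  have hpa : MeasurableSet {x | p (x, a)} := hp.preimage (by fun_prop : Measurable fun x => (x, a))
  have hB : MeasurableSet (D.action t ⁻¹' {a}) := D.measurable_action t (measurableSet_singleton a)
  rw [ae_map_iff (D.measurable_pre t).aemeasurable hpa]
  -- The indicator of failure vanishes almost surely given A_t = a; completeness, whose conclusion
  -- is under the unconditional law, makes it vanish outright. Completeness thus acts as an overlap
  -- condition: an event of the past that is null given A_t = a is null.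
  set g : Hist U (t + 1) × ZSp O A t → ℝ := Set.indicator {x | p (x, a)}ᶜ 1 with hg
  have hgm : Measurable g := measurable_one.indicator hpa.compl
  have h0 : (fun ω => g (D.pre t ω)) =ᵐ[P[|D.action t ⁻¹' {a}]] 0 := by
    filter_upwards [cond_absolutelyContinuous.ae_le h, ae_cond_mem hB] with ω hω ha
    have hpω : p (D.pre t ω, a) := by
      rw [← show D.action t ω = a from ha]; exact hω
    simp [hg, hpω]
  have h1 := (hcompU t ht a g hgm ((memLp_congr_ae h0).2 MemLp.zero')).1
    ((condExp_congr_ae h0).trans (by rw [condExp_zero]))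
  filter_upwards [h1] with ω hω
  by_contra hcon
  simp [hg, hcon] at hω

/-- A function of the past and the action with vanishing conditional expectation given `Z_t`, `O_0`
and `A_t` vanishes, for every value of the action. -/
theorem CompleteLatent.ae_eq_zero (hcompU : D.CompleteLatent P N) {t : ℕ} (ht : t ≤ N)
    {H : (Hist U (t + 1) × ZSp O A t) × A t → ℝ} (hH : Measurable H)
    (hHL : MemLp (fun ω => H (D.PA t ω)) 2 P)
    (h : P[fun ω => H (D.PA t ω) | MeasurableSpace.comap (D.ZOA t) inferInstance] =ᵐ[P] 0)
    (a : A t) : ∀ᵐ x ∂(P.map (D.pre t)), H (x, a) = 0 := by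
  have hHa : Measurable fun x => H (x, a) := hH.comp (by fun_prop)
  have hB : MeasurableSet (D.action t ⁻¹' {a}) := D.measurable_action t (measurableSet_singleton a)
  rw [ae_map_iff (D.measurable_pre t).aemeasurable (measurableSet_eq_fun hHa measurable_const)]
  have hFF : ∀ ω ∈ D.action t ⁻¹' {a}, H (D.pre t ω, a) = H (D.PA t ω) := fun ω hω => by
    rw [← show D.action t ω = a from hω]; rfl
  refine (hcompU t ht a (fun x => H (x, a)) hHa (memLp_cond_congr hB hHL hFF)).1 ?_
  refine condExp_cond_eq_zero (D.measurable_ZOA t) ((D.measurable_Z t).prodMk D.measurable_obs0) hB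
    (hHL.integrable (by norm_num)) h hFF
    fun s hs => ⟨(fun v => (v.1, v.2.1)) ⁻¹' s ∩ (fun v => v.2.2) ⁻¹' {a}, ?_, rfl⟩
  exact ((by fun_prop : Measurable fun v : ZSp O A t × O₀ × A t => (v.1, v.2.1)) hs).inter
    ((by fun_prop : Measurable fun v : ZSp O A t × O₀ × A t => v.2.2) (measurableSet_singleton a))

end Data

/-! ### From the observables to the full past -/

namespace Data

set_option linter.unusedSectionVars false

variable {Ω O₀ : Type*} {U O A W : ℕ → Type*}
    [MeasurableSpace Ω] [StandardBorelSpace Ω] [Nonempty Ω]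
    [MeasurableSpace O₀] [StandardBorelSpace O₀]
    [∀ t, MeasurableSpace (U t)] [∀ t, StandardBorelSpace (U t)]
    [∀ t, MeasurableSpace (O t)] [∀ t, StandardBorelSpace (O t)]
    [∀ t, MeasurableSpace (W t)] [∀ t, StandardBorelSpace (W t)]
    [∀ t, Fintype (A t)] [∀ t, MeasurableSpace (A t)] [∀ t, MeasurableSingletonClass (A t)]
    {N : ℕ} {M : ConfoundedProcess U O A}
    {P : Measure Ω} [IsProbabilityMeasure P] {D : Data Ω O₀ U O A W}
    [Nonempty O₀] [∀ t, Nonempty (W t)] [∀ t, Nonempty (U t)] [∀ t, Nonempty (O t)]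

/-- If `Q (·, W_t)` is balanced in mean by the reward and a continuation given the observables
`(Z_t, O_0, A_t)`, then it is balanced given the complete past, for every action. -/
theorem integral_proxyLaw_eq (hgen : D.GeneratedBy M P N) (hproxy : D.RewardProxy P N)
    (hobs : D.InitialObsIndep P N) (hcompU : D.CompleteLatent P N) {t : ℕ} (ht : t ≤ N)
    {Q : (ZSp O A t × A t) × W t → ℝ} (hQm : Measurable Q)
    (hQL : ∀ᵐ x ∂(P.map (D.ZA t)),
      MemLp (fun ω => Q (x, D.proxy t ω)) 2 (condLaw P (D.ZA t) x))
    {v : Ω → ℝ} (hv : Integrable v P)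
    {V : (Hist U (t + 1) × ZSp O A t) × A t → ℝ} (hVm : Measurable V) {C : ℝ} (hVC : ∀ p, |V p| ≤ C)
    (hvV : P[v | MeasurableSpace.comap (D.PAO t) inferInstance] =ᵐ[P] fun ω => V (D.PA t ω))
    (heq : CondMeanEq P (D.ZOA t) (fun ω => Q (D.ZA t ω, D.proxy t ω) - D.rew t ω - v ω) 0)
    (a : A t) : ∀ᵐ x ∂(P.map (D.pre t)),
      Integrable (fun w => Q ((x.2, a), w)) (D.proxyLaw P t x) ∧
        ∫ w, Q ((x.2, a), w) ∂(D.proxyLaw P t x)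
          = (∫ r, r ∂(M.reward t (x.1, snoc x.2.2 a))) + V (x, a) := by
  have hZAm := D.measurable_ZA t
  have hPAm := D.measurable_PA t
  have hWm := D.measurable_proxy t
  -- scaling
  have : IsProbabilityMeasure (P.map (D.ZA t)) := Measure.isProbabilityMeasure_map hZAm.aemeasurable
  -- Q is square-integrable only in each fibre over (Z_t, A_t), while completeness asks for global
  -- square-integrability. The weight c depends on (Z_t, A_t) only, so it preserves the equation and
  -- can be cancelled at the end.
  obtain ⟨c, hcm, hc0, hc1, hcL⟩ := exists_scaling_memLp (π := P.map (D.ZA t))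
    (κ := condDistrib (D.proxy t) (D.ZA t) P) hQm (by
      filter_upwards [hQL, ae_condLaw_ZA_map_proxy (P := P) D t] with x hx hρ
      rw [← hρ, memLp_map_measure_iff
        (show Measurable fun w => Q (x, w) from hQm.comp (by fun_prop)).aestronglyMeasurable
        hWm.aemeasurable]
      exact hx)
  rw [compProd_map_condDistrib hWm.aemeasurable] at hcL
  have hcQ : MemLp (fun ω => c (D.ZA t ω) * Q (D.ZA t ω, D.proxy t ω)) 2 P :=
    (memLp_map_measure_iff ((hcm.comp measurable_fst).mul hQm).aestronglyMeasurable
      (hZAm.prodMk hWm).aemeasurable).1 hcL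
  have hcQi := hcQ.integrable (by norm_num)
  have hcabs : ∀ x, |c x| ≤ 1 := fun x => by rw [abs_of_pos (hc0 x)]; exact hc1 x
  have hRi := hgen.integrable_rew ht
  have hci : ∀ {f : Ω → ℝ}, Integrable f P → Integrable (fun ω => c (D.ZA t ω) * f ω) P :=
    fun hf => hf.bdd_mul (hcm.comp hZAm).aestronglyMeasurable (.of_forall fun ω => hcabs _)
  have hcRi := hci hRi
  have hcvi := hci hv
  -- the three conditional expectations given the past
  set IQ : (Hist U (t + 1) × ZSp O A t) × A t → ℝ :=
    fun p => ∫ w, Q ((p.1.2, p.2), w) ∂(D.proxyLaw P t p.1) with hIQ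
  set IR : (Hist U (t + 1) × ZSp O A t) × A t → ℝ :=
    fun p => ∫ r, r ∂(M.reward t (p.1.1, snoc p.1.2.2 p.2)) with hIR
  set cc : (Hist U (t + 1) × ZSp O A t) × A t → ℝ := fun p => c (p.1.2, p.2) with hcc
  have hccm : Measurable cc := hcm.comp (by fun_prop)
  have hIQm : Measurable IQ :=
    (StronglyMeasurable.integral_kernel_prod_right'
      (κ := (D.proxyLaw P t).comap (Prod.fst : _ × A t → _) measurable_fst)
      (f := fun q : ((Hist U (t + 1) × ZSp O A t) × A t) × W t => Q ((q.1.1.2, q.1.2), q.2))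
      (hQm.comp (by fun_prop)).stronglyMeasurable).measurable
  have hIRm : Measurable IR :=
    ((StronglyMeasurable.integral_kernel (κ := M.reward t) (f := fun r : ℝ => r)
      stronglyMeasurable_id).measurable).comp
      (by fun_prop : Measurable fun p : (Hist U (t + 1) × ZSp O A t) × A t =>
        (p.1.1, snoc p.1.2.2 p.2))
  have hIRb : ∀ p, |IR p| ≤ M.rmax := fun p => abs_integral_id_le (M.reward_bdd t _)
  have lawW := hasCondDistrib_proxy hproxy hobs ht
  have ce1 : P[fun ω => c (D.ZA t ω) * Q (D.ZA t ω, D.proxy t ω) |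
      MeasurableSpace.comap (D.PAO t) inferInstance] =ᵐ[P] fun ω => cc (D.PA t ω) * IQ (D.PA t ω) := by
    refine (HasCondDistrib.condExp_eq (D.measurable_PAO t) hWm lawW
      (F := fun q : (((Hist U (t + 1) × ZSp O A t) × A t) × O₀) × W t =>
        c (q.1.1.1.2, q.1.1.2) * Q ((q.1.1.1.2, q.1.1.2), q.2))
      ((hcm.comp (by fun_prop)).mul (hQm.comp (by fun_prop))) hcQi).trans (.of_forall fun ω => ?_)
    exact integral_const_mul (cc (D.PA t ω)) fun w => Q (D.ZA t ω, w)
  have ce2 : P[fun ω => c (D.ZA t ω) * D.rew t ω |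
      MeasurableSpace.comap (D.PAO t) inferInstance] =ᵐ[P] fun ω => cc (D.PA t ω) * IR (D.PA t ω) := by
    refine (HasCondDistrib.condExp_eq (D.measurable_PAO t) (D.measurable_rew t)
      (hasCondDistrib_rew hgen hobs ht)
      (F := fun q : (((Hist U (t + 1) × ZSp O A t) × A t) × O₀) × ℝ =>
        c (q.1.1.1.2, q.1.1.2) * q.2)
      ((hcm.comp (by fun_prop)).mul (by fun_prop)) hcRi).trans (.of_forall fun ω => ?_)
    exact integral_const_mul (cc (D.PA t ω)) fun r : ℝ => r
  have ce3 : P[fun ω => c (D.ZA t ω) * v ω |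
      MeasurableSpace.comap (D.PAO t) inferInstance] =ᵐ[P] fun ω => cc (D.PA t ω) * V (D.PA t ω) := by
    have hsm : StronglyMeasurable[MeasurableSpace.comap (D.PAO t) inferInstance]
        (fun ω => c (D.ZA t ω)) :=
      (hcm.comp (by fun_prop : Measurable
        fun p : ((Hist U (t + 1) × ZSp O A t) × A t) × O₀ => (p.1.1.2, p.1.2))).stronglyMeasurable
        |>.comp_measurable (comap_measurable (D.PAO t))
    filter_upwards [condExp_mul_of_stronglyMeasurable_left hsm hcvi hv, hvV] with ω h1 h2
    refine h1.trans ?_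
    rw [Pi.mul_apply, h2]
    rfl
  -- the residual and its conditional expectations
  set η : Ω → ℝ := fun ω => c (D.ZA t ω) * Q (D.ZA t ω, D.proxy t ω) - c (D.ZA t ω) * D.rew t ω
    - c (D.ZA t ω) * v ω with hη
  have hηi : Integrable η P := (hcQi.sub hcRi).sub hcvi
  -- None of the three conditional means involves O_0, so the conditional mean of the residual given
  -- the past, A_t and O_0 is a function H of the past and A_t, the kind of function to which
  -- completeness applies.
  set H : (Hist U (t + 1) × ZSp O A t) × A t → ℝ := fun p => cc p * (IQ p - IR p - V p) with hH
  have hHm : Measurable H := hccm.mul ((hIQm.sub hIRm).sub hVm)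
  have ceη : P[η | MeasurableSpace.comap (D.PAO t) inferInstance] =ᵐ[P] fun ω => H (D.PA t ω) := by
    filter_upwards [condExp_sub (hcQi.sub hcRi) hcvi (MeasurableSpace.comap (D.PAO t) inferInstance),
      condExp_sub hcQi hcRi (MeasurableSpace.comap (D.PAO t) inferInstance), ce1, ce2, ce3]
      with ω h1 h2 h3 h4 h5
    refine h1.trans ?_
    rw [Pi.sub_apply, h2, Pi.sub_apply, h3, h4, h5, hH]
    ring
  have hη0 : P[η | MeasurableSpace.comap (D.ZOA t) inferInstance] =ᵐ[P] 0 := by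
    have h1 := condExp_ae_eq_integral_condDistrib_id (D.measurable_ZOA t) hηi
    filter_upwards [h1, ae_of_ae_map (D.measurable_ZOA t).aemeasurable heq,
      ae_of_ae_map (D.measurable_ZOA t).aemeasurable (ae_condLaw_eq (P := P) (D.measurable_ZOA t))]
      with ω h2 h3 h4
    rw [h2]
    have h5 : ∫ ω', η ω' ∂(condLaw P (D.ZOA t) (D.ZOA t ω))
        = ∫ ω', c (D.ZA t ω) * (Q (D.ZA t ω', D.proxy t ω') - D.rew t ω' - v ω')
          ∂(condLaw P (D.ZOA t) (D.ZOA t ω)) := by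
      refine integral_congr_ae ?_
      filter_upwards [h4] with ω' hω'
      have h6 : D.ZA t ω' = D.ZA t ω :=
        congrArg (fun y : ZSp O A t × O₀ × A t => (y.1, y.2.2)) hω'
      simp only [hη, h6]
      ring
    refine h5.trans ?_
    rw [integral_const_mul, h3.2]
    simp
  have hle : MeasurableSpace.comap (D.ZOA t) inferInstance
      ≤ MeasurableSpace.comap (D.PAO t) inferInstance := by
    have e : D.ZOA t = (fun p : ((Hist U (t + 1) × ZSp O A t) × A t) × O₀ =>
      (p.1.1.2, p.2, p.1.2)) ∘ D.PAO t := rfl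
    rw [e, ← MeasurableSpace.comap_comp]
    exact MeasurableSpace.comap_mono (by fun_prop : Measurable
      fun p : ((Hist U (t + 1) × ZSp O A t) × A t) × O₀ => (p.1.1.2, p.2, p.1.2)).comap_le
  have hH0 : P[fun ω => H (D.PA t ω) | MeasurableSpace.comap (D.ZOA t) inferInstance] =ᵐ[P] 0 :=
    (condExp_congr_ae ceη.symm).trans
      ((condExp_condExp_of_le hle (D.measurable_PAO t).comap_le).trans hη0)
  -- The part with Q is the conditional expectation of a square-integrable variable; the remaining
  -- part is bounded.
  have hHL : MemLp (fun ω => H (D.PA t ω)) 2 P := by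
    have h1 : MemLp (fun ω => cc (D.PA t ω) * IQ (D.PA t ω)) 2 P :=
      (memLp_congr_ae ce1).1 (hcQ.condExp (by norm_num))
    have h2 : MemLp (fun ω => cc (D.PA t ω) * (IR (D.PA t ω) + V (D.PA t ω))) 2 P := by
      refine MemLp.of_bound ((hccm.mul (hIRm.add hVm)).comp hPAm).aestronglyMeasurable
        (1 * (M.rmax + C)) (.of_forall fun ω => ?_)
      rw [norm_mul]
      exact mul_le_mul (hcabs _) ((abs_add_le _ _).trans (add_le_add (hIRb _) (hVC _)))
        (norm_nonneg _) zero_le_one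
    refine (h1.sub h2).ae_eq (.of_forall fun ω => ?_)
    simp only [Pi.sub_apply, hH]
    ring
  -- integrability, for every action
  have hint : ∀ᵐ ω ∂P, Integrable (fun w => Q (((D.PA t ω).1.2, (D.PA t ω).2), w))
      (D.proxyLaw P t (D.PA t ω).1) := by
    have h1 : Integrable (fun q : (((Hist U (t + 1) × ZSp O A t) × A t) × O₀) × W t =>
        c (q.1.1.1.2, q.1.1.2) * Q ((q.1.1.1.2, q.1.1.2), q.2))
        (P.map fun ω => (D.PAO t ω, D.proxy t ω)) := by
      refine (integrable_map_measure ?_ ((D.measurable_PAO t).prodMk hWm).aemeasurable).2 hcQi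
      exact ((hcm.comp (by fun_prop)).mul (hQm.comp (by fun_prop))).aestronglyMeasurable
    rw [lawW.map_eq, Measure.integrable_compProd_iff h1.1] at h1
    filter_upwards [ae_of_ae_map (D.measurable_PAO t).aemeasurable h1.1] with ω hω
    have h2 := hω.const_mul (c (D.ZA t ω))⁻¹
    refine h2.congr (.of_forall fun w => ?_)
    exact inv_mul_cancel_left₀ (hc0 (D.ZA t ω)).ne' _
  -- So far integrability is known for the drawn action only; completeness extends it to the given
  -- action a.
  have hint' := hcompU.ae_forall ht (p := fun p => Integrable (fun w => Q ((p.1.2, p.2), w))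
    (D.proxyLaw P t p.1)) (measurableSet_kernel_integrable
      (κ := (D.proxyLaw P t).comap (Prod.fst : _ × A t → _) measurable_fst)
      (f := fun p w => Q ((p.1.2, p.2), w)) (hQm.comp (by fun_prop)).stronglyMeasurable) hint a
  filter_upwards [hint', hcompU.ae_eq_zero ht hHm hHL hH0 a] with x h1 h2
  refine ⟨h1, ?_⟩
  rcases mul_eq_zero.1 h2 with h3 | h3
  · exact absurd h3 (hc0 _).ne'
  · linarith

end Data

theorem SuperPolicy.measurable_prob {O A : ℕ → Type*} [∀ t, MeasurableSpace (O t)]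
    [∀ t, MeasurableSpace (A t)] [∀ t, MeasurableSingletonClass (A t)] (ν : SuperPolicy O A) (t : ℕ)
    (rec : Hist A (t + 1)) (a : A t) : Measurable fun z => ν.prob t z rec a :=
  ((Kernel.measurable_coe (ν.act t) (measurableSet_singleton a)).comp
    (by fun_prop : Measurable fun z : ZSp O A t => (z, rec))).ennreal_toReal

theorem measurable_vFun {O A W : ℕ → Type*} [∀ t, MeasurableSpace (O t)]
    [∀ t, MeasurableSpace (A t)] [∀ t, MeasurableSingletonClass (A t)] [∀ t, Fintype (A t)]
    [∀ t, MeasurableSpace (W t)] (ν : SuperPolicy O A) (t : ℕ) {q : QFun O A W t}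
    (hq : ∀ rec a, Measurable fun p : W t × ZSp O A t => q p.1 p.2 rec a) (rec : Hist A t) :
    Measurable (vFun ν t q rec) := by
  have h : Measurable fun p : (W t × ZSp O A t) × A t => vFun ν t q rec (p.1.1, p.1.2, p.2) := by
    refine measurable_from_prod_countable_left fun b => ?_
    exact Finset.measurable_sum _ fun a _ => (hq (snoc rec b) a).mul
      ((ν.measurable_prob t (snoc rec b) a).comp measurable_snd)
  exact h.comp (by fun_prop : Measurable fun x : W t × ZSp O A t × A t => ((x.1, x.2.1), x.2.2))

/-! ### Backward induction for the bridge property, and the policy value -/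

namespace Data

set_option linter.unusedSectionVars false

variable {Ω O₀ : Type*} {U O A W : ℕ → Type*}
    [MeasurableSpace Ω] [StandardBorelSpace Ω] [Nonempty Ω]
    [MeasurableSpace O₀] [StandardBorelSpace O₀]
    [∀ t, MeasurableSpace (U t)] [∀ t, StandardBorelSpace (U t)]
    [∀ t, MeasurableSpace (O t)] [∀ t, StandardBorelSpace (O t)]
    [∀ t, MeasurableSpace (W t)] [∀ t, StandardBorelSpace (W t)]
    [∀ t, Fintype (A t)] [∀ t, MeasurableSpace (A t)] [∀ t, MeasurableSingletonClass (A t)]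
    {N : ℕ} {M : ConfoundedProcess U O A}
    {P : Measure Ω} [IsProbabilityMeasure P] {D : Data Ω O₀ U O A W}
    [Nonempty O₀] [∀ t, Nonempty (W t)] [∀ t, Nonempty (U t)] [∀ t, Nonempty (O t)]
    {ν : SuperPolicy O A} {q : ∀ t, QFun O A W t}

/-- The Q-bridge property of stage `t`, in terms of the law of the proxy given the past. -/
def BridgeAt (D : Data Ω O₀ U O A W) (M : ConfoundedProcess U O A) (P : Measure Ω)
    [IsProbabilityMeasure P] (ν : SuperPolicy O A) (N : ℕ) (q : ∀ t, QFun O A W t) (t : ℕ)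
    (rec : Hist A (t + 1)) : Prop :=
  ∀ᵐ x ∂(P.map (D.pre t)),
    Integrable (fun w => ∑ a, q t w x.2 rec a * ν.prob t x.2 rec a) (D.proxyLaw P t x) ∧
      ∫ w, ∑ a, q t w x.2 rec a * ν.prob t x.2 rec a ∂(D.proxyLaw P t x)
        = expReturn M ν N t (nodeOf x rec)

/-- Given the past, A_t and O_0, only W_t remains random, and its law is `proxyLaw`, for which the
bridge property is stated. The drawn action A_t takes the part of the last recommendation. -/
theorem condExp_vFun (hproxy : D.RewardProxy P N) (hobs : D.InitialObsIndep P N)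
    (hq : D.SolvesSystem P ν N q) {t : ℕ} (ht : t ≤ N)
    (hb : ∀ rec, D.BridgeAt M P ν N q t rec) (rec : Hist A t) :
    P[fun ω => vFun ν t (q t) rec (D.WZA t ω) | MeasurableSpace.comap (D.PAO t) inferInstance]
      =ᵐ[P] fun ω => expReturn M ν N t (nodeOf (D.pre t ω) (snoc rec (D.action t ω))) := by
  have h1 := HasCondDistrib.condExp_eq (D.measurable_PAO t) (D.measurable_proxy t)
    (hasCondDistrib_proxy hproxy hobs ht)
    (F := fun p : (((Hist U (t + 1) × ZSp O A t) × A t) × O₀) × W t =>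
      vFun ν t (q t) rec (p.2, p.1.1.1.2, p.1.1.2))
    ((measurable_vFun ν t (hq.stage t ht).measurable rec).comp (by fun_prop))
    (hq.integrable t ht rec)
  -- There are finitely many `rec`, so one null set serves all of them and the random action may be
  -- inserted.
  have h2 : ∀ᵐ ω ∂P, ∀ rec, _ := ae_all_iff.2 fun rec =>
    ae_of_ae_map (D.measurable_pre t).aemeasurable (hb rec)
  filter_upwards [h1, h2] with ω h3 h4
  exact h3.trans (h4 (snoc rec (D.action t ω))).2

/-- Averages successively over W_{t+1}, A_{t+1} and the next features. With A_t as executed action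
and A_{t+1} as next recommendation, the data move from the node by the same kernels as the process
under ν, so the result is the mean of `expReturn` under `nextKernel`. -/
theorem condExp_vFun_next (hgen : D.GeneratedBy M P N) (hproxy : D.RewardProxy P N)
    (hobs : D.InitialObsIndep P N) (hq : D.SolvesSystem P ν N q) {t : ℕ} (ht : t < N)
    (hb : ∀ rec, D.BridgeAt M P ν N q (t + 1) rec) (rec : Hist A (t + 1)) :
    P[fun ω => vFun ν (t + 1) (q (t + 1)) rec (D.WZA (t + 1) ω) |
        MeasurableSpace.comap (D.PAO t) inferInstance]
      =ᵐ[P] fun ω => contReturn M ν N t (nodeOf (D.pre t ω) rec) (D.action t ω) := by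
  have : Nonempty (A (t + 1)) := Nonempty.map (D.action (t + 1)) inferInstance
  have hΦm := measurable_expReturn M ν N (t + 1)
  have hΦC := abs_expReturn_le M ν N (t + 1)
  set Φ := expReturn M ν N (t + 1) with hΦ
  set C : ℝ := ((N - (t + 1) : ℕ) + 1) * M.rmax with hC
  have hX1 : Measurable fun ω => (D.obs0 ω, D.pre (t + 1) ω) :=
    D.measurable_obs0.prodMk (D.measurable_pre (t + 1))
  have h01 : MeasurableSpace.comap (D.PAO t) inferInstance
      ≤ MeasurableSpace.comap (fun ω => (D.obs0 ω, D.pre (t + 1) ω)) inferInstance := by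
    have e : D.PAO t = (fun p : O₀ × (Hist U (t + 2) × ZSp O A (t + 1)) => (prevPre p.2, p.1)) ∘
      fun ω => (D.obs0 ω, D.pre (t + 1) ω) := rfl
    rw [e, ← MeasurableSpace.comap_comp]
    exact MeasurableSpace.comap_mono (by fun_prop : Measurable
      fun p : O₀ × (Hist U (t + 2) × ZSp O A (t + 1)) => (prevPre p.2, p.1)).comap_le
  have h12 : MeasurableSpace.comap (fun ω => (D.obs0 ω, D.pre (t + 1) ω)) inferInstance
      ≤ MeasurableSpace.comap (D.PAO (t + 1)) inferInstance := by
    have e : (fun ω => (D.obs0 ω, D.pre (t + 1) ω))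
      = (fun p : ((Hist U (t + 2) × ZSp O A (t + 1)) × A (t + 1)) × O₀ => (p.2, p.1.1)) ∘
        D.PAO (t + 1) := rfl
    rw [e, ← MeasurableSpace.comap_comp]
    exact MeasurableSpace.comap_mono (by fun_prop : Measurable
      fun p : ((Hist U (t + 2) × ZSp O A (t + 1)) × A (t + 1)) × O₀ => (p.2, p.1.1)).comap_le
  -- given the past and the action
  have hΨm : Measurable fun p : (O₀ × (Hist U (t + 2) × ZSp O A (t + 1))) × A (t + 1) =>
      Φ (nodeOf p.1.2 (snoc rec p.2)) := hΦm.comp (by unfold nodeOf; fun_prop)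
  have e2 := condExp_vFun hproxy hobs hq ht hb rec
  -- averaging over the action
  have e1 := HasCondDistrib.condExp_eq hX1 (D.measurable_action (t + 1))
    (hasCondDistrib_action hgen ht) hΨm
    (Integrable.of_bound (hΨm.comp (hX1.prodMk (D.measurable_action (t + 1)))).aestronglyMeasurable
      C (.of_forall fun _ => hΦC _))
  -- averaging over the next features
  set Γ : Hist U (t + 2) × ZSp O A (t + 1) → ℝ := fun x =>
    ∫ a, Φ (nodeOf x (snoc rec a)) ∂(M.behavior (t + 1) (x.1, x.2.2)) with hΓ
  have hΓm : Measurable Γ :=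
    (StronglyMeasurable.integral_kernel_prod_right'
      (κ := (M.behavior (t + 1)).comap (fun x : Hist U (t + 2) × ZSp O A (t + 1) => (x.1, x.2.2))
        (by fun_prop))
      (f := fun p : (Hist U (t + 2) × ZSp O A (t + 1)) × A (t + 1) => Φ (nodeOf p.1 (snoc rec p.2)))
      (hΦm.comp (by unfold nodeOf; fun_prop)).stronglyMeasurable).measurable
  have hΓC : ∀ x, |Γ x| ≤ C := fun x => by
    simpa using norm_integral_le_of_norm_le_const
      (μ := M.behavior (t + 1) (x.1, x.2.2)) (f := fun a => Φ (nodeOf x (snoc rec a)))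
      (.of_forall fun a => hΦC _)
  have hY : Measurable fun ω => (D.lat (t + 1) ω, D.obs (t + 1) ω) :=
    (D.measurable_lat _).prodMk (D.measurable_obs _)
  have hΓ' : Measurable fun p : (((Hist U (t + 1) × ZSp O A t) × A t) × O₀) ×
      (U (t + 1) × O (t + 1)) => Γ (nextPre p.1.1 p.2) :=
    hΓm.comp (measurable_nextPre.comp (by fun_prop : Measurable
      fun p : (((Hist U (t + 1) × ZSp O A t) × A t) × O₀) × (U (t + 1) × O (t + 1)) =>
        (p.1.1, p.2)))
  have e0 := HasCondDistrib.condExp_eq (D.measurable_PAO t) hY (hasCondDistrib_next hgen hobs ht)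
    hΓ' (Integrable.of_bound (hΓ'.comp ((D.measurable_PAO t).prodMk hY)).aestronglyMeasurable
      C (.of_forall fun _ => hΓC _))
  have eΓ : (fun ω => Γ (nextPre (D.PAO t ω).1 (D.lat (t + 1) ω, D.obs (t + 1) ω)))
      = fun ω => Γ (D.pre (t + 1) ω) := funext fun ω => congrArg Γ (nextPre_PA D t ω)
  rw [eΓ] at e0
  -- the tower property
  refine (condExp_condExp_of_le h01 hX1.comap_le).symm.trans ?_
  refine (condExp_congr_ae (condExp_condExp_of_le h12
    (D.measurable_PAO (t + 1)).comap_le).symm).trans ?_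
  refine (condExp_congr_ae (condExp_congr_ae e2)).trans ?_
  refine (condExp_congr_ae e1).trans ?_
  refine e0.trans (.of_forall fun ω => ?_)
  simp only [contReturn, if_pos ht]
  rw [integral_nextKernel M t _ hΦm hΦC]
  rfl

/-- The Q-bridge property passes to the previous stage. -/
theorem bridgeAt_of_next (hgen : D.GeneratedBy M P N) (hproxy : D.RewardProxy P N)
    (hobs : D.InitialObsIndep P N) (hcompU : D.CompleteLatent P N) (hq : D.SolvesSystem P ν N q)
    {t : ℕ} (ht : t ≤ N) (hnext : t < N → ∀ rec, D.BridgeAt M P ν N q (t + 1) rec)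
    (rec : Hist A (t + 1)) : D.BridgeAt M P ν N q t rec := by
  obtain ⟨C, hC⟩ := exists_abs_contReturn_le M ν N t
  have hst := hq.stage t ht
  have hQm : Measurable fun p : (ZSp O A t × A t) × W t => q t p.2 p.1.1 rec p.1.2 := by
    have h : Measurable fun p : (W t × ZSp O A t) × A t => q t p.1.1 p.1.2 rec p.2 :=
      measurable_from_prod_countable_left fun a => hst.measurable rec a
    exact h.comp (by fun_prop : Measurable
      fun p : (ZSp O A t × A t) × W t => ((p.2, p.1.1), p.1.2))
  have hv : Integrable (fun ω => vFun ν (t + 1) (q (t + 1)) rec (D.WZA (t + 1) ω)) P ∧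
      P[fun ω => vFun ν (t + 1) (q (t + 1)) rec (D.WZA (t + 1) ω) |
          MeasurableSpace.comap (D.PAO t) inferInstance]
        =ᵐ[P] fun ω => contReturn M ν N t (nodeOf (D.pre t ω) rec) (D.action t ω) := by
    rcases ht.eq_or_lt with rfl | hlt
    · have h0 : (fun ω => vFun ν (t + 1) (q (t + 1)) rec (D.WZA (t + 1) ω)) = 0 := by
        funext ω
        simp [vFun, hq.terminal]
      rw [h0, condExp_zero]
      exact ⟨integrable_zero _ _ _, .of_forall fun ω => by simp [contReturn]⟩
    · exact ⟨hq.integrable _ hlt rec, condExp_vFun_next hgen hproxy hobs hq hlt (hnext hlt) rec⟩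
  have hVm : Measurable fun p : (Hist U (t + 1) × ZSp O A t) × A t =>
      contReturn M ν N t (nodeOf p.1 rec) p.2 :=
    (measurable_contReturn M ν N t).comp (by fun_prop : Measurable
      fun p : (Hist U (t + 1) × ZSp O A t) × A t => (nodeOf p.1 rec, p.2))
  -- One identity for each executed action a, all under the same law of the proxy: weighted by
  -- `ν.prob` and summed, their right-hand sides form the Bellman equation.
  have key := ae_all_iff.2 fun a => integral_proxyLaw_eq hgen hproxy hobs hcompU ht hQm
    (hst.memLp rec) hv.1 hVm (fun p => hC _ _) hv.2 (hst.equation rec) a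
  filter_upwards [key] with x hx
  have hi : ∀ a, Integrable (fun w => q t w x.2 rec a * ν.prob t x.2 rec a) (D.proxyLaw P t x) :=
    fun a => (hx a).1.mul_const _
  refine ⟨integrable_finsetSum _ fun a _ => hi a, ?_⟩
  rw [integral_finsetSum _ fun a _ => hi a, expReturn_eq_sum M ν ht]
  refine Finset.sum_congr rfl fun a _ => ?_
  rw [integral_mul_const]
  exact congrArg (· * _) (hx a).2

theorem SolvesSystem.bridgeAt (hq : D.SolvesSystem P ν N q) (hgen : D.GeneratedBy M P N)
    (hproxy : D.RewardProxy P N) (hobs : D.InitialObsIndep P N) (hcompU : D.CompleteLatent P N)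
    {t : ℕ} (ht : t ≤ N) : ∀ rec, D.BridgeAt M P ν N q t rec := by
  induction ht using Nat.decreasingInduction with
  | self => exact bridgeAt_of_next hgen hproxy hobs hcompU hq le_rfl fun h => (lt_irrefl _ h).elim
  | of_succ k hk ih => exact bridgeAt_of_next hgen hproxy hobs hcompU hq hk.le fun _ => ih

/-- Every solution of the backward system is a family of Q-bridge functions. -/
theorem SolvesSystem.isQBridge (hq : D.SolvesSystem P ν N q) (hgen : D.GeneratedBy M P N)
    (hproxy : D.RewardProxy P N) (hobs : D.InitialObsIndep P N) (hcompU : D.CompleteLatent P N) :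
    D.IsQBridge P M ν N q := by
  refine ⟨fun t ht rec => ?_, (hq.stage N le_rfl).last rfl⟩
  have hm : Measurable fun p : (Hist U (t + 1) × ZSp O A t) × W t =>
      ∑ a, q t p.2 p.1.2 rec a * ν.prob t p.1.2 rec a :=
    Finset.measurable_sum _ fun a _ => (((hq.stage t ht).measurable rec a).comp
      (by fun_prop : Measurable fun p : (Hist U (t + 1) × ZSp O A t) × W t => (p.2, p.1.2))).mul
      ((ν.measurable_prob t rec a).comp (by fun_prop))
  have hXY := (D.measurable_pre t).prodMk (D.measurable_proxy t)
  filter_upwards [hq.bridgeAt hgen hproxy hobs hcompU ht rec,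
    HasCondDistrib.condLaw_map (D.measurable_pre t) (D.measurable_proxy t)
      (hasCondDistrib_condDistrib (P := P) (D.measurable_pre t) (D.measurable_proxy t))]
    with x hx hlaw
  have hxm : Measurable fun w : W t => (x, w) := by fun_prop
  refine ⟨(integrable_map_measure hm.aestronglyMeasurable hXY.aemeasurable).1 ?_,
    (integral_map hXY.aemeasurable hm.aestronglyMeasurable).symm.trans ?_⟩
  · rw [hlaw]
    exact (integrable_map_measure hm.aestronglyMeasurable hxm.aemeasurable).2 hx.1
  · rw [hlaw, integral_map hxm.aemeasurable hm.aestronglyMeasurable]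
    exact hx.2

/-- Every solution of the backward system identifies the policy value. -/
theorem SolvesSystem.value_eq (hq : D.SolvesSystem P ν N q) (hgen : D.GeneratedBy M P N)
    (hproxy : D.RewardProxy P N) (hobs : D.InitialObsIndep P N) (hcompU : D.CompleteLatent P N) :
    D.value M P ν N = ∫ ω, ∑ a, q 0 (D.proxy 0 ω) (D.Z 0 ω) (D.actHist 1 ω) a
        * ν.prob 0 (D.Z 0 ω) (D.actHist 1 ω) a ∂P := by
  have : Nonempty (A 0) := Nonempty.map (D.action 0) inferInstance
  have hΦm := measurable_expReturn M ν N 0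
  have hX : Measurable fun ω => (D.obs0 ω, D.pre 0 ω) :=
    D.measurable_obs0.prodMk (D.measurable_pre 0)
  have hΨm : Measurable fun p : (O₀ × (Hist U 1 × ZSp O A 0)) × A 0 =>
      expReturn M ν N 0 (nodeOf p.1.2 (snoc (emptyHist A) p.2)) :=
    hΦm.comp (by unfold nodeOf; fun_prop)
  have e1 := HasCondDistrib.condExp_eq hX (D.measurable_action 0)
    (hasCondDistrib_action hgen (Nat.zero_le N)) hΨm
    (Integrable.of_bound (hΨm.comp (hX.prodMk (D.measurable_action 0))).aestronglyMeasurable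
      _ (.of_forall fun _ => abs_expReturn_le M ν N 0 _))
  have e2 := condExp_vFun hproxy hobs hq (Nat.zero_le N)
    (hq.bridgeAt hgen hproxy hobs hcompU (Nat.zero_le N)) (emptyHist A)
  have hz : ∀ ω, D.actHist 0 ω = emptyHist A := fun ω => Subsingleton.elim _ _
  have h1 : (fun ω => ∑ a, q 0 (D.proxy 0 ω) (D.Z 0 ω) (D.actHist 1 ω) a
        * ν.prob 0 (D.Z 0 ω) (D.actHist 1 ω) a)
      = fun ω => vFun ν 0 (q 0) (emptyHist A) (D.WZA 0 ω) := by
    funext ω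
    have : D.actHist 1 ω = snoc (emptyHist A) (D.action 0 ω) := by
      rw [← hz ω]
      exact (snoc_hist (fun t => D.action t ω) 0).symm
    rw [this]
    rfl
  -- Both sides are the mean of `expReturn` at the first node with the recommendation drawn in the
  -- data: `e2` integrates out the proxy on the right, `e1` integrates out the action to produce
  -- `stateValue` on the left.
  rw [h1, ← integral_condExp (D.measurable_PAO 0).comap_le, integral_congr_ae e2]
  refine Eq.trans ?_ (integral_condExp hX.comap_le)
  refine Eq.trans ?_ (integral_congr_ae e1).symm
  refine integral_congr_ae (.of_forall fun ω => ?_)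
  have h2 : (D.pre 0 ω).2.2 = emptyHist A := hz ω
  simp only [stateValue, Kernel.comap_apply, nodeOf, h2]
  rfl

end Data

end SuperRL

/-! ### The main theorem -/

theorem mainTheorem4 {Ω O₀ : Type*} {U O A W : ℕ → Type*}
    [MeasurableSpace Ω] [StandardBorelSpace Ω] [Nonempty Ω]
    [MeasurableSpace O₀] [StandardBorelSpace O₀]
    [∀ t, MeasurableSpace (U t)] [∀ t, StandardBorelSpace (U t)]
    [∀ t, MeasurableSpace (O t)] [∀ t, StandardBorelSpace (O t)]
    [∀ t, MeasurableSpace (W t)] [∀ t, StandardBorelSpace (W t)]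
    [∀ t, Fintype (A t)] [∀ t, MeasurableSpace (A t)] [∀ t, MeasurableSingletonClass (A t)]
    (N : ℕ) (M : SuperRL.ConfoundedProcess U O A)
    (P : Measure Ω) [IsProbabilityMeasure P] (D : SuperRL.Data Ω O₀ U O A W)
    (hgen : D.GeneratedBy M P N)
    (hproxy : D.RewardProxy P N)
    (hobs : D.InitialObsIndep P N)
    (hcompU : D.CompleteLatent P N)
    (hcompO : D.CompleteObs P N)
    (ν : SuperRL.SuperPolicy O A)
    (G : ∀ t, Set (W t × SuperRL.ZSp O A t × A t → ℝ))
    (hreg : D.Regular P ν N G) :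
    -- each equation with a continuation in the class is solvable
    (∀ t ≤ N, ∀ g : SuperRL.Hist A (t + 1) → W (t + 1) × SuperRL.ZSp O A (t + 1) × A (t + 1) → ℝ,
      (∀ rec, g rec ∈ G (t + 1)) → ∃ q, D.SolvesStage P N t q g) ∧
    -- the backward system is solvable
    (∃ q : ∀ t, SuperRL.QFun O A W t, D.SolvesSystem P ν N q ∧
      ∀ t ≤ N, ∀ rec, SuperRL.vFun ν t (q t) rec ∈ G t) ∧
    -- every solution of the backward system consists of Q-bridge functions and gives the value
    (∀ q : ∀ t, SuperRL.QFun O A W t, D.SolvesSystem P ν N q →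
      D.IsQBridge P M ν N q ∧
      D.value M P ν N = ∫ ω, ∑ a, q 0 (D.proxy 0 ω) (D.Z 0 ω) (D.actHist 1 ω) a
        * ν.prob 0 (D.Z 0 ω) (D.actHist 1 ω) a ∂P) := by
  have : Nonempty O₀ := Nonempty.map D.obs0 inferInstance
  have : ∀ t, Nonempty (W t) := fun t => Nonempty.map (D.proxy t) inferInstance
  have : ∀ t, Nonempty (U t) := fun t => Nonempty.map (D.lat t) inferInstance
  have : ∀ t, Nonempty (O t) := fun t => Nonempty.map (D.obs t) inferInstance
  exact ⟨fun t ht g hg => SuperRL.Data.exists_solvesStage hgen hcompO hreg ht g hg,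
    SuperRL.Data.exists_solvesSystem hgen hcompO hreg,
    fun q hq => ⟨hq.isQBridge hgen hproxy hobs hcompU, hq.value_eq hgen hproxy hobs hcompU⟩⟩
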